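/- For a $p\times q$ 0-1 matrix $A$ let $\lambda(A,\ell,\mathrm{row})$ be the minimum, over all choices of $\ell$ centers in $\{0,1\}^q$, of the maximum Hamming distance between a row of $A$ and its closest center; for a $q\times r$ 0-1 matrix $B$ define $\lambda(B,k,\mathrm{col})$ analogously for the columns of $B$ and $k$ centers in $\{0,1\}^q$. The model of computation is the unit-cost word RAM with words of $O(\log(p+q+r))$ bits, with fair coin tosses. **Theorem.** For every constant $\alpha\ge 1$ there are a randomized preprocessing algorithm and a deterministic query algorithm such that the following holds for all $p,q,r$, all $\ell\in[p]$ and $k\in[r]$, and all 0-1 matrices $A$ and $B$ of sizes $p\times q$ and $q\times r$, where $C=AB$ is their arithmetic matrix product. On input $(A,B,\ell,k)$ the preprocessing always halts in time $$O\bigl(p\log p\,(q+\ell)+r\log r\,(q+k)+\ell qk+pr\bigr).$$ Afterwards each query $(i,j)\in[p]\times[r]$ is answered with the exact value of $C_{ij}$, without changing the preprocessed data, and with probability at least $1-(p+r)^{-\alpha}$ over the coin tosses of the preprocessing all queries $(i,j)$ simultaneously have query time $$O\bigl(\lambda(A,\ell,\mathrm{row})+\lambda(B,k,\mathrm{col})+1\bigr).$$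 The constants hidden in the $O$-notation, including the one in the word length, depend only on $\alpha$. -/

import Mathlib

/-! ### Center clustering in Hamming spaces -/

/-- For points `P 0, …, P (n-1)` of `{0,1}^d`: the minimum, over all choices of `k` centers in
`{0,1}^d` (not necessarily among the points), of the maximum Hamming distance between a point and
its closest center. -/
noncomputable def centerRadius {n d : ℕ} (P : Fin n → Fin d → Bool) (k : ℕ) : ℕ :=
  ⨅ T : Fin k → Fin d → Bool, Finset.univ.sup fun i => ⨅ t, hammingDist (P i) (T t)

/-- `λ(A, ℓ, row)`. -/
noncomputable def rowRadius {p q : ℕ} (A : Matrix (Fin p) (Fin q) Bool) (l : ℕ) : ℕ :=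
  centerRadius (fun i m => A i m) l

/-- `λ(B, k, col)`. -/
noncomputable def colRadius {q r : ℕ} (B : Matrix (Fin q) (Fin r) Bool) (k : ℕ) : ℕ :=
  centerRadius (fun j m => B m j) k

/-- The arithmetic (natural number) product of two 0-1 matrices. -/
def arithProduct {p q r : ℕ} (A : Matrix (Fin p) (Fin q) Bool) (B : Matrix (Fin q) (Fin r) Bool) :
    Matrix (Fin p) (Fin r) ℕ :=
  A.map Bool.toNat * B.map Bool.toNat

/-! ### A randomized word RAM with unit-cost instructions -/

namespace WordRAM

/-- Programs. Numbers `d`, `a`, `b` name registers; a program mentions finitely many registers. -/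
inductive Prog where
  /-- do nothing -/
  | skip : Prog
  /-- `reg d := n` -/
  | const (d n : ℕ) : Prog
  /-- `reg d := reg a + reg b` -/
  | add (d a b : ℕ) : Prog
  /-- `reg d := reg a - reg b`, cut off at `0` -/
  | sub (d a b : ℕ) : Prog
  /-- `reg d := reg a * reg b` -/
  | mul (d a b : ℕ) : Prog
  /-- `reg d := mem (reg a)` -/
  | load (d a : ℕ) : Prog
  /-- `mem (reg a) := reg b` -/
  | store (a b : ℕ) : Prog
  /-- `reg d :=` the outcome (`0` or `1`) of a fresh toss of a fair coin -/
  | flip (d : ℕ) : Prog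
  /-- sequential composition -/
  | seq (P Q : Prog) : Prog
  /-- `if reg a < reg b then P else Q` -/
  | ite (a b : ℕ) (P Q : Prog) : Prog
  /-- `while reg a < reg b do P` -/
  | loop (a b : ℕ) (P : Prog) : Prog

/-- The program never tosses a coin, i.e. it is deterministic. -/
def Prog.CoinFree : Prog → Prop
  | .flip _ => False
  | .seq P Q => P.CoinFree ∧ Q.CoinFree
  | .ite _ _ P Q => P.CoinFree ∧ Q.CoinFree
  | .loop _ _ P => P.CoinFree
  | _ => True

/-- A machine state: registers, addressable memory, and the number of coins tossed so far. -/
structure State where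
  reg : ℕ → ℕ
  mem : ℕ → ℕ
  coins : ℕ

/-- Assign a value to a register. -/
def State.setReg (s : State) (d v : ℕ) : State := { s with reg := Function.update s.reg d v }

/-- Assign a value to a memory cell. -/
def State.setMem (s : State) (a v : ℕ) : State := { s with mem := Function.update s.mem a v }

/-- `Exec W ω P s s' t`: started in state `s`, with `ω` the outcomes of the successive coin tosses,
`P` halts in state `s'` after exactly `t` unit-cost steps (instructions and tests). A machine word
holds a number below `W`: an instruction whose result or whose address is not below `W` cannot be
executed, so a program that halts has not overflowed. -/
inductive Exec (W : ℕ) (ω : ℕ → Bool) : Prog → State → State → ℕ → Prop where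
  | skip (s : State) : Exec W ω .skip s s 1
  | const (s : State) (d n : ℕ) (h : n < W) : Exec W ω (.const d n) s (s.setReg d n) 1
  | add (s : State) (d a b : ℕ) (h : s.reg a + s.reg b < W) :
      Exec W ω (.add d a b) s (s.setReg d (s.reg a + s.reg b)) 1
  | sub (s : State) (d a b : ℕ) (h : s.reg a - s.reg b < W) :
      Exec W ω (.sub d a b) s (s.setReg d (s.reg a - s.reg b)) 1
  | mul (s : State) (d a b : ℕ) (h : s.reg a * s.reg b < W) :
      Exec W ω (.mul d a b) s (s.setReg d (s.reg a * s.reg b)) 1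
  | load (s : State) (d a : ℕ) (h : s.reg a < W) (h' : s.mem (s.reg a) < W) :
      Exec W ω (.load d a) s (s.setReg d (s.mem (s.reg a))) 1
  | store (s : State) (a b : ℕ) (h : s.reg a < W) (h' : s.reg b < W) :
      Exec W ω (.store a b) s (s.setMem (s.reg a) (s.reg b)) 1
  | flip (s : State) (d : ℕ) (h : (ω s.coins).toNat < W) :
      Exec W ω (.flip d) s
        { s.setReg d (ω s.coins).toNat with coins := s.coins + 1 } 1
  | seq {P Q : Prog} {s s' s'' : State} {t t' : ℕ} (h : Exec W ω P s s' t)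
      (h' : Exec W ω Q s' s'' t') : Exec W ω (.seq P Q) s s'' (t + t')
  | iteTrue {a b : ℕ} {P Q : Prog} {s s' : State} {t : ℕ} (hb : s.reg a < s.reg b)
      (h : Exec W ω P s s' t) : Exec W ω (.ite a b P Q) s s' (t + 1)
  | iteFalse {a b : ℕ} {P Q : Prog} {s s' : State} {t : ℕ} (hb : ¬ s.reg a < s.reg b)
      (h : Exec W ω Q s s' t) : Exec W ω (.ite a b P Q) s s' (t + 1)
  | loopTrue {a b : ℕ} {P : Prog} {s s' s'' : State} {t t' : ℕ} (hb : s.reg a < s.reg b)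
      (h : Exec W ω P s s' t) (h' : Exec W ω (.loop a b P) s' s'' t') :
      Exec W ω (.loop a b P) s s'' (t + t' + 1)
  | loopFalse {a b : ℕ} {P : Prog} {s : State} (hb : ¬ s.reg a < s.reg b) :
      Exec W ω (.loop a b P) s s 1

/-- The law of an infinite sequence of independent fair coin tosses. -/
noncomputable def coinMeasure : MeasureTheory.Measure (ℕ → Bool) :=
  MeasureTheory.Measure.infinitePi fun _ => (PMF.uniformOfFintype Bool).toMeasure

/-- Memory contents in which `A` and then `B` are stored row by row from address `0` on; all other
cells are `0`. -/
def inputMem {p q r : ℕ} (A : Matrix (Fin p) (Fin q) Bool) (B : Matrix (Fin q) (Fin r) Bool)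
    (x : ℕ) : ℕ :=
  if x < p * q then
    if h : x / q < p ∧ x % q < q then (A ⟨x / q, h.1⟩ ⟨x % q, h.2⟩).toNat else 0
  else
    if h : (x - p * q) / r < q ∧ (x - p * q) % r < r then
      (B ⟨(x - p * q) / r, h.1⟩ ⟨(x - p * q) % r, h.2⟩).toNat
    else 0

/-- The initial state of the preprocessing: `p, q, r, l, k` in registers `0, …, 4`, all other
registers `0`, the two matrices in memory. -/
def inputState {p q r : ℕ} (A : Matrix (Fin p) (Fin q) Bool) (B : Matrix (Fin q) (Fin r) Bool)
    (l k : ℕ) : State where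
  reg x := match x with
    | 0 => p
    | 1 => q
    | 2 => r
    | 3 => l
    | 4 => k
    | _ => 0
  mem := inputMem A B
  coins := 0

/-- The initial state of a query `(i, j)` asked in state `s`: the memory is that of `s`, the
indices (counted from `0`) are in registers `0` and `1`, and all other registers are `0`. -/
def State.query (s : State) (i j : ℕ) : State where
  reg x := match x with
    | 0 => i
    | 1 => j
    | _ => 0
  mem := s.mem
  coins := s.coins

end WordRAM

/-! Random sketches approximate Hamming distances. For bits, |x - b| - |y - b| = (x - y)(1 - 2b).
Hence, for uniformly random w in {0,1}^q, the distances of x and y to w differ by a signed sum of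
dist(x, y) independent fair signs, whose typical size is the square root of dist(x, y). The sketch
of a point is the vector of its distances to D = K⌈log₂(p + r)⌉ random vectors. By a Chernoff
argument the ℓ₁-distance of two sketches lies between D/10 and 2D times √dist(x, y), except with
probability 2(97/100)^D (`card_bad_le`, `coinMeasure_not_sketchGood_le`). For K large in terms of α,
a union bound over pairs of rows and pairs of columns gives the failure probability
(`union_bound_le`).

Farthest-point clustering is run on sketch distances, which costs D rather than q per comparison. It
yields l + 1 points whose mutual sketch distances are at least the sketch distance of any point to
its center (`FarthestInv.succ`, `FarthestInv.sep_points`). Two of these points share an optimal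
center, hence have Hamming distance at most twice the radius. The two-sided sketch bound then shows
that every point is within 800 times the radius of its center (`Clustered.list_length_le`).

The preprocessing stores for every row x with center u, and every column y with center w, the
coordinates in which they differ, together with all products u·w. A query uses x·y = u·w + (u·y -
u·w) + (x·y - u·y), where the brackets only involve coordinates on the two difference lists
(`sum_correction`, `run_query`). Answers and preprocessing time are therefore right for every
outcome of the coins; only the list lengths depend on luck.

For the machine model, programs are written in a small language of variables and arrays, compiled to
the RAM, and verified by rules that carry a time bound and a frame of untouched data. All stored
values stay below a polynomial bound `B`, and `B ^ 31` is below the word size. Replacing log(p + r)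
by log p and log r in the time bound is `log_add_mul_le`. -/

namespace WordRAM

/-! ### A structured language with variables and arrays, compiled to the word RAM -/

/-- Expressions over 40 variables and 32 arrays; `raw e` reads the memory cell with address `e`. -/
inductive Ex where
  | var (x : ℕ) : Ex
  | const (n : ℕ) : Ex
  | add (e f : Ex) : Ex
  | sub (e f : Ex) : Ex
  | mul (e f : Ex) : Ex
  | get (a : ℕ) (e : Ex) : Ex
  | raw (e : Ex) : Ex

/-- The state seen by the structured language: variables, arrays, and the coins tossed. -/
@[ext] structure St where
  v : ℕ → ℕ
  m : ℕ → ℕ → ℕ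
  coins : ℕ

namespace St

def setv (σ : St) (x n : ℕ) : St := { σ with v := Function.update σ.v x n }

def setm (σ : St) (a i n : ℕ) : St :=
  { σ with m := Function.update σ.m a (Function.update (σ.m a) i n) }

@[simp] theorem setv_v (σ : St) (x n y : ℕ) : (σ.setv x n).v y = if y = x then n else σ.v y := by
  simp [setv, Function.update_apply]

@[simp] theorem setv_m (σ : St) (x n : ℕ) : (σ.setv x n).m = σ.m := rfl

@[simp] theorem setv_coins (σ : St) (x n : ℕ) : (σ.setv x n).coins = σ.coins := rfl

@[simp] theorem setm_v (σ : St) (a i n : ℕ) : (σ.setm a i n).v = σ.v := rfl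

@[simp] theorem setm_coins (σ : St) (a i n : ℕ) : (σ.setm a i n).coins = σ.coins := rfl

@[simp] theorem setm_m (σ : St) (a i n b j : ℕ) :
    (σ.setm a i n).m b j = if b = a ∧ j = i then n else σ.m b j := by
  by_cases h : b = a
  · subst h; simp [setm, Function.update_apply]
  · simp [setm, h]

theorem setm_m_of_ne (σ : St) {a b : ℕ} (i n : ℕ) (h : b ≠ a) : (σ.setm a i n).m b = σ.m b := by
  funext j; simp [h]

/-- All variables and array entries are at most `B`. -/
def Bounded (B : ℕ) (σ : St) : Prop := (∀ x, σ.v x ≤ B) ∧ ∀ a i, σ.m a i ≤ B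

end St

/-- The machine state `s` stores `σ`: variables in the registers below 40, entry `i` of array `a`
at address `32 * i + a`. -/
def Rep (σ : St) (s : State) : Prop :=
  (∀ x < 40, s.reg x = σ.v x) ∧ (∀ x, s.mem x = σ.m (x % 32) (x / 32)) ∧ s.coins = σ.coins

namespace Ex

@[simp] def eval (σ : St) : Ex → ℕ
  | var x => σ.v x
  | const n => n
  | add e f => e.eval σ + f.eval σ
  | sub e f => e.eval σ - f.eval σ
  | mul e f => e.eval σ * f.eval σ
  | get a e => σ.m a (e.eval σ)
  | raw e => σ.m (e.eval σ % 32) (e.eval σ / 32)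

-- The result lands in register `d` and only registers from `d` on are overwritten, so any `d ≥ 40`
-- leaves the variables intact. A variable is copied by adding it to 0, since the machine has no
-- move instruction.
@[simp] def comp : Ex → ℕ → Prog
  | var x, d => .seq (.const d 0) (.add d d x)
  | const n, d => .const d n
  | add e f, d => .seq (e.comp d) (.seq (f.comp (d + 1)) (.add d d (d + 1)))
  | sub e f, d => .seq (e.comp d) (.seq (f.comp (d + 1)) (.sub d d (d + 1)))
  | mul e f, d => .seq (e.comp d) (.seq (f.comp (d + 1)) (.mul d d (d + 1)))
  | get a e, d => .seq (e.comp d) (.seq (.const (d + 1) 32) (.seq (.mul d d (d + 1))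
      (.seq (.const (d + 1) a) (.seq (.add d d (d + 1)) (.load d d)))))
  | raw e, d => .seq (e.comp d) (.load d d)

@[simp] def cost : Ex → ℕ
  | var _ => 2
  | const _ => 1
  | add e f => e.cost + f.cost + 1
  | sub e f => e.cost + f.cost + 1
  | mul e f => e.cost + f.cost + 1
  | get _ e => e.cost + 5
  | raw e => e.cost + 1

-- Constants stop at 32 because `Fits` guarantees `32 ≤ B`, which makes a constant count as degree
-- 1.
@[simp] def WF : Ex → Prop
  | var x => x < 40
  | const n => n ≤ 32
  | add e f => e.WF ∧ f.WF
  | sub e f => e.WF ∧ f.WF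
  | mul e f => e.WF ∧ f.WF
  | get a e => a < 32 ∧ e.WF
  | raw e => e.WF

/-- All intermediate results are at most `B ^ deg` if variables and entries are at most `B`. -/
@[simp] def deg : Ex → ℕ
  | var _ => 1
  | const _ => 1
  | add e f => e.deg + f.deg
  | sub e f => e.deg + f.deg
  | mul e f => e.deg + f.deg
  | get _ e => e.deg + 2
  | raw e => e.deg

theorem one_le_deg (e : Ex) : 1 ≤ e.deg := by
  induction e <;> simp [deg] <;> omega

/-- Well-formed expressions of small size. -/
def Ok (e : Ex) : Prop := e.WF ∧ e.deg ≤ 28 ∧ e.cost ≤ 80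

end Ex

/-- Numbers up to `B` and all intermediate results of small expressions fit into a word. -/
structure Fits (B W : ℕ) : Prop where
  le : 32 ≤ B
  lt : B ^ 31 < W

theorem Fits.pow_lt {B W : ℕ} (h : Fits B W) {n : ℕ} (hn : n ≤ 31) : B ^ n < W :=
  lt_of_le_of_lt (Nat.pow_le_pow_right (by linarith [h.le]) hn) h.lt

theorem Fits.lt_of_le {B W n : ℕ} (h : Fits B W) (hn : n ≤ B) : n < W :=
  lt_of_le_of_lt hn (by simpa using h.pow_lt (n := 1) (by norm_num))

theorem add_le_pow_add {B x y m n : ℕ} (hB : 2 ≤ B) (hm : 1 ≤ m) (hn : 1 ≤ n) (hx : x ≤ B ^ m)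
    (hy : y ≤ B ^ n) : x + y ≤ B ^ (m + n) := by
  have h1 : 2 ≤ B ^ m := hB.trans (Nat.le_self_pow (by omega) _)
  have h2 : 2 ≤ B ^ n := hB.trans (Nat.le_self_pow (by omega) _)
  rw [pow_add]
  nlinarith

/-- Bounds the address of an array entry; this is the reason why an array access raises the degree
by 2. -/
theorem mul_add_le_pow {B x a n : ℕ} (hB : 32 ≤ B) (hx : x ≤ B ^ n) (ha : a < 32) :
    x * 32 + a ≤ B ^ (n + 2) := by
  have h2 : 1 ≤ B ^ n := Nat.one_le_pow _ _ (by omega)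
  calc x * 32 + a ≤ B ^ n * B + B ^ n * B := by
        have := Nat.mul_le_mul hx hB
        have := Nat.mul_le_mul h2 hB
        omega
    _ = B ^ n * B * 2 := by ring
    _ ≤ B ^ n * B * B := Nat.mul_le_mul_left _ (by omega)
    _ = B ^ (n + 2) := by ring

theorem Ex.eval_le {B : ℕ} (hB : 32 ≤ B) {σ : St} (hσ : σ.Bounded B) (e : Ex) (he : e.WF) :
    e.eval σ ≤ B ^ e.deg := by
  induction e with
  | var x => simpa using hσ.1 x
  | const n => simp at *; omega
  | add e f ihe ihf =>
    exact add_le_pow_add (by omega) e.one_le_deg f.one_le_deg (ihe he.1) (ihf he.2)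
  | sub e f ihe ihf =>
    exact (Nat.sub_le _ _).trans ((ihe he.1).trans
      (Nat.pow_le_pow_right (by omega) (by simp)))
  | mul e f ihe ihf => simpa [pow_add] using Nat.mul_le_mul (ihe he.1) (ihf he.2)
  | get a e ih =>
    exact (hσ.2 _ _).trans (Nat.le_self_pow (by simp) _)
  | raw e ih => exact (hσ.2 _ _).trans (Nat.le_self_pow (by have := e.one_le_deg; simp; omega) _)

/-- `s'` differs from `s` only in registers from `d` on. -/
def AgreeBelow (d : ℕ) (s s' : State) : Prop :=
  (∀ x < d, s'.reg x = s.reg x) ∧ s'.mem = s.mem ∧ s'.coins = s.coins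

theorem AgreeBelow.rep {d : ℕ} {s s' : State} {σ : St} (h : AgreeBelow d s s') (hd : 40 ≤ d)
    (hs : Rep σ s) : Rep σ s' :=
  ⟨fun x hx => (h.1 x (by omega)).trans (hs.1 x hx), fun x => by rw [h.2.1]; exact hs.2.1 x,
    h.2.2.trans hs.2.2⟩

@[simp] theorem State.setReg_reg (s : State) (d n x : ℕ) :
    (s.setReg d n).reg x = if x = d then n else s.reg x := by
  simp [State.setReg, Function.update_apply]

@[simp] theorem State.setReg_mem (s : State) (d n : ℕ) : (s.setReg d n).mem = s.mem := rfl

@[simp] theorem State.setReg_coins (s : State) (d n : ℕ) : (s.setReg d n).coins = s.coins := rfl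

theorem Ex.exec_bin {W : ℕ} {ω : ℕ → Bool} {P : ℕ → Prog} {Q : ℕ → Prog} {R : Prog} {s : State}
    {d m n k tP tQ : ℕ}
    (h1 : ∃ s', Exec W ω (P d) s s' tP ∧ s'.reg d = m ∧ AgreeBelow d s s')
    (h2 : ∀ s', AgreeBelow d s s' →
      ∃ s'', Exec W ω (Q (d + 1)) s' s'' tQ ∧ s''.reg (d + 1) = n ∧ AgreeBelow (d + 1) s' s'')
    (hR : ∀ s, s.reg d = m → s.reg (d + 1) = n → Exec W ω R s (s.setReg d k) 1) :
    ∃ s', Exec W ω (.seq (P d) (.seq (Q (d + 1)) R)) s s' (tP + tQ + 1) ∧ s'.reg d = k ∧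
      AgreeBelow d s s' := by
  obtain ⟨s1, e1, r1, a1⟩ := h1
  obtain ⟨s2, e2, r2, a2⟩ := h2 s1 a1
  refine ⟨s2.setReg d k, ?_, by simp, fun x hx => ?_, ?_, ?_⟩
  · rw [add_assoc]
    exact .seq e1 (.seq e2 (hR s2 ((a2.1 d (by omega)).trans r1) r2))
  · rw [State.setReg_reg, if_neg (by omega), a2.1 x (by omega), a1.1 x hx]
  · simpa using a2.2.1.trans a1.2.1
  · simpa using a2.2.2.trans a1.2.2

/-- Every intermediate result is at most `B` to the degree of its subexpression, hence at most `B ^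
31 < W`, so no instruction overflows. The structural induction varies `s` and `d`, because the
second operand is evaluated one register higher and after the first. -/
theorem Ex.exec_comp {B W : ℕ} (hB : Fits B W) {σ : St} (hσ : σ.Bounded B) (ω : ℕ → Bool) (e : Ex)
    (he : e.WF) (hd : e.deg ≤ 31) (s : State) (hs : Rep σ s) (d : ℕ) (h40 : 40 ≤ d) :
    ∃ s', Exec W ω (e.comp d) s s' e.cost ∧ s'.reg d = e.eval σ ∧ AgreeBelow d s s' := by
  have key : ∀ f : Ex, f.WF → f.deg ≤ 31 → f.eval σ < W := fun f hf hfd =>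
    lt_of_le_of_lt (f.eval_le hB.le hσ hf) (hB.pow_lt hfd)
  have h0 : 32 < W := lt_of_le_of_lt hB.le (hB.lt_of_le le_rfl)
  induction e generalizing s d with
  | var x =>
    refine ⟨(s.setReg d 0).setReg d (σ.v x), ?_, by simp, fun y hy => ?_, rfl, rfl⟩
    · have hx : (s.setReg d 0).reg x = σ.v x := by
        have : x < 40 := he
        rw [State.setReg_reg, if_neg (by omega), hs.1 x he]
      have := Exec.add (W := W) (ω := ω) (s.setReg d 0) d d x
      rw [hx] at this
      simp only [State.setReg_reg, if_true, zero_add] at this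
      exact .seq (.const s d 0 (by omega)) (this (key _ he hd))
    · simp [show y ≠ d by omega]
  | const n =>
    refine ⟨s.setReg d n, .const s d n (by simp at he; omega), by simp, fun y hy => ?_, rfl, rfl⟩
    simp [show y ≠ d by omega]
  | add e f ihe ihf =>
    have hk := key _ he hd
    simp only [deg] at hd
    refine Ex.exec_bin (ihe he.1 (by omega) s hs d h40) (fun s' a => ihf he.2 (by omega) s'
      (a.rep h40 hs) (d + 1) (by omega)) fun s2 h1 h2 => ?_
    have := Exec.add (W := W) (ω := ω) s2 d d (d + 1)
    rw [h1, h2] at this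
    exact this hk
  | sub e f ihe ihf =>
    have hk := key _ he hd
    simp only [deg] at hd
    refine Ex.exec_bin (ihe he.1 (by omega) s hs d h40) (fun s' a => ihf he.2 (by omega) s'
      (a.rep h40 hs) (d + 1) (by omega)) fun s2 h1 h2 => ?_
    have := Exec.sub (W := W) (ω := ω) s2 d d (d + 1)
    rw [h1, h2] at this
    exact this hk
  | mul e f ihe ihf =>
    have hk := key _ he hd
    simp only [deg] at hd
    refine Ex.exec_bin (ihe he.1 (by omega) s hs d h40) (fun s' a => ihf he.2 (by omega) s'
      (a.rep h40 hs) (d + 1) (by omega)) fun s2 h1 h2 => ?_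
    have := Exec.mul (W := W) (ω := ω) s2 d d (d + 1)
    rw [h1, h2] at this
    exact this hk
  | get a e ih =>
    have ha : a < 32 := he.1
    simp only [deg] at hd
    obtain ⟨s1, e1, r1, a1⟩ := ih he.2 (by omega) s hs d h40
    have hle := e.eval_le hB.le hσ he.2
    have hadr : e.eval σ * 32 + a < W := by
      exact lt_of_le_of_lt (mul_add_le_pow hB.le hle ha) (hB.pow_lt hd)
    have hmem : s1.mem (e.eval σ * 32 + a) = σ.m a (e.eval σ) := by
      rw [(a1.rep h40 hs).2.1]
      congr 1
      · omega
      · omega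
    set x := e.eval σ with hx
    set s2 := s1.setReg (d + 1) 32
    set s3 := s2.setReg d (x * 32)
    set s4 := s3.setReg (d + 1) a
    set s5 := s4.setReg d (x * 32 + a)
    have f2 : Exec W ω (.const (d + 1) 32) s1 s2 1 := .const _ _ _ h0
    have f3 : Exec W ω (.mul d d (d + 1)) s2 s3 1 := by
      have := Exec.mul (W := W) (ω := ω) s2 d d (d + 1)
      simp only [s2, State.setReg_reg, if_true, r1, if_neg (show d ≠ d + 1 by omega)] at this
      exact this (by omega)
    have f4 : Exec W ω (.const (d + 1) a) s3 s4 1 := .const _ _ _ (by omega)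
    have f5 : Exec W ω (.add d d (d + 1)) s4 s5 1 := by
      have := Exec.add (W := W) (ω := ω) s4 d d (d + 1)
      simp only [s4, s3, State.setReg_reg, if_true, if_neg (show d ≠ d + 1 by omega)] at this
      exact this (by omega)
    have f6 : Exec W ω (.load d d) s5 (s5.setReg d (σ.m a x)) 1 := by
      have := Exec.load (W := W) (ω := ω) s5 d d
      simp only [s5, State.setReg_reg, if_true] at this
      have h5 : (s4.setReg d (x * 32 + a)).mem = s1.mem := rfl
      rw [h5, hmem] at this
      exact this hadr (hB.lt_of_le (hσ.2 _ _))
    refine ⟨s5.setReg d (σ.m a x), .seq e1 (.seq f2 (.seq f3 (.seq f4 (.seq f5 f6)))), by simp [hx],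
      fun y hy => ?_, a1.2.1, a1.2.2⟩
    simp only [s5, s4, s3, s2, State.setReg_reg, if_neg (show y ≠ d by omega),
      if_neg (show y ≠ d + 1 by omega)]
    exact a1.1 y hy
  | raw e ih =>
    simp only [deg] at hd
    obtain ⟨s1, e1, r1, a1⟩ := ih he hd s hs d h40
    have hmem := (a1.rep h40 hs).2.1 (e.eval σ)
    refine ⟨s1.setReg d (σ.m (e.eval σ % 32) (e.eval σ / 32)), .seq e1 ?_, by simp,
      fun y hy => ?_, a1.2.1, a1.2.2⟩
    · have := Exec.load (W := W) (ω := ω) s1 d d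
      rw [r1, hmem] at this
      exact this (key e he hd) (hB.lt_of_le (hσ.2 _ _))
    · rw [State.setReg_reg, if_neg (by omega), a1.1 y hy]

/-! ### Commands, their compilation and their frames -/

/-- Commands; `loop x y C` runs `C` for `x = 0, …, y - 1`. -/
inductive Cmd where
  | skip : Cmd
  | const (x n : ℕ) : Cmd
  | set (x : ℕ) (e : Ex) : Cmd
  | put (a : ℕ) (i e : Ex) : Cmd
  | flip (x : ℕ) : Cmd
  | seq (C D : Cmd) : Cmd
  | ite (e f : Ex) (C D : Cmd) : Cmd
  | loop (x y : ℕ) (C : Cmd) : Cmd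

namespace Cmd

/-- Temporaries start at register 40. In `put` the finished address waits in register 40 while the
value is computed from register 41 on. -/
def comp : Cmd → Prog
  | skip => .skip
  | const x n => .const x n
  | set x e => .seq (e.comp 40) (.seq (.const 41 0) (.add x 40 41))
  | put a i e => .seq (i.comp 40) (.seq (.const 41 32) (.seq (.mul 40 40 41)
      (.seq (.const 41 a) (.seq (.add 40 40 41) (.seq (e.comp 41) (.store 40 41))))))
  | flip x => .flip x
  | seq C D => .seq C.comp D.comp
  | ite e f C D => .seq (e.comp 40) (.seq (f.comp 41) (.ite 40 41 C.comp D.comp))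
  | loop x y C => .seq (.const x 0) (.loop x y (.seq C.comp (.seq (.const 40 1) (.add x x 40))))

/-- The command does not assign to the variable `x`. -/
@[simp] def Keeps (x : ℕ) : Cmd → Prop
  | skip => True
  | const y _ => x ≠ y
  | set y _ => x ≠ y
  | put _ _ _ => True
  | flip y => x ≠ y
  | seq C D => C.Keeps x ∧ D.Keeps x
  | ite _ _ C D => C.Keeps x ∧ D.Keeps x
  | loop y _ C => x ≠ y ∧ C.Keeps x

/-- The command does not write to the array `a`. -/
@[simp] def KeepsArr (a : ℕ) : Cmd → Prop
  | skip => True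
  | const _ _ => True
  | set _ _ => True
  | put b _ _ => a ≠ b
  | flip _ => True
  | seq C D => C.KeepsArr a ∧ D.KeepsArr a
  | ite _ _ C D => C.KeepsArr a ∧ D.KeepsArr a
  | loop _ _ C => C.KeepsArr a

@[simp] def NoFlip : Cmd → Prop
  | flip _ => False
  | seq C D => C.NoFlip ∧ D.NoFlip
  | ite _ _ C D => C.NoFlip ∧ D.NoFlip
  | loop _ _ C => C.NoFlip
  | _ => True

end Cmd

theorem Ex.coinFree_comp (e : Ex) (d : ℕ) : (e.comp d).CoinFree := by
  induction e generalizing d <;> simp_all [Prog.CoinFree]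

theorem Cmd.coinFree_comp (C : Cmd) (h : C.NoFlip) : C.comp.CoinFree := by
  induction C <;> simp_all [Cmd.comp, Prog.CoinFree, Ex.coinFree_comp]

/-- `σ'` agrees with `σ` on everything that `C` never writes to. -/
def Frame (C : Cmd) (σ σ' : St) : Prop :=
  (∀ x, C.Keeps x → σ'.v x = σ.v x) ∧ (∀ a, C.KeepsArr a → σ'.m a = σ.m a) ∧
    (C.NoFlip → σ'.coins = σ.coins)

theorem Frame.refl (C : Cmd) (σ : St) : Frame C σ σ := ⟨fun _ _ => rfl, fun _ _ => rfl, fun _ => rfl⟩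

/-- Total correctness: started in a state bounded by `B`, the command halts after at most `t` steps
in a state bounded by `B` that satisfies `Q`. -/
def Run (B W : ℕ) (ω : ℕ → Bool) (C : Cmd) (σ : St) (t : ℕ) (Q : St → Prop) : Prop :=
  σ.Bounded B → ∀ s, Rep σ s → ∃ s' t' σ', Exec W ω C.comp s s' t' ∧ t' ≤ t ∧ Rep σ' s' ∧
    σ'.Bounded B ∧ Frame C σ σ' ∧ Q σ'

/-! ### Proof rules for total correctness with time bounds -/

section Rules

variable {B W : ℕ} {ω : ℕ → Bool} {σ : St} {t : ℕ} {Q : St → Prop}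

theorem Run.mono {C : Cmd} {t' : ℕ} {Q' : St → Prop} (h : Run B W ω C σ t Q) (ht : t ≤ t')
    (hQ : ∀ σ', Frame C σ σ' → σ'.Bounded B → Q σ' → Q' σ') : Run B W ω C σ t' Q' := by
  intro hb s hs
  obtain ⟨s', u, σ', e, hu, r, b, f, q⟩ := h hb s hs
  exact ⟨s', u, σ', e, hu.trans ht, r, b, f, hQ σ' f b q⟩

theorem Run.bounded {C : Cmd} (h : σ.Bounded B → Run B W ω C σ t Q) : Run B W ω C σ t Q :=
  fun hb => h hb hb

theorem St.Bounded.setv (h : σ.Bounded B) {x n : ℕ} (hn : n ≤ B) : (σ.setv x n).Bounded B :=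
  ⟨fun y => by rw [St.setv_v]; split_ifs; exacts [hn, h.1 y], h.2⟩

theorem St.Bounded.setm (h : σ.Bounded B) {a i n : ℕ} (hn : n ≤ B) : (σ.setm a i n).Bounded B :=
  ⟨h.1, fun b j => by rw [St.setm_m]; split_ifs; exacts [hn, h.2 b j]⟩

theorem Rep.setReg {s : State} (h : Rep σ s) (x n : ℕ) : Rep (σ.setv x n) (s.setReg x n) :=
  ⟨fun y hy => by simp [h.1 y hy], h.2.1, h.2.2⟩

theorem run_skip (h : Q σ) (ht : 1 ≤ t := by norm_num) : Run B W ω .skip σ t Q := by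
  intro hb s hs
  exact ⟨s, 1, σ, .skip s, ht, hs, hb, .refl _ _, h⟩

theorem run_const (hB : Fits B W) {x n : ℕ} (hn : n ≤ B) (hQ : Q (σ.setv x n)) :
    Run B W ω (.const x n) σ 100 Q := by
  intro hb s hs
  refine ⟨s.setReg x n, 1, σ.setv x n, .const _ _ _ (hB.lt_of_le hn), by norm_num, hs.setReg _ _,
    hb.setv hn, ⟨fun y hy => ?_, fun _ _ => rfl, fun _ => rfl⟩, hQ⟩
  have : y ≠ x := hy
  simp [this]

theorem run_set (hB : Fits B W) {x : ℕ} {e : Ex} (_ : x < 40) (he : e.Ok)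
    (hle : σ.Bounded B → e.eval σ ≤ B) (hQ : Q (σ.setv x (e.eval σ))) :
    Run B W ω (.set x e) σ 100 Q := by
  intro hb s hs
  obtain ⟨h1, h2, h3⟩ := he
  obtain ⟨s1, e1, r1, a1⟩ := e.exec_comp hB hb ω h1 (by omega) s hs 40 le_rfl
  have hlt := hB.lt_of_le (hle hb)
  set s2 := s1.setReg 41 0
  have f2 : Exec W ω (.const 41 0) s1 s2 1 := .const _ _ _ (by omega)
  have f3 : Exec W ω (.add x 40 41) s2 (s2.setReg x (e.eval σ)) 1 := by
    have := Exec.add (W := W) (ω := ω) s2 x 40 41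
    simp only [s2, State.setReg_reg] at this
    norm_num [r1] at this
    exact this hlt
  refine ⟨_, _, σ.setv x (e.eval σ), .seq e1 (.seq f2 f3), by omega, ?_, hb.setv (hle hb),
    ⟨fun y hy => ?_, fun _ _ => rfl, fun _ => rfl⟩, hQ⟩
  · refine Rep.setReg ⟨fun y hy => ?_, fun y => ?_, ?_⟩ _ _
    · simp only [s2, State.setReg_reg, if_neg (show y ≠ 41 by omega), (a1.rep le_rfl hs).1 y hy]
    · exact (a1.rep le_rfl hs).2.1 y
    · exact (a1.rep le_rfl hs).2.2
  · have : y ≠ x := hy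
    simp [this]

theorem run_flip (hB : Fits B W) {x : ℕ}
    (hQ : Q { σ.setv x (ω σ.coins).toNat with coins := σ.coins + 1 }) :
    Run B W ω (.flip x) σ 100 Q := by
  intro hb s hs
  have h1 : (ω s.coins).toNat ≤ B := (Bool.toNat_le _).trans (by linarith [hB.le])
  have e := Exec.flip (W := W) (ω := ω) s x (hB.lt_of_le h1)
  rw [hs.2.2] at e h1
  refine ⟨_, _, { σ.setv x (ω σ.coins).toNat with coins := σ.coins + 1 }, e, by norm_num,
    ⟨(hs.setReg _ _).1, hs.2.1, rfl⟩, ?_,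
    ⟨fun y hy => ?_, fun _ _ => rfl, fun h => h.elim⟩, hQ⟩
  · exact ⟨(hb.setv h1).1, hb.2⟩
  · have : y ≠ x := hy
    change (σ.setv x _).v y = _
    simp [this]

theorem run_put (hB : Fits B W) {a : ℕ} {i e : Ex} (ha : a < 32) (hi : i.Ok) (he : e.Ok)
    (hle : σ.Bounded B → e.eval σ ≤ B) (hQ : Q (σ.setm a (i.eval σ) (e.eval σ))) :
    Run B W ω (.put a i e) σ 200 Q := by
  intro hb s hs
  obtain ⟨i1, i2, i3⟩ := hi
  obtain ⟨h1, h2, h3⟩ := he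
  obtain ⟨s1, e1, r1, a1⟩ := i.exec_comp hB hb ω i1 (by omega) s hs 40 le_rfl
  have hlt := hB.lt_of_le (hle hb)
  have h32 : 32 < W := hB.lt_of_le hB.le
  have hadr : i.eval σ * 32 + a < W := by
    exact lt_of_le_of_lt (mul_add_le_pow hB.le (i.eval_le hB.le hb i1) ha) (hB.pow_lt (by omega))
  set x := i.eval σ
  set s2 := s1.setReg 41 32
  set s3 := s2.setReg 40 (x * 32)
  set s4 := s3.setReg 41 a
  set s5 := s4.setReg 40 (x * 32 + a)
  have f2 : Exec W ω (.const 41 32) s1 s2 1 := .const _ _ _ h32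
  have f3 : Exec W ω (.mul 40 40 41) s2 s3 1 := by
    have := Exec.mul (W := W) (ω := ω) s2 40 40 41
    simp only [s2, State.setReg_reg] at this
    norm_num [r1] at this
    exact this (by omega)
  have f4 : Exec W ω (.const 41 a) s3 s4 1 := .const _ _ _ (by omega)
  have f5 : Exec W ω (.add 40 40 41) s4 s5 1 := by
    have := Exec.add (W := W) (ω := ω) s4 40 40 41
    simp only [s4, s3, State.setReg_reg] at this
    norm_num at this
    exact this (by omega)
  have rep1 := a1.rep le_rfl hs
  have rep5 : Rep σ s5 := by
    refine ⟨fun y hy => ?_, fun y => rep1.2.1 y, rep1.2.2⟩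
    simp only [s5, s4, s3, s2, State.setReg_reg, if_neg (show y ≠ 41 by omega),
      if_neg (show y ≠ 40 by omega), rep1.1 y hy]
  obtain ⟨s6, e6, r6, a6⟩ := e.exec_comp hB hb ω h1 (by omega) s5 rep5 41 (by norm_num)
  have rep6 := a6.rep (by norm_num) rep5
  have r6' : s6.reg 40 = x * 32 + a := by rw [a6.1 40 (by norm_num)]; simp [s5]
  have f7 : Exec W ω (.store 40 41) s6 (s6.setMem (x * 32 + a) (e.eval σ)) 1 := by
    have := Exec.store (W := W) (ω := ω) s6 40 41
    rw [r6, r6'] at this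
    exact this hadr hlt
  refine ⟨_, _, σ.setm a x (e.eval σ), .seq e1 (.seq f2 (.seq f3 (.seq f4 (.seq f5 (.seq e6 f7))))),
    by omega, ⟨rep6.1, fun y => ?_, rep6.2.2⟩, hb.setm (hle hb), ⟨fun _ _ => rfl, fun b hb' => ?_,
      fun _ => rfl⟩, hQ⟩
  · simp only [State.setMem, Function.update_apply, rep6.2.1 y, St.setm_m]
    exact if_congr (by omega) rfl rfl
  · exact St.setm_m_of_ne _ _ _ hb'

theorem run_seq {C D : Cmd} {t' : ℕ} {R : St → Prop} (hC : Run B W ω C σ t R)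
    (hD : ∀ σ', Frame C σ σ' → R σ' → Run B W ω D σ' t' Q) :
    Run B W ω (.seq C D) σ (t + t') Q := by
  intro hb s hs
  obtain ⟨s1, t1, σ1, e1, ht1, r1, b1, f1, q1⟩ := hC hb s hs
  obtain ⟨s2, t2, σ2, e2, ht2, r2, b2, f2, q2⟩ := hD σ1 f1 q1 b1 s1 r1
  exact ⟨s2, _, σ2, .seq e1 e2, by omega, r2, b2, ⟨fun x h => (f2.1 x h.2).trans (f1.1 x h.1),
    fun x h => (f2.2.1 x h.2).trans (f1.2.1 x h.1),
    fun h => (f2.2.2 h.2).trans (f1.2.2 h.1)⟩, q2⟩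

/-- Sequencing where the first command's postcondition is the second one's specification. -/
theorem run_seq' {C D : Cmd} {t' : ℕ} (hC : Run B W ω C σ t fun σ' => Run B W ω D σ' t' Q) :
    Run B W ω (.seq C D) σ (t + t') Q :=
  run_seq hC fun _ _ h => h

theorem run_ite (hB : Fits B W) {e f : Ex} {C D : Cmd} (he : e.Ok) (hf : f.Ok)
    (hC : e.eval σ < f.eval σ → Run B W ω C σ t Q) (hD : ¬ e.eval σ < f.eval σ → Run B W ω D σ t Q) :
    Run B W ω (.ite e f C D) σ (t + 200) Q := by
  intro hb s hs
  obtain ⟨h1, h2, h3⟩ := he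
  obtain ⟨i1, i2, i3⟩ := hf
  obtain ⟨s1, e1, r1, a1⟩ := e.exec_comp hB hb ω h1 (by omega) s hs 40 le_rfl
  obtain ⟨s2, e2, r2, a2⟩ := f.exec_comp hB hb ω i1 (by omega) s1 (a1.rep le_rfl hs) 41 (by norm_num)
  have rep2 := a2.rep (by norm_num) (a1.rep le_rfl hs)
  have r1' : s2.reg 40 = e.eval σ := by rw [a2.1 40 (by norm_num), r1]
  by_cases h : e.eval σ < f.eval σ
  · obtain ⟨s3, t3, σ3, e3, ht3, r3, b3, f3, q3⟩ := hC h hb s2 rep2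
    exact ⟨s3, _, σ3, .seq e1 (.seq e2 (.iteTrue (by rwa [r1', r2]) e3)), by omega, r3, b3,
      ⟨fun x h => f3.1 x h.1, fun x h => f3.2.1 x h.1, fun h => f3.2.2 h.1⟩, q3⟩
  · obtain ⟨s3, t3, σ3, e3, ht3, r3, b3, f3, q3⟩ := hD h hb s2 rep2
    exact ⟨s3, _, σ3, .seq e1 (.seq e2 (.iteFalse (by rwa [r1', r2]) e3)), by omega, r3, b3,
      ⟨fun x h => f3.1 x h.2, fun x h => f3.2.1 x h.2, fun h => f3.2.2 h.2⟩, q3⟩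

/-- The body keeps the counter and the limit, so the loop makes exactly `n` rounds. The body has to
establish the invariant for the state after the increment, which spares a separate argument for the
increment; the frame is always taken relative to the state before the loop. -/
theorem run_loop (hB : Fits B W) {x y n : ℕ} {C : Cmd} (I : ℕ → St → Prop) (hn : σ.v y = n)
    (hx : C.Keeps x) (hy : C.Keeps y) (hxy : y ≠ x) (hx40 : x < 40) (hy40 : y < 40)
    (h0 : I 0 (σ.setv x 0))
    (step : ∀ i < n, ∀ σ', Frame (.loop x y C) σ σ' → σ'.v x = i → I i σ' →
      Run B W ω C σ' t fun σ'' => I (i + 1) (σ''.setv x (i + 1)))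
    (fin : ∀ σ', Frame (.loop x y C) σ σ' → σ'.v x = n → I n σ' → Q σ') :
    Run B W ω (.loop x y C) σ (n * (t + 10) + 10) Q := by
  intro hb s hs
  have hW : 32 < W := hB.lt_of_le hB.le
  -- Induction on the number `j` of remaining rounds, since an execution of the loop is unfolded
  -- from its first round.
  have main : ∀ j i, i + j = n → ∀ σ' s', Frame (.loop x y C) σ σ' → σ'.v x = i → I i σ' →
      σ'.Bounded B → Rep σ' s' → ∃ s'' t' σ'',
        Exec W ω (.loop x y (.seq C.comp (.seq (.const 40 1) (.add x x 40)))) s' s'' t' ∧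
        t' ≤ j * (t + 10) + 1 ∧ Rep σ'' s'' ∧ σ''.Bounded B ∧ Frame (.loop x y C) σ σ'' ∧ Q σ'' := by
    intro j
    induction j with
    | zero =>
      intro i hi σ' s' F hxi hI b r
      obtain rfl : i = n := by omega
      refine ⟨s', 1, σ', .loopFalse ?_, by omega, r, b, F, fin σ' F hxi hI⟩
      rw [r.1 x hx40, r.1 y hy40, hxi, F.1 y ⟨hxy, hy⟩, hn]
      exact lt_irrefl _
    | succ j ih =>
      intro i hi σ' s' F hxi hI b r
      obtain ⟨s1, t1, σ1, e1, ht1, r1, b1, f1, q1⟩ := step i (by omega) σ' F hxi hI b s' r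
      have hyn : σ'.v y = n := by rw [F.1 y ⟨hxy, hy⟩, hn]
      have hnB : n ≤ B := hyn ▸ b.1 y
      have hx1 : s1.reg x = i := by rw [r1.1 x hx40, f1.1 x hx, hxi]
      set s2 := s1.setReg 40 1
      have e2 : Exec W ω (.const 40 1) s1 s2 1 := .const _ _ _ (by omega)
      have e3 : Exec W ω (.add x x 40) s2 (s2.setReg x (i + 1)) 1 := by
        have := Exec.add (W := W) (ω := ω) s2 x x 40
        simp only [s2, State.setReg_reg, if_neg (show x ≠ 40 by omega), hx1, if_true] at this
        exact this (hB.lt_of_le (by omega))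
      have r2 : Rep σ1 s2 := by
        refine ⟨fun z hz => ?_, r1.2.1, r1.2.2⟩
        simp only [s2, State.setReg_reg, if_neg (show z ≠ 40 by omega), r1.1 z hz]
      obtain ⟨s4, t4, σ4, e4, ht4, r4, b4, f4, q4⟩ := ih (i + 1) (by omega) (σ1.setv x (i + 1))
        (s2.setReg x (i + 1))
        ⟨fun z hz => by rw [St.setv_v, if_neg hz.1, f1.1 z hz.2, F.1 z hz],
          fun a ha => by rw [St.setv_m, f1.2.1 a ha, F.2.1 a ha],
          fun h => by rw [St.setv_coins, f1.2.2 h, F.2.2 h]⟩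
        (by simp) q1 (b1.setv (by omega)) (r2.setReg _ _)
      refine ⟨s4, _, σ4, .loopTrue ?_ (.seq e1 (.seq e2 e3)) e4, ?_, r4, b4, f4, q4⟩
      · rw [r.1 x hx40, r.1 y hy40, hxi, hyn]; omega
      · rw [Nat.succ_mul]; omega
  obtain ⟨s', t', σ', e, ht, r, b, f, q⟩ := main n 0 (by omega) (σ.setv x 0) (s.setReg x 0)
    ⟨fun z hz => by rw [St.setv_v, if_neg hz.1], fun _ _ => rfl, fun _ => rfl⟩ (by simp) h0
    (hb.setv (Nat.zero_le _)) (hs.setReg _ _)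
  exact ⟨s', _, σ', .seq (.const _ _ _ (by omega)) e, by omega, r, b, f, q⟩

end Rules

/-! ### Derived commands: distances, summation and filling of arrays -/

/-- The distance of two natural numbers. -/
def absDiff (x y : ℕ) : ℕ := (x - y) + (y - x)

theorem absDiff_le {x y b : ℕ} (hx : x ≤ b) (hy : y ≤ b) : absDiff x y ≤ b := by
  unfold absDiff; omega

theorem absDiff_pos {x y : ℕ} : 0 < absDiff x y ↔ x ≠ y := by
  unfold absDiff; omega

namespace Ex

def absDiff (e f : Ex) : Ex := add (sub e f) (sub f e)

@[simp] theorem eval_absDiff (e f : Ex) (σ : St) :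
    (absDiff e f).eval σ = WordRAM.absDiff (e.eval σ) (f.eval σ) := rfl

end Ex

namespace Cmd

/-- `z := ∑ x < y, e` -/
def sumTo (x y z : ℕ) (e : Ex) : Cmd :=
  seq (set z (.const 0)) (loop x y (set z (.add (.var z) e)))

@[simp] theorem keeps_sumTo {w x y z : ℕ} {e : Ex} : (sumTo x y z e).Keeps w ↔ w ≠ x ∧ w ≠ z := by
  simp [sumTo]

@[simp] theorem keepsArr_sumTo {a x y z : ℕ} {e : Ex} : (sumTo x y z e).KeepsArr a := by
  simp [sumTo]

@[simp] theorem noFlip_sumTo {x y z : ℕ} {e : Ex} : (sumTo x y z e).NoFlip := by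
  simp [sumTo]

/-- Fill the array `a` row by row with the values of `z` computed by `C` for `x < nx`, `y < ny`. -/
def fill (a x nx y ny z : ℕ) (C : Cmd) : Cmd :=
  loop x nx (loop y ny (seq C (put a (.add (.mul (.var x) (.var ny)) (.var y)) (.var z))))

@[simp] theorem keeps_fill {w a x nx y ny z : ℕ} {C : Cmd} :
    (fill a x nx y ny z C).Keeps w ↔ w ≠ x ∧ w ≠ y ∧ C.Keeps w := by
  simp [fill]

@[simp] theorem keepsArr_fill {b a x nx y ny z : ℕ} {C : Cmd} :
    (fill a x nx y ny z C).KeepsArr b ↔ C.KeepsArr b ∧ b ≠ a := by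
  simp [fill]

@[simp] theorem noFlip_fill {a x nx y ny z : ℕ} {C : Cmd} :
    (fill a x nx y ny z C).NoFlip ↔ C.NoFlip := by
  simp [fill]

end Cmd

theorem Frame.m_eq {C : Cmd} {σ σ' : St} (h : Frame C σ σ') (hC : ∀ a, C.KeepsArr a) :
    σ'.m = σ.m := funext fun a => h.2.1 a (hC a)

theorem row_index_inj {m i i' j j' : ℕ} (hj : j < m) (hj' : j' < m)
    (h : i * m + j = i' * m + j') : i = i' ∧ j = j' := by
  have h1 : (i * m + j) / m = i := by
    rw [mul_comm, Nat.mul_add_div (by omega), Nat.div_eq_of_lt hj, add_zero]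
  have h2 : (i' * m + j') / m = i' := by
    rw [mul_comm, Nat.mul_add_div (by omega), Nat.div_eq_of_lt hj', add_zero]
  rw [h] at h1
  obtain rfl := h1.symm.trans h2
  exact ⟨rfl, by omega⟩

section Rules

variable {B W : ℕ} {ω : ℕ → Bool} {σ : St} {t : ℕ} {Q : St → Prop}

/-- Terms are natural numbers, so all partial sums are below the full sum and only the latter has to
be bounded by `B`. The summand is evaluated in states that differ from the initial one at most in
the counter and the accumulator. -/
theorem run_sumTo (hB : Fits B W) {x y z n : ℕ} {e : Ex} (f : ℕ → ℕ) (hn : σ.v y = n)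
    (hyx : y ≠ x) (hzx : z ≠ x) (hyz : y ≠ z) (hx : x < 40) (hy : y < 40) (hz : z < 40)
    (he : (Ex.add (.var z) e).Ok)
    (hf : ∀ i < n, ∀ σ' : St, σ'.m = σ.m → (∀ w, w ≠ x → w ≠ z → σ'.v w = σ.v w) → σ'.v x = i →
      e.eval σ' = f i)
    (hsum : ∑ i ∈ Finset.range n, f i ≤ B) :
    Run B W ω (.sumTo x y z e) σ (n * 110 + 110)
      fun σ' => σ'.v z = ∑ i ∈ Finset.range n, f i := by
  rw [show n * 110 + 110 = 100 + (n * (100 + 10) + 10) by ring]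
  refine run_seq' (run_set hB hz (by simp [Ex.Ok]) (by simp) ?_)
  refine run_loop hB (fun i σ' => σ'.v z = ∑ j ∈ Finset.range i, f j) (by simp [hyz, hn])
    (by simpa using hzx.symm) (by simpa using hyz) hyx hx hy (by simp [hzx]) ?_ fun _ _ _ h => h
  intro i hi σ' F hxi hI
  have he' : e.eval σ' = f i := by
    refine hf i hi σ' (F.m_eq (by simp)) (fun w h1 h2 => ?_) hxi
    rw [F.1 w (by simp [h1, h2])]; simp [h2]
  have hle : (Ex.add (.var z) e).eval σ' = ∑ j ∈ Finset.range (i + 1), f j := by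
    simp [hI, he', Finset.sum_range_succ]
  refine run_set hB hz he (fun _ => ?_) ?_
  · rw [hle]
    refine le_trans ?_ hsum
    exact Finset.sum_le_sum_of_subset (Finset.range_subset_range.2 (by omega))
  · simp only [hle]; simp [hzx]

theorem run_fill (hB : Fits B W) {a x nx y ny z n m : ℕ} {C : Cmd} (f : ℕ → ℕ → ℕ)
    (hn : σ.v nx = n) (hm : σ.v ny = m) (h40 : x < 40 ∧ nx < 40 ∧ y < 40 ∧ ny < 40 ∧ z < 40)
    (ha : a < 32) (hxy : x ≠ y ∧ nx ≠ x ∧ nx ≠ y ∧ ny ≠ x ∧ ny ≠ y)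
    (hC : C.Keeps x ∧ C.Keeps nx ∧ C.Keeps y ∧ C.Keeps ny) (hCa : C.KeepsArr a)
    (hf : ∀ i < n, ∀ j < m, ∀ σ', Frame (.fill a x nx y ny z C) σ σ' → σ'.v x = i → σ'.v y = j →
      Run B W ω C σ' t fun σ'' => σ''.v z = f i j) :
    Run B W ω (.fill a x nx y ny z C) σ (n * (m * (t + 210) + 20) + 10)
      fun σ' => ∀ i < n, ∀ j < m, σ'.m a (i * m + j) = f i j := by
  rw [show n * (m * (t + 210) + 20) + 10 = n * ((m * ((t + 200) + 10) + 10) + 10) + 10 by ring]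
  obtain ⟨hC1, hC2, hC3, hC4⟩ := hC
  obtain ⟨x1, x2, x3, x4, x5⟩ := hxy
  obtain ⟨l1, l2, l3, l4, l5⟩ := h40
  refine run_loop hB (fun i σ' => ∀ i' < i, ∀ j < m, σ'.m a (i' * m + j) = f i' j) hn
    (by simp [x1, hC1]) (by simp [x3, hC2]) x2 l1 l2 (by simp) ?_ fun _ _ _ h => h
  intro i hi σ1 F1 hx1 hI1
  have hm1 : σ1.v ny = m := by rw [F1.1 ny (by simp [*]), hm]
  -- The inner invariant covers all positions lexicographically before `(i, j)`, so that finished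
  -- rows survive; `row_index_inj` ensures that writing one position leaves the others alone.
  refine run_loop hB (fun j σ' => ∀ i' j', j' < m → (i' < i ∨ i' = i ∧ j' < j) →
      σ'.m a (i' * m + j') = f i' j') hm1
    (by simp [hC3]) (by simp [hC4]) x5 l3 l4
    (by simp only [St.setv_m]; intro i' j' hj' h; exact hI1 i' (by omega) j' hj') ?_ ?_
  · intro j hj σ2 F2 hy2 hI2
    have hx2 : σ2.v x = i := by rw [F2.1 x (by simp [*]), hx1]
    have hm2 : σ2.v ny = m := by rw [F2.1 ny (by simp [*]), hm1]
    refine run_seq (hf i hi j hj σ2 ⟨fun w hw => ?_, fun b hb => ?_, fun h => ?_⟩ hx2 hy2) ?_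
    · rw [Cmd.keeps_fill] at hw
      rw [F2.1 w (by simp [hw]), F1.1 w (by simp [hw])]
    · rw [Cmd.keepsArr_fill] at hb
      rw [F2.2.1 b (by simp [hb]), F1.2.1 b (by simp [hb])]
    · rw [Cmd.noFlip_fill] at h
      rw [F2.2.2 (by simp [h]), F1.2.2 (by simp [h])]
    · intro σ3 F3 h3
      have e1 : σ3.v x = i := by rw [F3.1 x hC1, hx2]
      have e2 : σ3.v y = j := by rw [F3.1 y hC3, hy2]
      have e3 : σ3.v ny = m := by rw [F3.1 ny hC4, hm2]
      refine run_put hB ha (by simp [Ex.Ok, l1, l3, l4]) (by simp [Ex.Ok, l5])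
        (fun hb => hb.1 _) ?_
      intro i' j' hj' hlt
      simp only [Ex.eval, St.setm_m, St.setv_m, true_and, e1, e2, e3, h3]
      split_ifs with heq
      · obtain ⟨rfl, rfl⟩ := row_index_inj hj' hj heq; rfl
      · rw [F3.2.1 a hCa]
        refine hI2 i' j' hj' ?_
        by_contra hcon
        exact heq (by rw [show i' = i by omega, show j' = j by omega])
  · intro σ2 F2 hy2 hI2 i' hi' j hj
    rw [St.setv_m]
    exact hI2 i' j hj (by omega)

end Rules

/-! ### Farthest-point clustering -/

/-- Invariant of farthest-point clustering after `t` centers: `dist` is the distance to the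
nearest center so far, `asg` its index, `ctr` lists the centers and `u` is a farthest point. -/
structure FarthestInv (n t big : ℕ) (est : ℕ → ℕ → ℕ) (dist asg ctr : ℕ → ℕ) (u : ℕ) : Prop where
  lt : u < n
  ctr_lt : ∀ s < t, ctr s < n
  dist_eq : ∀ v < n, (t = 0 ∧ dist v = big) ∨ (asg v < t ∧ dist v = est v (ctr (asg v)))
  dist_le : ∀ v < n, ∀ s < t, dist v ≤ est v (ctr s)
  far : 0 < t → ∀ v < n, dist v ≤ dist u
  sep : ∀ v < n, ∀ s s', s < s' → s' < t → dist v ≤ est (ctr s') (ctr s)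

/-- Distances to the nearest center only decrease. The new center `u` was farthest, so its old
distance, which is at most its estimate to each earlier center, dominates all current distances.
Neither symmetry nor a triangle inequality of `est` is needed, which is essential as `est` will
behave like a square root of the metric. -/
theorem FarthestInv.succ {n t big : ℕ} {est : ℕ → ℕ → ℕ} {dist asg ctr dist' asg' ctr' : ℕ → ℕ}
    {u u' : ℕ} (h : FarthestInv n t big est dist asg ctr u)
    (hbig : ∀ v < n, ∀ w < n, est v w < big)
    (hctr : ∀ s, ctr' s = if s = t then u else ctr s)
    (h1 : ∀ v < n, est v u < dist v → dist' v = est v u ∧ asg' v = t)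
    (h2 : ∀ v < n, ¬ est v u < dist v → dist' v = dist v ∧ asg' v = asg v)
    (hu : u' < n) (hfar : ∀ v < n, dist' v ≤ dist' u') :
    FarthestInv n (t + 1) big est dist' asg' ctr' u' := by
  have hle : ∀ v < n, dist' v ≤ dist v := fun v hv => by
    by_cases hlt : est v u < dist v
    · rw [(h1 v hv hlt).1]; exact hlt.le
    · rw [(h2 v hv hlt).1]
  have hold : ∀ s < t, ctr' s = ctr s := fun s hs => by rw [hctr, if_neg (by omega)]
  have hnew : ctr' t = u := by rw [hctr, if_pos rfl]
  refine ⟨hu, fun s hs => ?_, fun v hv => ?_, fun v hv s hs => ?_, fun _ => hfar,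
    fun v hv s s' hs hs' => ?_⟩
  · rw [hctr]; split_ifs
    exacts [h.lt, h.ctr_lt s (by omega)]
  · right
    by_cases hlt : est v u < dist v
    · obtain ⟨e1, e2⟩ := h1 v hv hlt
      exact ⟨by omega, by rw [e1, e2, hnew]⟩
    · obtain ⟨e1, e2⟩ := h2 v hv hlt
      rcases h.dist_eq v hv with ⟨_, h0⟩ | ⟨h3, h4⟩
      -- Before the first center every stored distance is `big`, above any estimate, so the first
      -- center captures all points and this case is void.
      · have := hbig v hv u h.lt
        omega
      · exact ⟨by omega, by rw [e1, e2, hold _ h3, h4]⟩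
  · rcases Nat.lt_succ_iff_lt_or_eq.1 hs with hs | rfl
    · rw [hold s hs]
      exact (hle v hv).trans (h.dist_le v hv s hs)
    · rw [hnew]
      by_cases hlt : est v u < dist v
      · exact (h1 v hv hlt).1.le
      · rw [(h2 v hv hlt).1]; omega
  · rcases Nat.lt_succ_iff_lt_or_eq.1 hs' with hs' | rfl
    · rw [hold s (by omega), hold s' hs']
      exact (hle v hv).trans (h.sep v hv s s' hs hs')
    · rw [hold s hs, hnew]
      exact (hle v hv).trans ((h.far (by omega) v hv).trans (h.dist_le u h.lt s hs))

/-- Farthest-point clustering of `v8` points into `v9` clusters, with distances estimated from the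
sketches of length `v5` in array `o + 1`; `o + 2`, `o + 3`, `o + 4` receive the distances to the
nearest center, the cluster of each point, and the centers. -/
def farthestStep (o : ℕ) : Cmd :=
  .seq (.sumTo 25 5 26 (.absDiff (.get (o + 1) (.add (.mul (.var 24) (.var 5)) (.var 25)))
      (.get (o + 1) (.add (.mul (.var 20) (.var 5)) (.var 25)))))
  (.seq (.ite (.var 26) (.get (o + 2) (.var 24))
      (.seq (.put (o + 2) (.var 24) (.var 26)) (.put (o + 3) (.var 24) (.var 21))) .skip)
    (.ite (.var 22) (.get (o + 2) (.var 24))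
      (.seq (.set 22 (.get (o + 2) (.var 24))) (.set 23 (.var 24))) .skip))

/-- Variable 20 holds the next center, initially point 0, and variable 21 counts the clusters.
Variables 22 and 23 record the largest remaining distance and where it occurs. The initial distance
`v5 * v1 + 1` exceeds every sketch distance. -/
def farthest (o : ℕ) : Cmd :=
  .seq (.set 20 (.const 0))
  (.seq (.loop 24 8 (.put (o + 2) (.var 24) (.add (.mul (.var 5) (.var 1)) (.const 1))))
  (.loop 21 9
    (.seq (.put (o + 4) (.var 21) (.var 20))
    (.seq (.set 22 (.const 0))
    (.seq (.set 23 (.const 0))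
    (.seq (.loop 24 8 (farthestStep o))
      (.set 20 (.var 23))))))))

section Farthest

variable {B W : ℕ} {ω : ℕ → Bool} {σ : St}

theorem run_farthestStep (hB : Fits B W) {o n D u v : ℕ} {SK : ℕ → ℕ → ℕ} (ho : o ≤ 8)
    (hD : σ.v 5 = D) (hu : σ.v 20 = u) (hv : σ.v 24 = v) (hun : u < n) (hvn : v < n)
    (hSK : ∀ v < n, ∀ j < D, σ.m (o + 1) (v * D + j) = SK v j)
    (hle : ∑ j ∈ Finset.range D, absDiff (SK v j) (SK u j) ≤ B) :
    Run B W ω (farthestStep o) σ (D * 110 + 1200) fun σ' =>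
      (∑ j ∈ Finset.range D, absDiff (SK v j) (SK u j) < σ.m (o + 2) v →
        σ'.m (o + 2) v = ∑ j ∈ Finset.range D, absDiff (SK v j) (SK u j) ∧
        σ'.m (o + 3) v = σ.v 21) ∧
      (¬ ∑ j ∈ Finset.range D, absDiff (SK v j) (SK u j) < σ.m (o + 2) v →
        σ'.m (o + 2) v = σ.m (o + 2) v ∧ σ'.m (o + 3) v = σ.m (o + 3) v) ∧
      (∀ w ≠ v, σ'.m (o + 2) w = σ.m (o + 2) w ∧ σ'.m (o + 3) w = σ.m (o + 3) w) ∧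
      (σ.v 22 < σ'.m (o + 2) v → σ'.v 22 = σ'.m (o + 2) v ∧ σ'.v 23 = v) ∧
      (¬ σ.v 22 < σ'.m (o + 2) v → σ'.v 22 = σ.v 22 ∧ σ'.v 23 = σ.v 23) := by
  refine Run.mono (t := (D * 110 + 110) + ((400 + 200) + (200 + 200))) ?_ (by omega)
    fun _ _ _ h => h
  refine run_seq (run_sumTo hB (fun j => absDiff (SK v j) (SK u j)) hD (by norm_num) (by norm_num)
    (by norm_num) (by norm_num) (by norm_num) (by norm_num)
    (by simp [Ex.Ok, Ex.absDiff, show o + 1 < 32 by omega]) ?_ hle) ?_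
  · intro j hj σ' hm hw h25
    simp [hm, hw, h25, hD, hu, hv, hSK v hvn j hj, hSK u hun j hj]
  · intro σ1 F1 h26
    have m1 : σ1.m = σ.m := F1.m_eq (by simp)
    have e24 : σ1.v 24 = v := by rw [F1.1 24 (by simp), hv]
    have e21 : σ1.v 21 = σ.v 21 := by rw [F1.1 21 (by simp)]
    have e22 : σ1.v 22 = σ.v 22 := by rw [F1.1 22 (by simp)]
    have e23 : σ1.v 23 = σ.v 23 := by rw [F1.1 23 (by simp)]
    refine run_seq (R := fun σ2 =>
      (∑ j ∈ Finset.range D, absDiff (SK v j) (SK u j) < σ.m (o + 2) v →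
        σ2.m (o + 2) v = ∑ j ∈ Finset.range D, absDiff (SK v j) (SK u j) ∧
        σ2.m (o + 3) v = σ.v 21) ∧
      (¬ ∑ j ∈ Finset.range D, absDiff (SK v j) (SK u j) < σ.m (o + 2) v →
        σ2.m (o + 2) v = σ.m (o + 2) v ∧ σ2.m (o + 3) v = σ.m (o + 3) v) ∧
      (∀ w ≠ v, σ2.m (o + 2) w = σ.m (o + 2) w ∧ σ2.m (o + 3) w = σ.m (o + 3) w)) ?_ ?_
    · refine run_ite hB (by simp [Ex.Ok]) (by simp [Ex.Ok]; omega) ?_ ?_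
      · intro h
        simp only [Ex.eval, h26, m1, e24] at h
        refine Run.mono (t := 200 + 200) ?_ le_rfl fun _ _ _ h => h
        refine run_seq' (run_put hB (by omega) (by simp [Ex.Ok]) (by simp [Ex.Ok])
          (fun hb => hb.1 _) ?_)
        refine run_put hB (by omega) (by simp [Ex.Ok]) (by simp [Ex.Ok]) (fun hb => hb.1 _) ?_
        refine ⟨fun _ => ?_, fun h' => absurd h h', fun w hw => ?_⟩
        · simp [e24, h26, e21]
        · simp [e24, hw, m1]
      · intro h
        simp only [Ex.eval, h26, m1, e24] at h
        exact run_skip ⟨fun h' => absurd h' h, fun _ => by simp [m1], fun w hw => by simp [m1]⟩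
    · intro σ2 F2 ⟨h1, h2, h3⟩
      have g24 : σ2.v 24 = v := by rw [F2.1 24 (by simp), e24]
      have g22 : σ2.v 22 = σ.v 22 := by rw [F2.1 22 (by simp), e22]
      have g23 : σ2.v 23 = σ.v 23 := by rw [F2.1 23 (by simp), e23]
      refine run_ite hB (by simp [Ex.Ok]) (by simp [Ex.Ok]; omega) ?_ ?_
      · intro h
        simp only [Ex.eval, g22, g24] at h
        refine Run.mono (t := 100 + 100) ?_ le_rfl fun _ _ _ h => h
        refine run_seq' (run_set hB (by norm_num) (by simp [Ex.Ok]; omega) (fun hb => hb.2 _ _) ?_)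
        refine run_set hB (by norm_num) (by simp [Ex.Ok]) (fun hb => hb.1 _) ?_
        refine ⟨h1, h2, h3, fun _ => ?_, fun h' => absurd h h'⟩
        simp [g24]
      · intro h
        simp only [Ex.eval, g22, g24] at h
        exact run_skip ⟨h1, h2, h3, fun h' => absurd h' h, fun _ => ⟨g22, g23⟩⟩

theorem keeps_farthestStep {o x : ℕ} :
    (farthestStep o).Keeps x ↔ x ≠ 25 ∧ x ≠ 26 ∧ x ≠ 22 ∧ x ≠ 23 := by
  simp [farthestStep]; tauto

theorem keepsArr_farthestStep {o a : ℕ} :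
    (farthestStep o).KeepsArr a ↔ a ≠ o + 2 ∧ a ≠ o + 3 := by
  simp [farthestStep]

theorem run_farthest (hB : Fits B W) {o n l q D : ℕ} {SK : ℕ → ℕ → ℕ} (ho : o ≤ 8)
    (hq : σ.v 1 = q) (hD : σ.v 5 = D) (hn : σ.v 8 = n) (hl : σ.v 9 = l) (hn0 : 0 < n)
    (hSK : ∀ v < n, ∀ j < D, σ.m (o + 1) (v * D + j) = SK v j)
    (hle : ∀ v < n, ∀ u < n, ∑ j ∈ Finset.range D, absDiff (SK v j) (SK u j) ≤ D * q)
    (hDq : D * q + 1 ≤ B) :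
    Run B W ω (farthest o) σ (n * 210 + l * (n * (D * 110 + 1210) + 600) + 200) fun σ' =>
      FarthestInv n l (D * q + 1) (fun v u => ∑ j ∈ Finset.range D, absDiff (SK v j) (SK u j))
        (σ'.m (o + 2)) (σ'.m (o + 3)) (σ'.m (o + 4)) (σ'.v 20) := by
  refine Run.mono (t := 100 + ((n * (200 + 10) + 10) + (l * ((200 + (100 + (100 +
    ((n * ((D * 110 + 1200) + 10) + 10) + 100)))) + 10) + 10))) ?_ (by ring_nf; omega)
    fun _ _ _ h => h
  set est := fun v u => ∑ j ∈ Finset.range D, absDiff (SK v j) (SK u j) with hest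
  refine run_seq' (run_set hB (by norm_num) (by simp [Ex.Ok]) (by simp) ?_)
  refine run_seq (R := fun σ' => ∀ v < n, σ'.m (o + 2) v = D * q + 1) ?_ ?_
  · refine run_loop hB (fun i σ' => ∀ v < i, σ'.m (o + 2) v = D * q + 1) (by simp [hn]) (by simp)
      (by simp) (by norm_num) (by norm_num) (by norm_num) (by simp) ?_ fun _ _ _ h => h
    intro i hi σ' F h24 hI
    have e5 : σ'.v 5 = D := by rw [F.1 5 (by simp)]; simp [hD]
    have e1 : σ'.v 1 = q := by rw [F.1 1 (by simp)]; simp [hq]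
    refine run_put hB (by omega) (by simp [Ex.Ok]) (by simp [Ex.Ok]) (by simp [e5, e1, hDq]) ?_
    intro v hv
    simp only [Ex.eval, St.setv_m, St.setm_m, h24, e5, e1, true_and]
    split_ifs with h
    · rfl
    · exact hI v (by omega)
  intro σ1 F1 h1
  have e1 : σ1.v 1 = q := by rw [F1.1 1 (by simp)]; simp [hq]
  have e5 : σ1.v 5 = D := by rw [F1.1 5 (by simp)]; simp [hD]
  have e8 : σ1.v 8 = n := by rw [F1.1 8 (by simp)]; simp [hn]
  have e9 : σ1.v 9 = l := by rw [F1.1 9 (by simp)]; simp [hl]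
  have e20 : σ1.v 20 = 0 := by rw [F1.1 20 (by simp)]; simp
  have mSK : ∀ v < n, ∀ j < D, σ1.m (o + 1) (v * D + j) = SK v j := by
    rw [F1.2.1 (o + 1) (by simp)]; simpa using hSK
  refine run_loop hB (fun t σ' => FarthestInv n t (D * q + 1) est
    (σ'.m (o + 2)) (σ'.m (o + 3)) (σ'.m (o + 4)) (σ'.v 20)) e9 (by simp [keeps_farthestStep])
    (by simp [keeps_farthestStep]) (by norm_num) (by norm_num) (by norm_num)
    ⟨by simp [e20, hn0], by simp, fun v hv => .inl ⟨rfl, by simp [h1 v hv]⟩, by simp, by simp,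
      by simp⟩ ?_ fun _ _ _ h => h
  intro t ht σ2 F2 h21 hI
  have f5 : σ2.v 5 = D := by rw [F2.1 5 (by simp [keeps_farthestStep]), e5]
  have f8 : σ2.v 8 = n := by rw [F2.1 8 (by simp [keeps_farthestStep]), e8]
  have mSK2 : ∀ v < n, ∀ j < D, σ2.m (o + 1) (v * D + j) = SK v j := by
    rw [F2.2.1 (o + 1) (by simp [keepsArr_farthestStep])]; exact mSK
  set u := σ2.v 20 with hu
  refine run_seq' (run_put hB (by omega) (by simp [Ex.Ok]) (by simp [Ex.Ok]) (fun hb => hb.1 _) ?_)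
  refine run_seq' (run_set hB (by norm_num) (by simp [Ex.Ok]) (by simp) ?_)
  refine run_seq' (run_set hB (by norm_num) (by simp [Ex.Ok]) (by simp) ?_)
  refine run_seq (R := fun σ' =>
    (∀ v < n, est v u < σ2.m (o + 2) v → σ'.m (o + 2) v = est v u ∧ σ'.m (o + 3) v = t) ∧
    (∀ v < n, ¬ est v u < σ2.m (o + 2) v →
      σ'.m (o + 2) v = σ2.m (o + 2) v ∧ σ'.m (o + 3) v = σ2.m (o + 3) v) ∧
    σ'.v 23 < n ∧ ∀ v < n, σ'.m (o + 2) v ≤ σ'.m (o + 2) (σ'.v 23)) ?_ ?_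
  · refine run_loop hB (n := n) (fun i σ' =>
      (∀ v < i, est v u < σ2.m (o + 2) v → σ'.m (o + 2) v = est v u ∧ σ'.m (o + 3) v = t) ∧
      (∀ v < i, ¬ est v u < σ2.m (o + 2) v →
        σ'.m (o + 2) v = σ2.m (o + 2) v ∧ σ'.m (o + 3) v = σ2.m (o + 3) v) ∧
      (∀ v, i ≤ v → σ'.m (o + 2) v = σ2.m (o + 2) v ∧ σ'.m (o + 3) v = σ2.m (o + 3) v) ∧
      -- The maximum is updated only on a strict increase. If it remains 0, all distances seen are 0
      -- and the default index 0 is a farthest point as well.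
      (σ'.v 23 < n ∧ (σ'.v 22 = 0 ∨ σ'.v 23 < i ∧ σ'.v 22 = σ'.m (o + 2) (σ'.v 23))) ∧
      ∀ v < i, σ'.m (o + 2) v ≤ σ'.v 22) (by simp [f8]) (by simp [keeps_farthestStep])
      (by simp [keeps_farthestStep]) (by norm_num) (by norm_num) (by norm_num)
      (by simp [hn0]) ?_ ?_
    · intro i hi σ3 F3 h24 ⟨i1, i2, i3, ⟨i4, i5⟩, i6⟩
      have g5 : σ3.v 5 = D := by
        rw [F3.1 5 (by simp [keeps_farthestStep])]; simp [f5]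
      have g20 : σ3.v 20 = u := by
        rw [F3.1 20 (by simp [keeps_farthestStep])]; simp [hu]
      have g21 : σ3.v 21 = t := by
        rw [F3.1 21 (by simp [keeps_farthestStep])]; simp [h21]
      have mSK3 : ∀ v < n, ∀ j < D, σ3.m (o + 1) (v * D + j) = SK v j := by
        rw [F3.2.1 (o + 1) (by simp [keepsArr_farthestStep])]; simpa using mSK2
      refine Run.mono (run_farthestStep hB ho g5 g20 h24 hI.lt hi mSK3
        ((hle i hi u hI.lt).trans (by omega))) le_rfl ?_
      intro σ4 F4 hb ⟨j1, j2, j3, j4, j5⟩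
      rw [(i3 i le_rfl).1, g21] at j1
      rw [(i3 i le_rfl).1, (i3 i le_rfl).2] at j2
      simp only [St.setv_m, St.setv_v, show (23 : ℕ) ≠ 24 by norm_num,
        show (22 : ℕ) ≠ 24 by norm_num, if_false]
      refine ⟨fun v hv hlt => ?_, fun v hv hlt => ?_, fun v hv => ?_, ?_, fun v hv => ?_⟩
      · rcases Nat.lt_succ_iff_lt_or_eq.1 hv with hv | rfl
        · rw [(j3 v (by omega)).1, (j3 v (by omega)).2]; exact i1 v hv hlt
        · exact j1 hlt
      · rcases Nat.lt_succ_iff_lt_or_eq.1 hv with hv | rfl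
        · rw [(j3 v (by omega)).1, (j3 v (by omega)).2]; exact i2 v hv hlt
        · exact j2 hlt
      · rw [(j3 v (by omega)).1, (j3 v (by omega)).2]; exact i3 v (by omega)
      · by_cases hlt : σ3.v 22 < σ4.m (o + 2) i
        · rw [(j4 hlt).1, (j4 hlt).2]
          exact ⟨hi, .inr ⟨by omega, rfl⟩⟩
        · rw [(j5 hlt).1, (j5 hlt).2]
          refine ⟨i4, i5.imp_right fun h => ⟨by omega, ?_⟩⟩
          rw [(j3 _ (by omega)).1]; exact h.2
      · have hmono : σ3.v 22 ≤ σ4.v 22 ∧ σ4.m (o + 2) i ≤ σ4.v 22 := by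
          by_cases hlt : σ3.v 22 < σ4.m (o + 2) i
          · rw [(j4 hlt).1]; exact ⟨hlt.le, le_rfl⟩
          · rw [(j5 hlt).1]; exact ⟨le_rfl, by omega⟩
        rcases Nat.lt_succ_iff_lt_or_eq.1 hv with hv | rfl
        · rw [(j3 v (by omega)).1]; exact (i6 v hv).trans hmono.1
        · exact hmono.2
    · intro σ3 F3 h24 ⟨i1, i2, i3, ⟨i4, i5⟩, i6⟩
      refine ⟨i1, i2, i4, fun v hv => ?_⟩
      rcases i5 with h | h
      · have := i6 v hv
        omega
      · rw [← h.2]; exact i6 v hv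
  · intro σ3 F3 ⟨i1, i2, i3, i4⟩
    refine run_set hB (by norm_num) (by simp [Ex.Ok]) (fun hb => hb.1 _) ?_
    have hctr : ∀ s, σ3.m (o + 4) s = if s = t then u else σ2.m (o + 4) s := by
      intro s
      rw [F3.2.1 (o + 4) (by simp [keepsArr_farthestStep])]
      simp [h21, hu]
    simpa using hI.succ (fun v hv w hw => Nat.lt_succ_of_le (hle v hv w hw)) hctr i1 i2 i3 i4

end Farthest

/-! ### Difference lists, sketches and the complete clustering -/

/-- For each of `v8` points, list the coordinates in which it differs from its center. -/
def diffLists (o : ℕ) : Cmd :=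
  .loop 24 8
    (.seq (.set 27 (.const 0))
    (.seq (.set 28 (.get (o + 4) (.get (o + 3) (.var 24))))
    (.seq (.loop 25 1
      (.ite (.const 0) (.absDiff (.get o (.add (.mul (.var 24) (.var 1)) (.var 25)))
          (.get o (.add (.mul (.var 28) (.var 1)) (.var 25))))
        (.seq (.put (o + 6) (.add (.mul (.var 24) (.var 1)) (.var 27)) (.var 25))
          (.set 27 (.add (.var 27) (.const 1)))) .skip))
      (.put (o + 5) (.var 24) (.var 27)))))

/-- The number of coordinates in which the 0-1 vectors `x` and `w` differ. -/
def hdist (q : ℕ) (x w : ℕ → ℕ) : ℕ := ∑ m ∈ Finset.range q, absDiff (x m) (w m)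

/-- The `ℓ₁`-distance of the sketches of `X v` and `X u`, where the sketch of a vector consists of
its Hamming distances to `w 0, …, w (D - 1)`. -/
def sketchDist (q D : ℕ) (w X : ℕ → ℕ → ℕ) (v u : ℕ) : ℕ :=
  ∑ j ∈ Finset.range D, absDiff (hdist q (X v) (w j)) (hdist q (X u) (w j))

theorem hdist_le {q : ℕ} {x w : ℕ → ℕ} (hx : ∀ m < q, x m ≤ 1) (hw : ∀ m < q, w m ≤ 1) :
    hdist q x w ≤ q := by
  refine (Finset.sum_le_card_nsmul _ _ 1 fun m hm => ?_).trans (by simp)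
  have h := Finset.mem_range.1 hm
  exact absDiff_le (hx m h) (hw m h)

/-- Sketches, clustering and difference lists for `v8` points and `v9` clusters. -/
def cluster (o : ℕ) : Cmd :=
  .seq (.fill (o + 1) 10 8 11 5 13 (.sumTo 12 1 13
    (.absDiff (.get o (.add (.mul (.var 10) (.var 1)) (.var 12)))
      (.get 16 (.add (.mul (.var 11) (.var 1)) (.var 12))))))
  (.seq (farthest o) (diffLists o))

/-- The outcome of `cluster` for the points `X 0, …, X (n - 1)` of `{0,1}^q` in the arrays `m`. -/
structure Clustered (m : ℕ → ℕ → ℕ) (o n l q : ℕ) (X est : ℕ → ℕ → ℕ) : Prop where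
  point : ∀ v < n, ∀ x < q, m o (v * q + x) = X v x
  asg_lt : ∀ v < n, m (o + 3) v < l
  ctr_lt : ∀ s < l, m (o + 4) s < n
  diff : ∀ v < n, ∀ F : ℕ → ℕ, ∑ t ∈ Finset.range (m (o + 5) v), F (m (o + 6) (v * q + t)) =
    ∑ x ∈ Finset.range q, if X v x ≠ X (m (o + 4) (m (o + 3) v)) x then F x else 0
  sep : ∀ v < n, ∃ g : ℕ → ℕ, (∀ s ≤ l, g s < n) ∧ ∀ s s', s < s' → s' ≤ l →
    est v (m (o + 4) (m (o + 3) v)) ≤ est (g s') (g s)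

/-- The `l` centers together with the final farthest point `u`, placed at index `l`, are the `l + 1`
points to which the pigeonhole principle will be applied. -/
theorem FarthestInv.sep_points {n l big : ℕ} {est : ℕ → ℕ → ℕ} {dist asg ctr : ℕ → ℕ} {u : ℕ}
    (h : FarthestInv n l big est dist asg ctr u) (hl : 0 < l) {v : ℕ} (hv : v < n) :
    asg v < l ∧ ∃ g : ℕ → ℕ, (∀ s ≤ l, g s < n) ∧ ∀ s s', s < s' → s' ≤ l →
      est v (ctr (asg v)) ≤ est (g s') (g s) := by
  obtain ⟨h1, h2⟩ := (h.dist_eq v hv).resolve_left (by omega)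
  refine ⟨h1, fun s => if s = l then u else ctr s, fun s hs => ?_, fun s s' hs hs' => ?_⟩
  · dsimp only; split_ifs
    exacts [h.lt, h.ctr_lt s (by omega)]
  · rw [← h2]
    simp only [if_neg (show s ≠ l by omega)]
    split_ifs with h3
    · exact (h.far hl v hv).trans (h.dist_le u h.lt s (by omega))
    · exact h.sep v hv s s' hs (by omega)

section Cluster

variable {B W : ℕ} {ω : ℕ → Bool} {σ : St}

/-- Quantifying over all `F` expresses that the list enumerates the differing coordinates without
repetition. The choice `F = 1` yields the length of the list, products of entries yield the
corrections in a query. -/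
theorem run_diffLists (hB : Fits B W) {o n q : ℕ} {X : ℕ → ℕ → ℕ} (ho : o ≤ 8)
    (hq : σ.v 1 = q) (hn : σ.v 8 = n)
    (hX : ∀ v < n, ∀ x < q, σ.m o (v * q + x) = X v x)
    (hc : ∀ v < n, σ.m (o + 4) (σ.m (o + 3) v) < n) :
    Run B W ω (diffLists o) σ (n * (q * 510 + 420) + 10) fun σ' => ∀ v < n, ∀ F : ℕ → ℕ,
      ∑ t ∈ Finset.range (σ'.m (o + 5) v), F (σ'.m (o + 6) (v * q + t)) =
      ∑ x ∈ Finset.range q, if X v x ≠ X (σ.m (o + 4) (σ.m (o + 3) v)) x then F x else 0 := by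
  -- With `F = 1` the list is no longer than the number of coordinates scanned, so each list stays
  -- inside its own row of length `q`.
  have hcnt : ∀ (P : ℕ → Prop) [DecidablePred P] (c j : ℕ) (a : ℕ → ℕ),
      (∀ F : ℕ → ℕ, ∑ t ∈ Finset.range c, F (a t) =
        ∑ x ∈ Finset.range j, if P x then F x else 0) → c ≤ j := by
    intro P _ c j a h
    have h1 := h fun _ => 1
    simp only [Finset.sum_const, Finset.card_range, smul_eq_mul, mul_one] at h1
    rw [h1]
    exact (Finset.sum_le_card_nsmul _ _ 1 fun x _ => by split_ifs <;> simp).trans (by simp)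
  refine Run.mono (t := n * ((100 + (100 + ((q * (((200 + 100) + 200) + 10) + 10) + 200))) + 10)
    + 10) ?_ (by ring_nf; omega) fun _ _ _ h => h
  refine run_loop hB (fun i σ' => ∀ v < i, ∀ F : ℕ → ℕ,
      ∑ t ∈ Finset.range (σ'.m (o + 5) v), F (σ'.m (o + 6) (v * q + t)) =
      ∑ x ∈ Finset.range q, if X v x ≠ X (σ.m (o + 4) (σ.m (o + 3) v)) x then F x else 0)
    hn (by simp) (by simp) (by norm_num) (by norm_num) (by norm_num) (by simp) ?_
    fun _ _ _ h => h
  intro v hv σ1 F1 h24 hI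
  have e1 : σ1.v 1 = q := by rw [F1.1 1 (by simp), hq]
  have mX : σ1.m o = σ.m o := F1.2.1 o (by simp)
  have m3 : σ1.m (o + 3) = σ.m (o + 3) := F1.2.1 _ (by simp)
  have m4 : σ1.m (o + 4) = σ.m (o + 4) := F1.2.1 _ (by simp)
  set c := σ.m (o + 4) (σ.m (o + 3) v) with hcdef
  refine run_seq' (run_set hB (by norm_num) (by simp [Ex.Ok]) (by simp) ?_)
  refine run_seq' (run_set hB (by norm_num) (by simp [Ex.Ok]; omega) (fun hb => hb.2 _ _) ?_)
  refine run_seq (R := fun σ' => (∀ v' < v, ∀ t < q, σ'.m (o + 6) (v' * q + t) =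
      σ1.m (o + 6) (v' * q + t)) ∧ ∀ F : ℕ → ℕ,
      ∑ t ∈ Finset.range (σ'.v 27), F (σ'.m (o + 6) (v * q + t)) =
      ∑ x ∈ Finset.range q, if X v x ≠ X c x then F x else 0) ?_ ?_
  · refine run_loop hB (n := q) (fun j σ' => (∀ v' < v, ∀ t < q, σ'.m (o + 6) (v' * q + t) =
      σ1.m (o + 6) (v' * q + t)) ∧ ∀ F : ℕ → ℕ,
      ∑ t ∈ Finset.range (σ'.v 27), F (σ'.m (o + 6) (v * q + t)) =
      ∑ x ∈ Finset.range j, if X v x ≠ X c x then F x else 0) (by simp [e1]) (by simp) (by simp)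
      (by norm_num) (by norm_num) (by norm_num) (by simp) ?_ fun _ _ _ h => h
    intro j hj σ2 F2 h25 ⟨i1, i2⟩
    have g1 : σ2.v 1 = q := by rw [F2.1 1 (by simp)]; simp [e1]
    have g24 : σ2.v 24 = v := by rw [F2.1 24 (by simp)]; simp [h24]
    have g28 : σ2.v 28 = c := by rw [F2.1 28 (by simp)]; simp [h24, m3, m4, hcdef]
    have gX : σ2.m o = σ.m o := by rw [F2.2.1 o (by simp)]; simpa using mX
    have hle := hcnt _ _ _ _ i2
    have hcond : absDiff (σ.m o (v * q + j)) (σ.m o (c * q + j)) = absDiff (X v j) (X c j) := by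
      rw [hX v hv j hj, hX c (hc v hv) j hj]
    refine run_ite hB (by simp [Ex.Ok]) (by simp [Ex.Ok, Ex.absDiff]; omega) ?_ ?_
    · intro h
      simp only [Ex.eval_absDiff, Ex.eval, g1, g24, g28, gX, h25, hcond, absDiff_pos] at h
      refine run_seq' (run_put hB (by omega) (by simp [Ex.Ok]) (by simp [Ex.Ok])
        (fun hb => hb.1 _) ?_)
      refine run_set hB (by norm_num) (by simp [Ex.Ok]) (fun hb => ?_) ⟨fun v' hv' t ht => ?_,
        fun F => ?_⟩
      · have h1 := hb.1 1
        simp only [Ex.eval, St.setm_v, g1] at h1 ⊢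
        omega
      · simp only [Ex.eval, St.setv_m, St.setm_m, g1, g24, true_and]
        rw [if_neg, i1 v' hv' t ht]
        intro heq
        have := (row_index_inj ht (by omega) heq).1
        omega
      · simp only [Ex.eval, St.setv_m, St.setm_m, St.setv_v, St.setm_v, g1, g24, true_and, h25]
        norm_num only
        simp only [if_true, if_false]
        rw [Finset.sum_range_succ, Finset.sum_range_succ, if_pos h, if_pos rfl, ← i2]
        congr 1
        refine Finset.sum_congr rfl fun t ht => ?_
        rw [if_neg (by have := Finset.mem_range.1 ht; omega)]
    · intro h
      simp only [Ex.eval_absDiff, Ex.eval, g1, g24, g28, gX, h25, hcond, absDiff_pos] at h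
      refine run_skip ⟨by simpa using i1, fun F => ?_⟩
      rw [Finset.sum_range_succ, if_neg h, add_zero]
      simpa using i2 F
  · intro σ2 F2 ⟨i1, i2⟩
    have g24 : σ2.v 24 = v := by rw [F2.1 24 (by simp)]; simp [h24]
    refine run_put hB (by omega) (by simp [Ex.Ok]) (by simp [Ex.Ok]) (fun hb => hb.1 _) ?_
    intro v' hv' F
    simp only [Ex.eval, St.setv_m, St.setm_m, g24, true_and, Nat.add_left_cancel_iff]
    norm_num only
    simp only [false_and, if_false]
    rcases Nat.lt_succ_iff_lt_or_eq.1 hv' with hv' | rfl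
    · rw [if_neg (by omega), F2.2.1 (o + 5) (by simp)]
      simp only [St.setv_m]
      rw [← hI v' hv' F]
      refine Finset.sum_congr rfl fun t ht => ?_
      rw [i1 v' hv' t]
      exact (Finset.mem_range.1 ht).trans_le (hcnt _ _ _ _ (hI v' hv'))
    · rw [if_pos rfl]; exact i2 F

theorem run_cluster (hB : Fits B W) {o n l q D : ℕ} {X w : ℕ → ℕ → ℕ} (ho : o ≤ 8)
    (hq : σ.v 1 = q) (hD : σ.v 5 = D) (hn : σ.v 8 = n) (hl : σ.v 9 = l) (hn0 : 0 < n) (hl0 : 0 < l)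
    (hX : ∀ v < n, ∀ x < q, σ.m o (v * q + x) = X v x) (hX1 : ∀ v < n, ∀ x < q, X v x ≤ 1)
    (hw : ∀ j < D, ∀ x < q, σ.m 16 (j * q + x) = w j x) (hw1 : ∀ j < D, ∀ x < q, w j x ≤ 1)
    (hqB : q ≤ B) (hDq : D * q + 1 ≤ B) :
    Run B W ω (cluster o) σ (n * (D * (q * 110 + 320) + 20) + (n * 210 +
        l * (n * (D * 110 + 1210) + 600)) + n * (q * 510 + 420) + 220)
      fun σ' => Clustered σ'.m o n l q X (sketchDist q D w X) := by
  refine Run.mono (t := (n * (D * ((q * 110 + 110) + 210) + 20) + 10) + ((n * 210 +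
        l * (n * (D * 110 + 1210) + 600) + 200) + (n * (q * 510 + 420) + 10))) ?_
    (by ring_nf; omega) fun _ _ _ h => h
  have hh : ∀ v < n, ∀ j < D, hdist q (X v) (w j) ≤ q := fun v hv j hj =>
    hdist_le (hX1 v hv) (hw1 j hj)
  refine run_seq (run_fill hB (fun v j => hdist q (X v) (w j)) hn hD (by norm_num) (by omega)
    (by norm_num) (by simp) (by simp) ?_) ?_
  · intro v hv j hj σ1 F1 h10 h11
    have e1 : σ1.v 1 = q := by rw [F1.1 1 (by simp), hq]
    have mo : σ1.m o = σ.m o := F1.2.1 o (by simp)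
    have m16 : σ1.m 16 = σ.m 16 := F1.2.1 16 (by simp; omega)
    refine run_sumTo hB (fun x => absDiff (X v x) (w j x)) e1 (by norm_num) (by norm_num)
      (by norm_num) (by norm_num) (by norm_num) (by norm_num)
      (by simp [Ex.Ok, Ex.absDiff]; omega) ?_ ((hh v hv j hj).trans hqB)
    intro x hx σ2 m2 w2 h12
    simp [m2, w2, h12, h10, h11, e1, mo, m16, hX v hv x hx, hw j hj x hx]
  intro σ1 F1 h1
  have e1 : σ1.v 1 = q := by rw [F1.1 1 (by simp), hq]
  have e5 : σ1.v 5 = D := by rw [F1.1 5 (by simp), hD]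
  have e8 : σ1.v 8 = n := by rw [F1.1 8 (by simp), hn]
  have e9 : σ1.v 9 = l := by rw [F1.1 9 (by simp), hl]
  have mo : σ1.m o = σ.m o := F1.2.1 o (by simp)
  refine run_seq (run_farthest hB (SK := fun v j => hdist q (X v) (w j)) ho e1 e5 e8 e9 hn0 h1
    ?_ hDq) ?_
  · intro v hv u hu
    refine (Finset.sum_le_card_nsmul _ _ q fun j hj => ?_).trans (by simp)
    have hj := Finset.mem_range.1 hj
    exact absDiff_le (hh v hv j hj) (hh u hu j hj)
  intro σ2 F2 h2
  have g1 : σ2.v 1 = q := by rw [F2.1 1 (by simp [farthest, keeps_farthestStep]), e1]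
  have g8 : σ2.v 8 = n := by rw [F2.1 8 (by simp [farthest, keeps_farthestStep]), e8]
  have m2 : σ2.m o = σ.m o := by
    rw [F2.2.1 o (by simp [farthest, keepsArr_farthestStep]), mo]
  refine Run.mono (run_diffLists hB ho g1 g8 (by rw [m2]; exact hX) fun v hv =>
    h2.ctr_lt _ (h2.sep_points hl0 hv).1) le_rfl ?_
  intro σ3 F3 _ h3
  have m30 : σ3.m o = σ.m o := by rw [F3.2.1 o (by simp [diffLists]), m2]
  have m33 : σ3.m (o + 3) = σ2.m (o + 3) := F3.2.1 _ (by simp [diffLists])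
  have m34 : σ3.m (o + 4) = σ2.m (o + 4) := F3.2.1 _ (by simp [diffLists])
  refine ⟨by rw [m30]; exact hX, fun v hv => ?_, fun s hs => ?_, fun v hv F => ?_, fun v hv => ?_⟩
  · rw [m33]; exact (h2.sep_points hl0 hv).1
  · rw [m34]; exact h2.ctr_lt s hs
  · rw [m33, m34]; exact h3 v hv F
  · rw [m33, m34]; exact (h2.sep_points hl0 hv).2

theorem keeps_cluster {o x : ℕ} (hx : x < 10) : (cluster o).Keeps x := by
  simp [cluster, farthest, keeps_farthestStep, diffLists]; omega

theorem keepsArr_cluster {o a : ℕ} (h : a ≤ o ∨ o + 7 ≤ a) : (cluster o).KeepsArr a := by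
  simp [cluster, farthest, keepsArr_farthestStep, diffLists]; omega

end Cluster

/-! ### Queries -/

/-- Everything that a query reads: the two clusterings, the inner products of the centers (array
18), and `q` and `k` (array 19). -/
structure Prepared (m : ℕ → ℕ → ℕ) (p q r l k : ℕ) (X Y estX estY : ℕ → ℕ → ℕ) : Prop where
  rows : Clustered m 0 p l q X estX
  cols : Clustered m 8 r k q Y estY
  prod : ∀ a < l, ∀ b < k,
    m 18 (a * k + b) = ∑ x ∈ Finset.range q, X (m 4 a) x * Y (m 12 b) x
  fst : m 19 0 = q
  snd : m 19 1 = k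

/-- The product of the current entries of arrays 0 and 8 in rows `v x` and `v y` and in the column
that a difference list names. -/
def listTerm (x y d i : ℕ) : Ex :=
  .mul (.get 0 (.add (.mul (.var x) (.var 2)) (.get d (.add (.mul (.var i) (.var 2)) (.var 14)))))
    (.get 8 (.add (.mul (.var y) (.var 2)) (.get d (.add (.mul (.var i) (.var 2)) (.var 14)))))

/-- Variables 4 and 5 receive the clusters of row x and column y, 6 and 7 the indices of their
centers u and w, 8 and 9 the list lengths. Variables 10 to 13 receive the partial sums of u·y over
the list of y, x·y over the list of x, u·w over the list of y, and u·y over the list of x; the first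
two are added to u·w, the last two subtracted. -/
def query : Cmd :=
  .seq (.set 2 (.get 19 (.const 0)))
  (.seq (.set 3 (.get 19 (.const 1)))
  (.seq (.set 4 (.get 3 (.var 0)))
  (.seq (.set 5 (.get 11 (.var 1)))
  (.seq (.set 6 (.get 4 (.var 4)))
  (.seq (.set 7 (.get 12 (.var 5)))
  (.seq (.set 8 (.get 5 (.var 0)))
  (.seq (.set 9 (.get 13 (.var 1)))
  (.seq (.sumTo 14 9 10 (listTerm 6 1 14 1))
  (.seq (.sumTo 14 8 11 (listTerm 0 1 6 0))
  (.seq (.sumTo 14 9 12 (listTerm 6 7 14 1))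
  (.seq (.sumTo 14 8 13 (listTerm 6 1 6 0))
    (.set 0 (.sub (.add (.get 18 (.add (.mul (.var 4) (.var 3)) (.var 5)))
      (.add (.var 10) (.var 11))) (.add (.var 12) (.var 13)))))))))))))))

theorem noFlip_query : query.NoFlip := by simp [query]

theorem keepsArr_query (a : ℕ) : query.KeepsArr a := by simp [query]

/-- Correcting the inner product of two centers `u`, `w` along the difference lists gives the inner
product of the points `x`, `y`. -/
theorem sum_correction (q : ℕ) (x y u w : ℕ → ℕ) :
    ((∑ i ∈ Finset.range q, u i * w i) +
      ((∑ i ∈ Finset.range q, if y i ≠ w i then u i * y i else 0) +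
        ∑ i ∈ Finset.range q, if x i ≠ u i then x i * y i else 0)) -
      ((∑ i ∈ Finset.range q, if y i ≠ w i then u i * w i else 0) +
        ∑ i ∈ Finset.range q, if x i ≠ u i then u i * y i else 0) =
      ∑ i ∈ Finset.range q, x i * y i := by
  -- Subtraction is truncated, so besides the identity it must be shown that the subtracted part is
  -- not larger. Both hold coordinate by coordinate, in four cases.
  rw [Nat.sub_eq_iff_eq_add']
  · simp only [← Finset.sum_add_distrib]
    refine Finset.sum_congr rfl fun i _ => ?_
    by_cases h1 : x i = u i <;> by_cases h2 : y i = w i <;>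
      simp only [h1, h2, ne_eq, not_true, not_false_iff, if_true, if_false] <;> ring
  · simp only [← Finset.sum_add_distrib]
    refine Finset.sum_le_sum fun i _ => ?_
    by_cases h1 : x i = u i <;> by_cases h2 : y i = w i <;> simp [h1, h2]

section Query

variable {B W : ℕ} {ω : ℕ → Bool} {σ : St}

/-- The list property `hl`, applied to the product of the two entries, turns the sum along the list
into a sum over the coordinates with `P`. The time depends on the list length `c` only, not on `q`.
-/
theorem run_listSum (hB : Fits B W) {x y d i n z q c a b e : ℕ} {P : ℕ → Prop} [DecidablePred P]
    (X Y : ℕ → ℕ) (hx : x < 40) (hy : y < 40) (hd : d < 32) (hi : i < 40) (hn : n < 14)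
    (hz : z < 14) (hnz : n ≠ z) (hxz : x ≠ z ∧ x ≠ 14) (hyz : y ≠ z ∧ y ≠ 14)
    (hiz : i ≠ z ∧ i ≠ 14) (h2z : 2 ≠ z)
    (hq : σ.v 2 = q) (hc : σ.v n = c) (ha : σ.v x = a) (hb : σ.v y = b) (he : σ.v i = e)
    (hX : ∀ s < q, σ.m 0 (a * q + s) = X s) (hY : ∀ s < q, σ.m 8 (b * q + s) = Y s)
    (hX1 : ∀ s < q, X s ≤ 1) (hY1 : ∀ s < q, Y s ≤ 1) (hqB : q ≤ B)
    (hl : ∀ F : ℕ → ℕ, ∑ t ∈ Finset.range c, F (σ.m d (e * q + t)) =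
      ∑ s ∈ Finset.range q, if P s then F s else 0) :
    Run B W ω (.sumTo 14 n z (listTerm x y d i)) σ (c * 110 + 110) fun σ' =>
      σ'.v z = ∑ s ∈ Finset.range q, if P s then X s * Y s else 0 := by
  have hl' : ∑ t ∈ Finset.range c, (σ.m 0 (a * q + σ.m d (e * q + t)) *
      σ.m 8 (b * q + σ.m d (e * q + t))) = ∑ s ∈ Finset.range q, if P s then X s * Y s else 0 := by
    rw [hl fun s => σ.m 0 (a * q + s) * σ.m 8 (b * q + s)]
    refine Finset.sum_congr rfl fun s hs => ?_
    rw [hX s (Finset.mem_range.1 hs), hY s (Finset.mem_range.1 hs)]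
  rw [← hl']
  refine run_sumTo hB (fun t => σ.m 0 (a * q + σ.m d (e * q + t)) *
    σ.m 8 (b * q + σ.m d (e * q + t))) hc (by omega) (by omega) hnz (by norm_num) (by omega)
    (by omega) (by simp [Ex.Ok, listTerm]; omega) ?_ ?_
  · intro t ht σ' hm hw h14
    simp only [listTerm, Ex.eval, hm, h14, hw x hxz.2 hxz.1, hw y hyz.2 hyz.1, hw i hiz.2 hiz.1,
      hw 2 (by norm_num) h2z, hq, ha, hb, he]
  · rw [hl']
    refine le_trans (Finset.sum_le_card_nsmul _ _ 1 fun s hs => ?_) (by simpa using hqB)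
    have hs := Finset.mem_range.1 hs
    split_ifs
    · exact Nat.mul_le_mul (hX1 s hs) (hY1 s hs)
    · exact Nat.zero_le _

/-- Each difference list is traversed twice at 110 steps per entry, whence the factors 220;
everything else takes constant time. -/
theorem run_query (hB : Fits B W) {p q r l k i j : ℕ} {X Y estX estY : ℕ → ℕ → ℕ}
    (h : Prepared σ.m p q r l k X Y estX estY) (hi : i < p) (hj : j < r)
    (h0 : σ.v 0 = i) (h1 : σ.v 1 = j) (hX1 : ∀ v < p, ∀ x < q, X v x ≤ 1)
    (hY1 : ∀ v < r, ∀ x < q, Y v x ≤ 1) :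
    Run B W ω query σ (σ.m 5 i * 220 + σ.m 13 j * 220 + 1340) fun σ' =>
      σ'.v 0 = ∑ x ∈ Finset.range q, X i x * Y j x := by
  refine Run.bounded fun hb => ?_
  have hqB : q ≤ B := h.fst ▸ hb.2 19 0
  have hai := h.rows.asg_lt i hi
  have hbj := h.cols.asg_lt j hj
  have hu := h.rows.ctr_lt _ hai
  have hw := h.cols.ctr_lt _ hbj
  have hdX := h.rows.diff i hi
  have hdY := h.cols.diff j hj
  have hpX := h.rows.point
  have hpY := h.cols.point
  have hP := h.prod _ hai _ hbj
  norm_num only at hai hbj hu hw hdX hdY hP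
  have hsum : ∀ (f : ℕ → ℕ), (∀ x < q, f x ≤ 1) → ∑ x ∈ Finset.range q, f x ≤ B := fun f hf =>
    le_trans (Finset.sum_le_card_nsmul _ _ 1 fun s hs => hf s (Finset.mem_range.1 hs))
      (by simpa using hqB)
  set a := σ.m 3 i with ha
  set b := σ.m 11 j with hbdef
  set u := σ.m 4 a with hudef
  set w := σ.m 12 b with hwdef
  refine Run.mono (t := 100 + (100 + (100 + (100 + (100 + (100 + (100 + (100 +
    ((σ.m 13 j * 110 + 110) + ((σ.m 5 i * 110 + 110) + ((σ.m 13 j * 110 + 110) +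
    ((σ.m 5 i * 110 + 110) + 100)))))))))))) ?_ (by omega) fun _ _ _ h => h
  refine run_seq' (run_set hB (by norm_num) (by simp [Ex.Ok]) (fun hb => hb.2 _ _) ?_)
  refine run_seq' (run_set hB (by norm_num) (by simp [Ex.Ok]) (fun hb => hb.2 _ _) ?_)
  refine run_seq' (run_set hB (by norm_num) (by simp [Ex.Ok]) (fun hb => hb.2 _ _) ?_)
  refine run_seq' (run_set hB (by norm_num) (by simp [Ex.Ok]) (fun hb => hb.2 _ _) ?_)
  refine run_seq' (run_set hB (by norm_num) (by simp [Ex.Ok]) (fun hb => hb.2 _ _) ?_)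
  refine run_seq' (run_set hB (by norm_num) (by simp [Ex.Ok]) (fun hb => hb.2 _ _) ?_)
  refine run_seq' (run_set hB (by norm_num) (by simp [Ex.Ok]) (fun hb => hb.2 _ _) ?_)
  refine run_seq' (run_set hB (by norm_num) (by simp [Ex.Ok]) (fun hb => hb.2 _ _) ?_)
  refine run_seq (run_listSum hB (P := fun x => Y j x ≠ Y w x) (q := q) (c := σ.m 13 j) (a := u)
    (b := j) (e := j) (X u) (Y j)
    (by norm_num) (by norm_num) (by norm_num) (by norm_num) (by norm_num) (by norm_num)
    (by norm_num) (by norm_num) (by norm_num) (by norm_num) (by norm_num)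
    (by simp [h.fst]) (by simp [h1]) (by simp [h0, ← ha, ← hudef]) (by simp [h1]) (by simp [h1])
    (fun s hs => by simpa using hpX u hu s hs) (fun s hs => by simpa using hpY j hj s hs)
    (hX1 u hu) (hY1 j hj) hqB (by simpa using hdY)) ?_
  intro σ1 F1 g10
  have f1 : ∀ x, x ≠ 14 → x ≠ 10 → σ1.v x = _ := fun x h1 h2 => F1.1 x (by simp [h1, h2])
  have m1 : σ1.m = σ.m := F1.m_eq (by simp)
  have e0 : σ1.v 0 = i := by rw [f1 0 (by norm_num) (by norm_num)]; simp [h0]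
  have e1 : σ1.v 1 = j := by rw [f1 1 (by norm_num) (by norm_num)]; simp [h1]
  have e2 : σ1.v 2 = q := by rw [f1 2 (by norm_num) (by norm_num)]; simp [h.fst]
  have e3 : σ1.v 3 = k := by rw [f1 3 (by norm_num) (by norm_num)]; simp [h.snd]
  have e4 : σ1.v 4 = a := by rw [f1 4 (by norm_num) (by norm_num)]; simp [h0, ha]
  have e5 : σ1.v 5 = b := by rw [f1 5 (by norm_num) (by norm_num)]; simp [h1, hbdef]
  have e6 : σ1.v 6 = u := by rw [f1 6 (by norm_num) (by norm_num)]; simp [h0, ← ha, hudef]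
  have e7 : σ1.v 7 = w := by rw [f1 7 (by norm_num) (by norm_num)]; simp [h1, ← hbdef, hwdef]
  have e8 : σ1.v 8 = σ.m 5 i := by rw [f1 8 (by norm_num) (by norm_num)]; simp [h0]
  have e9 : σ1.v 9 = σ.m 13 j := by rw [f1 9 (by norm_num) (by norm_num)]; simp [h1]
  clear f1 F1
  refine run_seq (run_listSum hB (P := fun x => X i x ≠ X u x) (X i) (Y j)
    (by norm_num) (by norm_num) (by norm_num) (by norm_num) (by norm_num) (by norm_num)
    (by norm_num) (by norm_num) (by norm_num) (by norm_num) (by norm_num)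
    e2 e8 e0 e1 e0 (by simpa [m1] using hpX i hi) (by simpa [m1] using hpY j hj)
    (hX1 i hi) (hY1 j hj) hqB (by simpa [m1] using hdX)) ?_
  intro σ2 F2 g11
  have m2 : σ2.m = σ.m := by rw [F2.m_eq (by simp), m1]
  refine run_seq (run_listSum hB (P := fun x => Y j x ≠ Y w x) (X u) (Y w)
    (by norm_num) (by norm_num) (by norm_num) (by norm_num) (by norm_num) (by norm_num)
    (by norm_num) (by norm_num) (by norm_num) (by norm_num) (by norm_num)
    ((F2.1 2 (by simp)).trans e2) ((F2.1 9 (by simp)).trans e9) ((F2.1 6 (by simp)).trans e6)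
    ((F2.1 7 (by simp)).trans e7) ((F2.1 1 (by simp)).trans e1)
    (by simpa [m2] using hpX u hu) (by simpa [m2] using hpY w hw)
    (hX1 u hu) (hY1 w hw) hqB (by simpa [m2] using hdY)) ?_
  intro σ3 F3 g12
  have m3 : σ3.m = σ.m := by rw [F3.m_eq (by simp), m2]
  have c : ∀ x, x ≠ 14 → x ≠ 11 → x ≠ 12 → σ3.v x = σ1.v x := fun x h1 h2 h3 => by
    rw [F3.1 x (by simp [*]), F2.1 x (by simp [*])]
  have c11 : σ3.v 11 = σ2.v 11 := F3.1 11 (by simp)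
  clear F3 F2
  refine run_seq (run_listSum hB (P := fun x => X i x ≠ X u x) (X u) (Y j)
    (by norm_num) (by norm_num) (by norm_num) (by norm_num) (by norm_num) (by norm_num)
    (by norm_num) (by norm_num) (by norm_num) (by norm_num) (by norm_num)
    ((c 2 (by simp) (by simp) (by simp)).trans e2) ((c 8 (by simp) (by simp) (by simp)).trans e8)
    ((c 6 (by simp) (by simp) (by simp)).trans e6) ((c 1 (by simp) (by simp) (by simp)).trans e1)
    ((c 0 (by simp) (by simp) (by simp)).trans e0)
    (by simpa [m3] using hpX u hu) (by simpa [m3] using hpY j hj)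
    (hX1 u hu) (hY1 j hj) hqB (by simpa [m3] using hdX)) ?_
  intro σ4 F4 g13
  have m4 : σ4.m = σ.m := by rw [F4.m_eq (by simp), m3]
  have hval : (Ex.sub (.add (.get 18 (.add (.mul (.var 4) (.var 3)) (.var 5)))
      (.add (.var 10) (.var 11))) (.add (.var 12) (.var 13))).eval σ4 =
      ∑ x ∈ Finset.range q, X i x * Y j x := by
    rw [← sum_correction q (X i) (Y j) (X u) (Y w)]
    simp only [Ex.eval, F4.1 4 (by simp), F4.1 3 (by simp), F4.1 5 (by simp), F4.1 10 (by simp),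
      F4.1 11 (by simp), F4.1 12 (by simp), c 4 (by simp) (by simp) (by simp),
      c 3 (by simp) (by simp) (by simp), c 5 (by simp) (by simp) (by simp),
      c 10 (by simp) (by simp) (by simp), c11, g10, g11, g12, g13, m4, e3, e4, e5, hP]
  refine run_set hB (by norm_num) (by simp [Ex.Ok]) (fun _ => ?_) ?_
  · rw [hval]
    exact hsum _ fun x hx => Nat.mul_le_mul (hX1 i hi x hx) (hY1 j hj x hx)
  · rw [hval]; simp

end Query

/-! ### Preprocessing -/

/-- Move the input out of the way and store the rows of `A` in array 0, the columns of `B` in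
array 8. -/
def setup : Cmd :=
  .seq (.set 6 (.add (.mul (.var 0) (.var 1)) (.mul (.var 1) (.var 2))))
  (.seq (.loop 10 6 (.put 17 (.add (.var 10) (.var 6)) (.raw (.var 10))))
  (.seq (.fill 0 10 0 11 1 13 (.set 13 (.get 17
    (.add (.add (.mul (.var 10) (.var 1)) (.var 11)) (.var 6)))))
  (.fill 8 10 2 11 1 13 (.set 13 (.get 17
    (.add (.add (.mul (.var 0) (.var 1)) (.add (.mul (.var 11) (.var 2)) (.var 10))) (.var 6)))))))

/-- `v5 := K * ⌈log₂ (v0 + v2)⌉` -/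
def sketchLength (K : ℕ) : Cmd :=
  .seq (.set 10 (.const 1))
  (.seq (.set 11 (.const 0))
  (.seq (.set 12 (.add (.var 0) (.var 2)))
  (.seq (.loop 13 12 (.ite (.var 10) (.var 12)
    (.seq (.set 10 (.add (.var 10) (.var 10))) (.set 11 (.add (.var 11) (.const 1)))) .skip))
  (.seq (.const 14 K)
    (.set 5 (.mul (.var 14) (.var 11)))))))

/-- Fill array 16 with `v5 * v1` coin tosses. -/
def tossCoins : Cmd :=
  .seq (.set 7 (.mul (.var 5) (.var 1)))
    (.loop 10 7 (.seq (.flip 11) (.put 16 (.var 10) (.var 11))))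

/-- The inner products of the row centers and the column centers. -/
def centerProducts : Cmd :=
  .fill 18 10 3 11 4 13 (.seq (.set 14 (.get 4 (.var 10)))
    (.seq (.set 15 (.get 12 (.var 11)))
      (.sumTo 12 1 13 (.mul (.get 0 (.add (.mul (.var 14) (.var 1)) (.var 12)))
        (.get 8 (.add (.mul (.var 15) (.var 1)) (.var 12)))))))

def prep (K : ℕ) : Cmd :=
  .seq setup
  (.seq (sketchLength K)
  (.seq tossCoins
  (.seq (.set 8 (.var 0))
  (.seq (.set 9 (.var 3))
  (.seq (cluster 0)
  (.seq (.set 8 (.var 2))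
  (.seq (.set 9 (.var 4))
  (.seq (cluster 8)
  (.seq centerProducts
  (.seq (.put 19 (.const 0) (.var 1))
    (.put 19 (.const 1) (.var 4))))))))))))

/-- The time spent on clustering `n` points. -/
def clusterTime (n l q D : ℕ) : ℕ :=
  n * (D * (q * 110 + 320) + 20) + (n * 210 + l * (n * (D * 110 + 1210) + 600)) +
    n * (q * 510 + 420) + 220

def prepTime (p q r l k D : ℕ) : ℕ :=
  ((p * q + q * r) * 210 + p * (q * 310 + 20) + r * (q * 310 + 20) + 130) +
  ((p + r) * 410 + 510) + (D * q * 310 + 110) + clusterTime p l q D + clusterTime r k q D +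
  (l * (k * (q * 110 + 520) + 20) + 10) + 800

section Prep

variable {B W : ℕ} {ω : ℕ → Bool} {σ : St}

/-- The input fills the addresses below `N`, across all interleaved arrays. It is first copied to
array 17 from index `N` on; the addresses there are at least `32 * N`, so input not yet read is
never overwritten. -/
theorem run_setup (hB : Fits B W) {p q r : ℕ} {inp : ℕ → ℕ} (hp : σ.v 0 = p) (hq : σ.v 1 = q)
    (hr : σ.v 2 = r) (hN : p * q + q * r ≤ B)
    (hinp : ∀ x < p * q + q * r, σ.m (x % 32) (x / 32) = inp x) :
    Run B W ω setup σ ((p * q + q * r) * 210 + p * (q * 310 + 20) + r * (q * 310 + 20) + 130)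
      fun σ' => (∀ i < p, ∀ x < q, σ'.m 0 (i * q + x) = inp (i * q + x)) ∧
        ∀ j < r, ∀ x < q, σ'.m 8 (j * q + x) = inp (p * q + (x * r + j)) := by
  set N := p * q + q * r with hNdef
  refine Run.mono (t := 100 + ((N * (200 + 10) + 10) + ((p * (q * (100 + 210) + 20) + 10) +
    (r * (q * (100 + 210) + 20) + 10)))) ?_ (by ring_nf; omega) fun _ _ _ h => h
  refine run_seq' (run_set hB (by norm_num) (by simp [Ex.Ok]) (by simp [hp, hq, hr, ← hNdef, hN]) ?_)
  refine run_seq (R := fun σ' => ∀ x < N, σ'.m 17 (x + N) = inp x) ?_ ?_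
  · refine run_loop hB (n := N) (fun i σ' => (∀ x < N, σ'.m (x % 32) (x / 32) = inp x) ∧
      ∀ x < i, σ'.m 17 (x + N) = inp x) (by simp [hp, hq, hr, ← hNdef]) (by simp) (by simp)
      (by norm_num) (by norm_num) (by norm_num) (by simpa using hinp) ?_ fun _ _ _ h => h.2
    intro i hi σ1 F1 h10 ⟨h1, h2⟩
    have e6 : σ1.v 6 = N := by rw [F1.1 6 (by simp)]; simp [hp, hq, hr, ← hNdef]
    refine run_put hB (by norm_num) (by simp [Ex.Ok]) (by simp [Ex.Ok]) (fun hb => hb.2 _ _)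
      ⟨fun x hx => ?_, fun x hx => ?_⟩
    · simp only [Ex.eval, St.setv_m, St.setm_m, h10, e6]
      rw [if_neg (by omega), h1 x hx]
    · simp only [Ex.eval, St.setv_m, St.setm_m, h10, e6, true_and]
      split_ifs with h
      · rw [h1 i hi, show x = i by omega]
      · exact h2 x (by omega)
  intro σ1 F1 h1
  have e0 : σ1.v 0 = p := by rw [F1.1 0 (by simp)]; simp [hp]
  have e1 : σ1.v 1 = q := by rw [F1.1 1 (by simp)]; simp [hq]
  have e2 : σ1.v 2 = r := by rw [F1.1 2 (by simp)]; simp [hr]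
  have e6 : σ1.v 6 = N := by rw [F1.1 6 (by simp)]; simp [hp, hq, hr, ← hNdef]
  refine run_seq (run_fill hB (fun i x => inp (i * q + x)) e0 e1 (by norm_num) (by norm_num)
    (by norm_num) (by simp) (by simp) ?_) ?_
  · intro i hi x hx σ2 F2 h10 h11
    have g1 : σ2.v 1 = q := by rw [F2.1 1 (by simp), e1]
    have g6 : σ2.v 6 = N := by rw [F2.1 6 (by simp), e6]
    have g17 : σ2.m 17 = σ1.m 17 := F2.2.1 17 (by simp)
    refine run_set hB (by norm_num) (by simp [Ex.Ok]) (fun hb => hb.2 _ _) ?_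
    have hlt : i * q + x < N := by
      have := Nat.mul_le_mul_right q (Nat.succ_le_of_lt hi)
      rw [Nat.succ_mul] at this
      omega
    simp [h10, h11, g1, g6, g17, h1 _ hlt]
  intro σ2 F2 h2
  have f0 : σ2.v 0 = p := by rw [F2.1 0 (by simp), e0]
  have f1 : σ2.v 1 = q := by rw [F2.1 1 (by simp), e1]
  have f2 : σ2.v 2 = r := by rw [F2.1 2 (by simp), e2]
  have f6 : σ2.v 6 = N := by rw [F2.1 6 (by simp), e6]
  have m17 : σ2.m 17 = σ1.m 17 := F2.2.1 17 (by simp)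
  refine Run.mono (run_fill (t := 100) hB (fun j x => inp (p * q + (x * r + j))) f2 f1
    (by norm_num) (by norm_num) (by norm_num) (by simp) (by simp) ?_) le_rfl ?_
  · intro j hj x hx σ3 F3 h10 h11
    have g0 : σ3.v 0 = p := by rw [F3.1 0 (by simp), f0]
    have g1 : σ3.v 1 = q := by rw [F3.1 1 (by simp), f1]
    have g2 : σ3.v 2 = r := by rw [F3.1 2 (by simp), f2]
    have g6 : σ3.v 6 = N := by rw [F3.1 6 (by simp), f6]
    have g17 : σ3.m 17 = σ2.m 17 := F3.2.1 17 (by simp)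
    refine run_set hB (by norm_num) (by simp [Ex.Ok]) (fun hb => hb.2 _ _) ?_
    have hlt : p * q + (x * r + j) < N := by
      have := Nat.mul_le_mul_right r (Nat.succ_le_of_lt hx)
      rw [Nat.succ_mul] at this
      omega
    simp [h10, h11, g0, g1, g2, g6, g17, m17, h1 _ hlt]
  · intro σ3 F3 _ h3
    exact ⟨by rw [F3.2.1 0 (by simp)]; exact h2, h3⟩

theorem eq_clog_of_pow {L n : ℕ} (h1 : n ≤ 2 ^ L) (h2 : 2 ^ L < 2 * n) : L = Nat.clog 2 n := by
  refine le_antisymm ?_ (Nat.clog_le_of_le_pow h1)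
  have h3 := Nat.le_pow_clog (b := 2) (by norm_num) n
  have : 2 ^ L < 2 ^ (Nat.clog 2 n + 1) := by rw [pow_succ]; omega
  exact Nat.lt_succ_iff.1 ((Nat.pow_lt_pow_iff_right (by norm_num)).1 this)

/-- A power of 2 is doubled while it is below `n`. While it is below `n`, its exponent equals the
number of rounds, and `n < 2 ^ n` shows that `n` rounds suffice. The last doubling starts below `n`,
so the power ends below `2 * n`, which pins down the exponent. -/
theorem run_sketchLength (hB : Fits B W) {p r K : ℕ} (hp : σ.v 0 = p) (hr : σ.v 2 = r)
    (h1 : 1 ≤ p) (hpr : 2 * (p + r) ≤ B) (hK : K ≤ B) (hKpr : K * (p + r) ≤ B) :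
    Run B W ω (sketchLength K) σ ((p + r) * 410 + 510)
      fun σ' => σ'.v 5 = K * Nat.clog 2 (p + r) := by
  set n := p + r with hn
  refine Run.mono (t := 100 + (100 + (100 + ((n * (((100 + 100) + 200) + 10) + 10) +
    (100 + 100))))) ?_ (by omega) fun _ _ _ h => h
  refine run_seq' (run_set hB (by norm_num) (by simp [Ex.Ok]) (by simp; omega) ?_)
  refine run_seq' (run_set hB (by norm_num) (by simp [Ex.Ok]) (by simp) ?_)
  refine run_seq' (run_set hB (by norm_num) (by simp [Ex.Ok]) (by simp [hp, hr]; omega) ?_)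
  refine run_seq (R := fun σ' => σ'.v 11 = Nat.clog 2 n ∧ σ'.v 11 ≤ n) ?_ ?_
  · refine run_loop hB (n := n) (fun i σ' => σ'.v 10 = 2 ^ σ'.v 11 ∧ σ'.v 10 < 2 * n ∧
      (σ'.v 10 < n → σ'.v 11 = i) ∧ σ'.v 11 ≤ i) (by simp [hp, hr, hn]) (by simp) (by simp)
      (by norm_num) (by norm_num) (by norm_num) (by simp; omega) ?_ ?_
    · intro i hi σ1 F1 h13 ⟨i1, i2, i3, i4⟩
      have e12 : σ1.v 12 = n := by rw [F1.1 12 (by simp)]; simp [hp, hr, hn]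
      refine run_ite hB (by simp [Ex.Ok]) (by simp [Ex.Ok]) ?_ ?_
      · intro h
        simp only [Ex.eval, e12] at h
        have h11 := i3 h
        refine run_seq' (run_set hB (by norm_num) (by simp [Ex.Ok]) (by simp; omega) ?_)
        refine run_set hB (by norm_num) (by simp [Ex.Ok]) (by simp; omega) ?_
        simp [h11, pow_succ] at i1 ⊢
        omega
      · intro h
        simp only [Ex.eval, e12] at h
        refine run_skip ?_
        simp only [St.setv_v]
        norm_num only
        simp only [if_false]
        exact ⟨i1, i2, fun h' => absurd h' h, by omega⟩
    · intro σ1 _ _ ⟨i1, i2, i3, i4⟩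
      refine ⟨eq_clog_of_pow ?_ (i1 ▸ i2), i4⟩
      by_contra hlt
      have := i3 (by omega)
      rw [this] at i1 hlt
      exact hlt (Nat.lt_two_pow_self.le)
  · intro σ1 F1 ⟨h11, hle⟩
    refine run_seq' (run_const hB hK ?_)
    have hv : σ1.v 11 * K ≤ B := by
      rw [mul_comm]
      exact (Nat.mul_le_mul_left K hle).trans hKpr
    refine run_set hB (by norm_num) (by simp [Ex.Ok]) (fun _ => ?_) ?_
    · simpa [mul_comm] using hv
    · simp [h11]

/-- No coin has been tossed before, so entry `x` is precisely coin `x` and the random vectors are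
consecutive blocks of `ω`. -/
theorem run_tossCoins (hB : Fits B W) {q D : ℕ} (hq : σ.v 1 = q) (hD : σ.v 5 = D)
    (hc : σ.coins = 0) (hDq : D * q ≤ B) :
    Run B W ω tossCoins σ (D * q * 310 + 110)
      fun σ' => ∀ x < D * q, σ'.m 16 x = (ω x).toNat := by
  refine Run.mono (t := 100 + (D * q * ((100 + 200) + 10) + 10)) ?_ (by omega) fun _ _ _ h => h
  refine run_seq' (run_set hB (by norm_num) (by simp [Ex.Ok]) (by simp [hq, hD, hDq]) ?_)
  refine run_loop hB (fun i σ' => σ'.coins = i ∧ ∀ x < i, σ'.m 16 x = (ω x).toNat)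
    (by simp [hq, hD]) (by simp) (by simp) (by norm_num) (by norm_num) (by norm_num)
    (by simp [hc]) ?_ fun _ _ _ h => h.2
  intro i hi σ1 F1 h10 ⟨h1, h2⟩
  refine run_seq' (run_flip hB ?_)
  refine run_put hB (by norm_num) (by simp [Ex.Ok]) (by simp [Ex.Ok]) (fun hb => hb.1 _)
    ⟨by simp [h1], fun x hx => ?_⟩
  have e10 : (σ1.setv 11 (ω σ1.coins).toNat).v 10 = i := by simp [h10]
  have e11 : (σ1.setv 11 (ω σ1.coins).toNat).v 11 = (ω i).toNat := by simp [h1]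
  simp only [Ex.eval, St.setv_m, St.setm_m, e10, e11, true_and]
  split_ifs with h
  · rw [h]
  · exact h2 x (by omega)

theorem run_centerProducts (hB : Fits B W) {p q r l k : ℕ} {X Y estX estY : ℕ → ℕ → ℕ}
    (hq : σ.v 1 = q) (hl : σ.v 3 = l) (hk : σ.v 4 = k) (hX : Clustered σ.m 0 p l q X estX)
    (hY : Clustered σ.m 8 r k q Y estY) (hX1 : ∀ v < p, ∀ x < q, X v x ≤ 1)
    (hY1 : ∀ v < r, ∀ x < q, Y v x ≤ 1) (hqB : q ≤ B) :
    Run B W ω centerProducts σ (l * (k * (q * 110 + 520) + 20) + 10) fun σ' =>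
      ∀ a < l, ∀ b < k,
        σ'.m 18 (a * k + b) = ∑ x ∈ Finset.range q, X (σ.m 4 a) x * Y (σ.m 12 b) x := by
  refine Run.mono (t := l * (k * ((100 + (100 + (q * 110 + 110))) + 210) + 20) + 10) ?_
    (by ring_nf; omega) fun _ _ _ h => h
  refine run_fill hB (fun a b => ∑ x ∈ Finset.range q, X (σ.m 4 a) x * Y (σ.m 12 b) x) hl hk
    (by norm_num) (by norm_num) (by norm_num) (by simp) (by simp) ?_
  intro a ha b hb σ1 F1 h10 h11
  have hac : σ.m 4 a < p := hX.ctr_lt a ha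
  have hbc : σ.m 12 b < r := hY.ctr_lt b hb
  have e1 : σ1.v 1 = q := by rw [F1.1 1 (by simp), hq]
  have m0 : σ1.m 0 = σ.m 0 := F1.2.1 0 (by simp)
  have m4 : σ1.m 4 = σ.m 4 := F1.2.1 4 (by simp)
  have m8 : σ1.m 8 = σ.m 8 := F1.2.1 8 (by simp)
  have m12 : σ1.m 12 = σ.m 12 := F1.2.1 12 (by simp)
  refine run_seq' (run_set hB (by norm_num) (by simp [Ex.Ok]) (fun hb => hb.2 _ _) ?_)
  refine run_seq' (run_set hB (by norm_num) (by simp [Ex.Ok]) (fun hb => hb.2 _ _) ?_)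
  refine run_sumTo hB (fun x => X (σ.m 4 a) x * Y (σ.m 12 b) x) (by simp [e1]) (by norm_num)
    (by norm_num) (by norm_num) (by norm_num) (by norm_num) (by norm_num) (by simp [Ex.Ok]) ?_ ?_
  · intro x hx σ2 m2 w2 h12
    have pX := hX.point _ hac x hx
    have pY := hY.point _ hbc x hx
    simp [m2, w2, h12, h10, h11, e1, m0, m4, m8, m12, pX, pY]
  · refine le_trans (Finset.sum_le_card_nsmul _ _ 1 fun s hs => ?_) (by simpa using hqB)
    have hs := Finset.mem_range.1 hs
    exact Nat.mul_le_mul (hX1 _ hac s hs) (hY1 _ hbc s hs)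

theorem Clustered.congr {m m' : ℕ → ℕ → ℕ} {o n l q : ℕ} {X est : ℕ → ℕ → ℕ}
    (h : Clustered m o n l q X est) (hm : ∀ a, o ≤ a → a < o + 7 → m' a = m a) :
    Clustered m' o n l q X est := by
  have h0 := hm o (by omega) (by omega)
  have h3 := hm (o + 3) (by omega) (by omega)
  have h4 := hm (o + 4) (by omega) (by omega)
  have h5 := hm (o + 5) (by omega) (by omega)
  have h6 := hm (o + 6) (by omega) (by omega)
  obtain ⟨a, b, c, d, e⟩ := h
  refine ⟨?_, ?_, ?_, ?_, ?_⟩ <;> simp only [h0, h3, h4, h5, h6] <;> assumption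

/-- Both clusterings use the same random vectors; no independence between them is required. The
second one writes only to arrays 9 to 14, so the data of the first survive. -/
theorem run_prep (hB : Fits B W) {p q r l k K D : ℕ} {inp : ℕ → ℕ} {X Y w : ℕ → ℕ → ℕ}
    (hp : σ.v 0 = p) (hq : σ.v 1 = q) (hr : σ.v 2 = r) (hl : σ.v 3 = l) (hk : σ.v 4 = k)
    (hc : σ.coins = 0) (hl0 : 0 < l) (hlp : l ≤ p) (hk0 : 0 < k) (hkr : k ≤ r)
    (hinp : ∀ x < p * q + q * r, σ.m (x % 32) (x / 32) = inp x)
    (hX : ∀ i < p, ∀ x < q, inp (i * q + x) = X i x)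
    (hY : ∀ j < r, ∀ x < q, inp (p * q + (x * r + j)) = Y j x)
    (hX1 : ∀ v < p, ∀ x < q, X v x ≤ 1) (hY1 : ∀ v < r, ∀ x < q, Y v x ≤ 1)
    (hw : ∀ j x, w j x = (ω (j * q + x)).toNat)
    (hD : D = K * Nat.clog 2 (p + r)) (hN : p * q + q * r ≤ B) (hpr : 2 * (p + r) ≤ B)
    (hK : K ≤ B) (hKpr : K * (p + r) ≤ B) (hDq : D * q + 1 ≤ B) (hqB : q ≤ B) :
    Run B W ω (prep K) σ (prepTime p q r l k D) fun σ' =>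
      Prepared σ'.m p q r l k X Y (sketchDist q D w X) (sketchDist q D w Y) := by
  refine Run.mono (t := ((p * q + q * r) * 210 + p * (q * 310 + 20) + r * (q * 310 + 20) + 130) +
    (((p + r) * 410 + 510) + ((D * q * 310 + 110) + (100 + (100 + (clusterTime p l q D +
    (100 + (100 + (clusterTime r k q D + ((l * (k * (q * 110 + 520) + 20) + 10) +
    (200 + 200))))))))))) ?_ (by unfold prepTime; omega) fun _ _ _ h => h
  have hw1 : ∀ j < D, ∀ x < q, w j x ≤ 1 := fun j _ x _ => by rw [hw]; exact Bool.toNat_le _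
  refine run_seq (run_setup hB hp hq hr hN hinp) ?_
  intro σ1 F1 ⟨h0, h8⟩
  have f1 : ∀ x, x < 5 → σ1.v x = σ.v x := fun x hx =>
    F1.1 x (by simp [setup]; omega)
  have c1 : σ1.coins = 0 := by rw [F1.2.2 (by simp [setup]), hc]
  refine run_seq (run_sketchLength hB ((f1 0 (by norm_num)).trans hp) ((f1 2 (by norm_num)).trans hr)
    (by omega) hpr hK hKpr) ?_
  intro σ2 F2 h5
  rw [← hD] at h5
  have f2 : ∀ x, x < 5 → σ2.v x = σ.v x := fun x hx => by
    rw [F2.1 x (by simp [sketchLength]; omega), f1 x hx]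
  have c2 : σ2.coins = 0 := by rw [F2.2.2 (by simp [sketchLength]), c1]
  have m2 : σ2.m = σ1.m := F2.m_eq (by simp [sketchLength])
  refine run_seq (run_tossCoins hB ((f2 1 (by norm_num)).trans hq) h5 c2 (by omega)) ?_
  intro σ3 F3 h16
  have f3 : ∀ x, x < 5 → σ3.v x = σ.v x := fun x hx => by
    rw [F3.1 x (by simp [tossCoins]; omega), f2 x hx]
  have f35 : σ3.v 5 = D := by rw [F3.1 5 (by simp [tossCoins]), h5]
  have m30 : σ3.m 0 = σ1.m 0 := by rw [F3.2.1 0 (by simp [tossCoins]), m2]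
  have m38 : σ3.m 8 = σ1.m 8 := by rw [F3.2.1 8 (by simp [tossCoins]), m2]
  refine run_seq' (run_set hB (by norm_num) (by simp [Ex.Ok]) (fun hb => hb.1 _) ?_)
  refine run_seq' (run_set hB (by norm_num) (by simp [Ex.Ok]) (fun hb => hb.1 _) ?_)
  have hwm : ∀ j < D, ∀ x < q, σ3.m 16 (j * q + x) = w j x := by
    intro j hj x hx
    rw [hw, h16]
    have := Nat.mul_le_mul_right q (Nat.succ_le_of_lt hj)
    rw [Nat.succ_mul] at this
    omega
  refine run_seq (run_cluster (X := X) (w := w) (n := p) (l := l) (q := q) (D := D) hB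
    (by norm_num) (by simp [f3, hq]) (by simp [f35])
    (by simp [f3, hp]) (by simp [f3, hl]) (by omega) hl0 ?_ hX1 (by simpa using hwm) hw1 hqB hDq) ?_
  · intro i hi x hx
    simp only [St.setv_m, m30, h0 i hi x hx, hX i hi x hx]
  intro σ4 F4 hA
  have f4 : ∀ x, x < 5 → σ4.v x = σ.v x := fun x hx => by
    rw [F4.1 x (keeps_cluster (by omega)), ← f3 x hx]
    simp [show x ≠ 8 by omega, show x ≠ 9 by omega]
  have f45 : σ4.v 5 = D := by
    rw [F4.1 5 (keeps_cluster (by omega))]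
    simp [f35]
  have m48 : σ4.m 8 = σ1.m 8 := by
    rw [F4.2.1 8 (keepsArr_cluster (by norm_num))]; simpa using m38
  have m416 : σ4.m 16 = σ3.m 16 := by
    rw [F4.2.1 16 (keepsArr_cluster (by norm_num))]; simp
  refine run_seq' (run_set hB (by norm_num) (by simp [Ex.Ok]) (fun hb => hb.1 _) ?_)
  refine run_seq' (run_set hB (by norm_num) (by simp [Ex.Ok]) (fun hb => hb.1 _) ?_)
  refine run_seq (run_cluster (X := Y) (w := w) (n := r) (l := k) (q := q) (D := D) hB
    (by norm_num) (by simp [f4, hq]) (by simp [f45])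
    (by simp [f4, hr]) (by simp [f4, hk]) (by omega) hk0 ?_ hY1
    (by simpa [m416] using hwm) hw1 hqB hDq) ?_
  · intro i hi x hx
    simp only [St.setv_m, m48, h8 i hi x hx, hY i hi x hx]
  intro σ5 F5 hBc
  have f5 : ∀ x, x < 5 → σ5.v x = σ.v x := fun x hx => by
    rw [F5.1 x (keeps_cluster (by omega)), ← f4 x hx]
    simp [show x ≠ 8 by omega, show x ≠ 9 by omega]
  have hA5 : Clustered σ5.m 0 p l q X (sketchDist q D w X) := hA.congr fun a _ ha => by
    rw [F5.2.1 a (keepsArr_cluster (by omega))]; simp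
  refine run_seq (run_centerProducts hB ((f5 1 (by norm_num)).trans hq)
    ((f5 3 (by norm_num)).trans hl) ((f5 4 (by norm_num)).trans hk) hA5 hBc hX1 hY1 hqB) ?_
  intro σ6 F6 h18
  have m6 : ∀ a ≠ 18, σ6.m a = σ5.m a := fun a ha => F6.2.1 a (by simp [centerProducts, ha])
  have e1 : σ6.v 1 = q := by rw [F6.1 1 (by simp [centerProducts]), f5 1 (by norm_num), hq]
  have e4 : σ6.v 4 = k := by rw [F6.1 4 (by simp [centerProducts]), f5 4 (by norm_num), hk]
  refine run_seq' (run_put hB (by norm_num) (by simp [Ex.Ok]) (by simp [Ex.Ok])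
    (fun hb => hb.1 _) ?_)
  refine run_put hB (by norm_num) (by simp [Ex.Ok]) (by simp [Ex.Ok]) (fun hb => hb.1 _) ?_
  set σ7 := (σ6.setm 19 ((Ex.const 0).eval σ6) ((Ex.var 1).eval σ6)) with h7
  have m7 : ∀ a ≠ 18, a ≠ 19 → (σ7.setm 19 ((Ex.const 1).eval σ7) ((Ex.var 4).eval σ7)).m a =
      σ5.m a := fun a h1 h2 => by
    rw [St.setm_m_of_ne _ _ _ h2, h7, St.setm_m_of_ne _ _ _ h2, m6 a h1]
  refine ⟨hA5.congr fun a _ ha => m7 a (by omega) (by omega),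
    hBc.congr fun a _ ha => m7 a (by omega) (by omega), fun a ha b hb => ?_, ?_, ?_⟩
  · rw [m7 4 (by norm_num) (by norm_num), m7 12 (by norm_num) (by norm_num), ← h18 a ha b hb,
      St.setm_m_of_ne _ _ _ (by norm_num), h7, St.setm_m_of_ne _ _ _ (by norm_num)]
  · simp [h7, e1]
  · simp [h7, e4]

end Prep

/-! ### Concentration of the sketch distance -/

/-- A signed sum: the coin `b m` decides about the sign of `a m`. -/
noncomputable def signedSum {n : ℕ} (a : Fin n → ℝ) (b : Fin n → Bool) : ℝ :=
  ∑ m, a m * (1 - 2 * ((b m).toNat : ℝ))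

theorem sum_bool_cons {n : ℕ} (f : (Fin (n + 1) → Bool) → ℝ) :
    ∑ b, f b = ∑ b : Fin n → Bool, (f (Fin.cons false b) + f (Fin.cons true b)) := by
  rw [← (Fin.consEquiv fun _ => Bool).sum_comp, Fintype.sum_prod_type]
  simp [Fin.consEquiv, Finset.sum_add_distrib, add_comm]

theorem signedSum_cons_false {n : ℕ} (a : Fin (n + 1) → ℝ) (b : Fin n → Bool) :
    signedSum a (Fin.cons false b) = signedSum (fun m => a m.succ) b + a 0 := by
  simp [signedSum, Fin.sum_univ_succ, add_comm]

theorem signedSum_cons_true {n : ℕ} (a : Fin (n + 1) → ℝ) (b : Fin n → Bool) :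
    signedSum a (Fin.cons true b) = signedSum (fun m => a m.succ) b - a 0 := by
  simp [signedSum, Fin.sum_univ_succ]; ring

/-- The second moment. Averaging over the first sign cancels the cross term. -/
theorem sum_signedSum_sq {n : ℕ} (a : Fin n → ℝ) :
    ∑ b, signedSum a b ^ 2 = 2 ^ n * ∑ m, a m ^ 2 := by
  induction n with
  | zero => simp [signedSum]
  | succ n ih =>
    simp only [sum_bool_cons, signedSum_cons_false, signedSum_cons_true]
    have h : ∀ b : Fin n → Bool, (signedSum (fun m => a m.succ) b + a 0) ^ 2 +
        (signedSum (fun m => a m.succ) b - a 0) ^ 2 =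
        2 * signedSum (fun m => a m.succ) b ^ 2 + 2 * a 0 ^ 2 := fun b => by ring
    simp only [h, Finset.sum_add_distrib, ← Finset.mul_sum, ih, Fin.sum_univ_succ]
    simp
    ring

/-- The fourth moment. Averaging over the first sign leaves S⁴ + 6a²S² + a⁴, which is compared with
3(V + a²)² for V the sum of the other squares. -/
theorem sum_signedSum_four_le {n : ℕ} (a : Fin n → ℝ) :
    ∑ b, signedSum a b ^ 4 ≤ 2 ^ n * (3 * (∑ m, a m ^ 2) ^ 2) := by
  induction n with
  | zero => simp [signedSum]
  | succ n ih =>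
    simp only [sum_bool_cons, signedSum_cons_false, signedSum_cons_true]
    have h : ∀ b : Fin n → Bool, (signedSum (fun m => a m.succ) b + a 0) ^ 4 +
        (signedSum (fun m => a m.succ) b - a 0) ^ 4 =
        2 * signedSum (fun m => a m.succ) b ^ 4 +
          12 * a 0 ^ 2 * signedSum (fun m => a m.succ) b ^ 2 + 2 * a 0 ^ 4 := fun b => by ring
    simp only [h, Finset.sum_add_distrib, ← Finset.mul_sum, sum_signedSum_sq, Fin.sum_univ_succ]
    have := ih fun m => a m.succ
    have h2 : (0 : ℝ) < 2 ^ n := by positivity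
    simp only [Finset.sum_const, Finset.card_univ, Fintype.card_pi, Fintype.card_bool,
      Finset.prod_const, Fintype.card_fin, nsmul_eq_mul, Nat.cast_pow, Nat.cast_ofNat]
    have h4 : 0 ≤ (2 : ℝ) ^ n * a 0 ^ 4 := by positivity
    rw [pow_succ (2 : ℝ) n]
    linarith [h4, this]

/-- The sub-Gaussian bound: each sign contributes a factor cosh(s·a) ≤ exp(s²a²/2). -/
theorem sum_exp_signedSum_le {n : ℕ} (a : Fin n → ℝ) (s : ℝ) :
    ∑ b, Real.exp (s * signedSum a b) ≤ 2 ^ n * Real.exp (s ^ 2 * (∑ m, a m ^ 2) / 2) := by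
  induction n with
  | zero => simp [signedSum]
  | succ n ih =>
    simp only [sum_bool_cons, signedSum_cons_false, signedSum_cons_true]
    have h : ∀ b : Fin n → Bool, Real.exp (s * (signedSum (fun m => a m.succ) b + a 0)) +
        Real.exp (s * (signedSum (fun m => a m.succ) b - a 0)) =
        2 * Real.cosh (s * a 0) * Real.exp (s * signedSum (fun m => a m.succ) b) := fun b => by
      rw [Real.cosh_eq, mul_add, mul_sub, Real.exp_add, sub_eq_add_neg, Real.exp_add]; ring
    simp only [h, ← Finset.mul_sum]
    calc _ ≤ 2 * Real.exp ((s * a 0) ^ 2 / 2) *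
          (2 ^ n * Real.exp (s ^ 2 * (∑ m : Fin n, a m.succ ^ 2) / 2)) := by
          refine mul_le_mul (mul_le_mul_of_nonneg_left (Real.cosh_le_exp_half_sq _) (by norm_num))
            (ih _) (Finset.sum_nonneg fun _ _ => (Real.exp_pos _).le) (by positivity)
      _ = _ := by
          rw [Fin.sum_univ_succ, show s ^ 2 * (a 0 ^ 2 + ∑ m : Fin n, a m.succ ^ 2) / 2 =
            (s * a 0) ^ 2 / 2 + s ^ 2 * (∑ m : Fin n, a m.succ ^ 2) / 2 by ring, Real.exp_add]
          ring

/-- The right side contains even powers only, so for x = |S|/√d its mean is controlled by the second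
and fourth moments. It is at least 1/(1 + x), and hence at least exp(-x). -/
theorem exp_neg_le_quartic {x : ℝ} (hx : 0 ≤ x) :
    Real.exp (-x) ≤ 1 - x ^ 2 / 2 + x ^ 4 / 8 := by
  have h1 : Real.exp (-x) ≤ 1 / (1 + x) := by
    rw [Real.exp_neg, ← one_div]
    exact one_div_le_one_div_of_le (by linarith) (by linarith [Real.add_one_le_exp x])
  refine h1.trans ?_
  rw [div_le_iff₀ (by linarith)]
  rcases le_total x 1 with h | h
  · have h3 : 0 ≤ x * (1 - x) := mul_nonneg hx (by linarith)
    nlinarith [pow_nonneg hx 3, pow_nonneg hx 4, pow_nonneg hx 5, mul_nonneg h3 hx]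
  · nlinarith [sq_nonneg (x ^ 2 - 2), mul_nonneg hx (sq_nonneg (x ^ 2 - 2))]

/-- Markov's inequality for the exponential of a sum over independent blocks. -/
theorem card_le_of_sum_exp {n D : ℕ} (f : (Fin n → Bool) → ℝ) {c ρ : ℝ}
    (h : Real.exp c * ∑ b, Real.exp (f b) ≤ 2 ^ n * ρ) (S : Finset (Fin D → Fin n → Bool))
    (hS : ∀ T ∈ S, 0 ≤ D * c + ∑ j, f (T j)) : (S.card : ℝ) ≤ 2 ^ (D * n) * ρ ^ D := by
  calc (S.card : ℝ) = ∑ T ∈ S, 1 := by simp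
    _ ≤ ∑ T ∈ S, Real.exp (D * c + ∑ j, f (T j)) :=
        Finset.sum_le_sum fun T hT => Real.one_le_exp (hS T hT)
    _ ≤ ∑ T : Fin D → Fin n → Bool, Real.exp (D * c + ∑ j, f (T j)) :=
        Finset.sum_le_sum_of_subset_of_nonneg (Finset.subset_univ _)
          fun _ _ _ => (Real.exp_pos _).le
    _ = (Real.exp c * ∑ b, Real.exp (f b)) ^ D := by
        rw [mul_pow, Fintype.sum_pow, Finset.mul_sum]
        simp only [Real.exp_add, Real.exp_sum, Real.exp_nat_mul]
    _ ≤ (2 ^ n * ρ) ^ D := pow_le_pow_left₀ (mul_nonneg (Real.exp_pos _).le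
        (Finset.sum_nonneg fun _ _ => (Real.exp_pos _).le)) h D
    _ = _ := by rw [mul_pow, ← pow_mul, mul_comm n]

/-- The moments of S/√d are 1 and at most 3, and 1 - 1/2 + 3/8 = 7/8. This prevents |S| from being
small too often. -/
theorem sum_exp_neg_abs_le {n : ℕ} (a : Fin n → ℝ) {d : ℝ} (hd : 0 < d)
    (ha : ∑ m, a m ^ 2 = d) :
    ∑ b, Real.exp (-(|signedSum a b| / √d)) ≤ 2 ^ n * (7 / 8) := by
  have hs : √d ^ 2 = d := Real.sq_sqrt hd.le
  have hs0 : √d ≠ 0 := (Real.sqrt_pos.2 hd).ne'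
  calc _ ≤ ∑ b, (1 - signedSum a b ^ 2 / (2 * d) + signedSum a b ^ 4 / (8 * d ^ 2)) := by
        refine Finset.sum_le_sum fun b _ => (exp_neg_le_quartic (by positivity)).trans_eq ?_
        rw [div_pow, div_pow, sq_abs, show √d ^ 4 = (√d ^ 2) ^ 2 by ring, hs,
          show |signedSum a b| ^ 4 = signedSum a b ^ 4 from Even.pow_abs (by decide) _]
        ring
    _ = 2 ^ n - (2 ^ n * d) / (2 * d) + (∑ b, signedSum a b ^ 4) / (8 * d ^ 2) := by
        rw [Finset.sum_add_distrib, Finset.sum_sub_distrib, ← Finset.sum_div, ← Finset.sum_div,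
          sum_signedSum_sq, ha]
        simp
    _ ≤ 2 ^ n - (2 ^ n * d) / (2 * d) + (2 ^ n * (3 * d ^ 2)) / (8 * d ^ 2) := by
        gcongr
        exact ha ▸ sum_signedSum_four_le a
    _ = _ := by field_simp; ring

theorem sum_exp_abs_le {n : ℕ} (a : Fin n → ℝ) {d : ℝ} (hd : 0 < d) (ha : ∑ m, a m ^ 2 = d) :
    ∑ b, Real.exp (|signedSum a b| / √d) ≤ 2 ^ n * (2 * Real.exp (1 / 2)) := by
  have hs : √d ^ 2 = d := Real.sq_sqrt hd.le
  have hs0 : √d ≠ 0 := (Real.sqrt_pos.2 hd).ne'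
  have h1 := sum_exp_signedSum_le a (1 / √d)
  have h2 := sum_exp_signedSum_le a (-(1 / √d))
  rw [ha, neg_sq, div_pow, hs, one_pow, one_div_mul_cancel hd.ne'] at h2
  rw [ha, div_pow, hs, one_pow, one_div_mul_cancel hd.ne'] at h1
  calc _ ≤ ∑ b, (Real.exp (1 / √d * signedSum a b) + Real.exp (-(1 / √d) * signedSum a b)) := by
        refine Finset.sum_le_sum fun b _ => ?_
        rcases abs_cases (signedSum a b) with ⟨h, _⟩ | ⟨h, _⟩ <;> rw [h]
        · rw [show signedSum a b / √d = 1 / √d * signedSum a b by ring]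
          linarith [Real.exp_pos (-(1 / √d) * signedSum a b)]
        · rw [show -signedSum a b / √d = -(1 / √d) * signedSum a b by ring]
          linarith [Real.exp_pos (1 / √d * signedSum a b)]
    _ ≤ _ := by rw [Finset.sum_add_distrib]; linarith

open Classical in
-- Chernoff bounds for both tails. Per row, the lower tail costs a factor e^(1/10)·7/8 and the upper
-- tail e^(-2)·2e^(1/2); both are at most 97/100.
theorem card_bad_le {n : ℕ} (a : Fin n → ℝ) {d : ℝ} (hd : 0 < d) (ha : ∑ m, a m ^ 2 = d) (D : ℕ) :
    ((Finset.univ.filter fun T : Fin D → Fin n → Bool =>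
      ¬ (D / 10 * √d ≤ ∑ j, |signedSum a (T j)| ∧ ∑ j, |signedSum a (T j)| ≤ 2 * D * √d)).card : ℝ)
      ≤ 2 ^ (D * n) * (2 * (97 / 100) ^ D) := by
  have hs0 : 0 < √d := Real.sqrt_pos.2 hd
  have e1 : Real.exp (1 / 10) ≤ 1108 / 1000 := by
    refine le_of_pow_le_pow_left₀ (n := 10) (by norm_num) (by norm_num) ?_
    rw [← Real.exp_nat_mul]
    norm_num
    linarith [Real.exp_one_lt_d9]
  have e2 : Real.exp (-2) * (2 * Real.exp (1 / 2)) ≤ 97 / 100 := by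
    have h1 := Real.add_one_le_exp (3 / 2 : ℝ)
    have h2 : Real.exp (-2) * (2 * Real.exp (1 / 2)) = 2 * Real.exp (-(3 / 2)) := by
      rw [mul_left_comm, ← Real.exp_add]; norm_num
    rw [h2, Real.exp_neg]
    have : (Real.exp (3 / 2))⁻¹ ≤ (5 / 2 : ℝ)⁻¹ := inv_anti₀ (by norm_num) (by linarith)
    norm_num at this ⊢
    linarith
  have h1 := card_le_of_sum_exp (D := D) (fun b => -(|signedSum a b| / √d)) (c := 1 / 10)
    (ρ := 97 / 100) (by
      calc _ ≤ 1108 / 1000 * (2 ^ n * (7 / 8)) :=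
            mul_le_mul e1 (sum_exp_neg_abs_le a hd ha)
              (Finset.sum_nonneg fun _ _ => (Real.exp_pos _).le) (by norm_num)
        _ ≤ _ := by have : (0 : ℝ) < 2 ^ n := by positivity
                    nlinarith)
    (Finset.univ.filter fun T => ∑ j, |signedSum a (T j)| < D / 10 * √d) (fun T hT => by
      have hT := (Finset.mem_filter.1 hT).2
      rw [Finset.sum_neg_distrib, ← Finset.sum_div]
      have := (div_le_iff₀ hs0).2 hT.le
      linarith)
  have h2 := card_le_of_sum_exp (D := D) (fun b => |signedSum a b| / √d) (c := -2)
    (ρ := 97 / 100) (by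
      calc _ ≤ Real.exp (-2) * (2 ^ n * (2 * Real.exp (1 / 2))) :=
            mul_le_mul_of_nonneg_left (sum_exp_abs_le a hd ha) (Real.exp_pos _).le
        _ = 2 ^ n * (Real.exp (-2) * (2 * Real.exp (1 / 2))) := by ring
        _ ≤ _ := by gcongr)
    (Finset.univ.filter fun T => 2 * D * √d < ∑ j, |signedSum a (T j)|) (fun T hT => by
      have hT := (Finset.mem_filter.1 hT).2
      rw [← Finset.sum_div]
      have := (le_div_iff₀ hs0).2 hT.le
      linarith)
  have hsub : (Finset.univ.filter fun T : Fin D → Fin n → Bool =>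
      ¬ (D / 10 * √d ≤ ∑ j, |signedSum a (T j)| ∧ ∑ j, |signedSum a (T j)| ≤ 2 * D * √d)) ⊆
      (Finset.univ.filter fun T => ∑ j, |signedSum a (T j)| < D / 10 * √d) ∪
      (Finset.univ.filter fun T => 2 * D * √d < ∑ j, |signedSum a (T j)|) := by
    intro T hT
    simp only [Finset.mem_filter, Finset.mem_union, Finset.mem_univ, true_and, not_and_or,
      not_le] at hT ⊢
    exact hT
  have h3 : ((Finset.univ.filter fun T : Fin D → Fin n → Bool =>
      ¬ (D / 10 * √d ≤ ∑ j, |signedSum a (T j)| ∧ ∑ j, |signedSum a (T j)| ≤ 2 * D * √d)).card : ℝ)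
      ≤ _ := Nat.cast_le.2 ((Finset.card_le_card hsub).trans (Finset.card_union_le _ _))
  push_cast at h3
  linarith

open MeasureTheory in
/-- An event about the first `D * q` coins, arranged in `D` rows. -/
theorem coinMeasure_rows_le (D q : ℕ) (S : Finset (Fin D → Fin q → Bool)) :
    coinMeasure {ω | (fun (j : Fin D) (m : Fin q) => ω (j * q + m)) ∈ S} ≤
      S.card * (1 / 2) ^ (D * q) := by
  have hinj : Set.InjOn (fun x : Fin D × Fin q => (x.1 : ℕ) * q + x.2)
      (Finset.univ : Finset (Fin D × Fin q)) := by
    rintro ⟨j, m⟩ _ ⟨j', m'⟩ _ h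
    obtain ⟨h1, h2⟩ := row_index_inj m.2 m'.2 h
    exact Prod.ext (Fin.ext h1) (Fin.ext h2)
  have hsub : {ω : ℕ → Bool | (fun (j : Fin D) (m : Fin q) => ω (j * q + m)) ∈ S} ⊆
      ⋃ T ∈ S, {ω | (fun (j : Fin D) (m : Fin q) => ω (j * q + m)) = T} := by
    intro ω hω
    simpa using hω
  refine (measure_mono hsub).trans ((measure_biUnion_finset_le _ _).trans ?_)
  rw [← nsmul_eq_mul]
  refine Finset.sum_le_card_nsmul _ _ _ fun T _ => ?_
  set g : ℕ → Bool := fun x => if h : x / q < D ∧ x % q < q then T ⟨x / q, h.1⟩ ⟨x % q, h.2⟩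
    else false with hg
  have hgT : ∀ (j : Fin D) (m : Fin q), g (j * q + m) = T j m := by
    intro j m
    have h2 : (j * q + m : ℕ) % q = m := by
      rw [mul_comm, Nat.mul_add_mod, Nat.mod_eq_of_lt m.2]
    have h1 : (j * q + m : ℕ) / q = j := by
      rw [mul_comm, Nat.mul_add_div m.pos, Nat.div_eq_of_lt m.2, add_zero]
    simp [hg, h1, h2]
  -- A prescribed pattern fixes `D * q` distinct coins, so it lies in a cylinder of measure `(1 / 2)
  -- ^ (D * q)`.
  have hset : {ω : ℕ → Bool | (fun (j : Fin D) (m : Fin q) => ω (j * q + m)) = T} ⊆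
      ((Finset.univ.image fun x : Fin D × Fin q => (x.1 : ℕ) * q + x.2 : Finset ℕ) : Set ℕ).pi
        fun x => {g x} := by
    intro ω hω x hx
    obtain ⟨⟨j, m⟩, _, rfl⟩ := Finset.mem_image.1 (Finset.mem_coe.1 hx)
    rw [Set.mem_singleton_iff, hgT]
    exact congr_fun (congr_fun hω j) m
  refine (measure_mono hset).trans ?_
  unfold coinMeasure
  rw [Measure.infinitePi_pi _ fun _ _ => measurableSet_singleton _, Finset.prod_image hinj]
  simp

theorem cast_absDiff (x y : ℕ) : (absDiff x y : ℝ) = |(x : ℝ) - y| := by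
  unfold absDiff
  rcases le_total x y with h | h
  · rw [Nat.sub_eq_zero_of_le h, zero_add, Nat.cast_sub h, abs_sub_comm, abs_of_nonneg]
    exact sub_nonneg.2 (Nat.cast_le.2 h)
  · rw [Nat.sub_eq_zero_of_le h, add_zero, Nat.cast_sub h, abs_of_nonneg]
    exact sub_nonneg.2 (Nat.cast_le.2 h)

/-- The link between sketches and signed sums: |x - b| - |y - b| = (x - y)(1 - 2b) for bits x, y, b.
-/
theorem cast_hdist_sub_hdist {q : ℕ} {x y : ℕ → ℕ} (hx : ∀ m < q, x m ≤ 1) (hy : ∀ m < q, y m ≤ 1)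
    (b : ℕ → Bool) : (hdist q x (fun m => (b m).toNat) : ℝ) - hdist q y (fun m => (b m).toNat) =
      signedSum (fun m : Fin q => (x m : ℝ) - y m) fun m => b m := by
  unfold hdist signedSum
  push_cast
  rw [← Finset.sum_sub_distrib, ← Fin.sum_univ_eq_sum_range]
  refine Finset.sum_congr rfl fun m _ => ?_
  have h1 : x m = 0 ∨ x m = 1 := by have := hx m m.2; omega
  have h2 : y m = 0 ∨ y m = 1 := by have := hy m m.2; omega
  rw [cast_absDiff, cast_absDiff]
  rcases h1 with h1 | h1 <;> rcases h2 with h2 | h2 <;> cases b m <;> rw [h1, h2] <;> norm_num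

theorem sum_sq_sub_eq_hdist {q : ℕ} {x y : ℕ → ℕ} (hx : ∀ m < q, x m ≤ 1) (hy : ∀ m < q, y m ≤ 1) :
    ∑ m : Fin q, ((x m : ℝ) - y m) ^ 2 = hdist q x y := by
  unfold hdist
  push_cast
  rw [← Fin.sum_univ_eq_sum_range (fun m => (absDiff (x m) (y m) : ℝ))]
  refine Finset.sum_congr rfl fun m _ => ?_
  have h1 : x m = 0 ∨ x m = 1 := by have := hx m m.2; omega
  have h2 : y m = 0 ∨ y m = 1 := by have := hy m m.2; omega
  rw [cast_absDiff]
  rcases h1 with h1 | h1 <;> rcases h2 with h2 | h2 <;> rw [h1, h2] <;> norm_num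

/-- The coins in rows of length `q`, as numbers. -/
def coinRows (q : ℕ) (ω : ℕ → Bool) (j x : ℕ) : ℕ := (ω (j * q + x)).toNat

/-- The sketch distance of `X v` and `X u` determines their Hamming distance up to constants. -/
def SketchGood (q D : ℕ) (w X : ℕ → ℕ → ℕ) (v u : ℕ) : Prop :=
  D / 10 * √(hdist q (X v) (X u)) ≤ sketchDist q D w X v u ∧
    (sketchDist q D w X v u : ℝ) ≤ 2 * D * √(hdist q (X v) (X u))

theorem coinMeasure_not_sketchGood_le {q D : ℕ} {X : ℕ → ℕ → ℕ} {v u : ℕ}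
    (hv : ∀ m < q, X v m ≤ 1) (hu : ∀ m < q, X u m ≤ 1) :
    coinMeasure {ω | ¬ SketchGood q D (coinRows q ω) X v u} ≤
      ENNReal.ofReal (2 * (97 / 100) ^ D) := by
  classical
  set a : Fin q → ℝ := fun m => (X v m : ℝ) - X u m with ha
  have hda : ∑ m, a m ^ 2 = hdist q (X v) (X u) := sum_sq_sub_eq_hdist hv hu
  have hS : ∀ ω, (sketchDist q D (coinRows q ω) X v u : ℝ) =
      ∑ j : Fin D, |signedSum a fun m : Fin q => ω (j * q + m)| := by
    intro ω
    unfold sketchDist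
    push_cast
    rw [← Fin.sum_univ_eq_sum_range (fun j => (absDiff (hdist q (X v) (coinRows q ω j))
      (hdist q (X u) (coinRows q ω j)) : ℝ))]
    refine Finset.sum_congr rfl fun j _ => ?_
    rw [cast_absDiff]
    exact congr_arg _ (cast_hdist_sub_hdist hv hu fun m => ω (j * q + m))
  -- Equal points have equal sketches and are always good; the tail bounds divide by the distance
  -- and need it positive.
  rcases Nat.eq_zero_or_pos (hdist q (X v) (X u)) with h0 | hpos
  · have ha0 : ∀ m, a m = 0 := fun m => by
      have h := hda
      rw [h0, Nat.cast_zero, Finset.sum_eq_zero_iff_of_nonneg fun _ _ => sq_nonneg _] at h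
      exact pow_eq_zero_iff (by norm_num) |>.1 (h m (Finset.mem_univ m))
    have : {ω | ¬ SketchGood q D (coinRows q ω) X v u} = ∅ := by
      ext ω
      simp [SketchGood, hS, h0, signedSum, ha0]
    rw [this]; simp
  · have hd : (0 : ℝ) < hdist q (X v) (X u) := by exact_mod_cast hpos
    have hcard := card_bad_le a hd hda D
    set S := Finset.univ.filter fun T : Fin D → Fin q → Bool =>
      ¬ (D / 10 * √(hdist q (X v) (X u) : ℝ) ≤ ∑ j, |signedSum a (T j)| ∧
        ∑ j, |signedSum a (T j)| ≤ 2 * D * √(hdist q (X v) (X u) : ℝ)) with hSdef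
    have hset : {ω | ¬ SketchGood q D (coinRows q ω) X v u} =
        {ω | (fun (j : Fin D) (m : Fin q) => ω (j * q + m)) ∈ S} := by
      ext ω
      simp only [Set.mem_ofPred_eq, hSdef, Finset.mem_filter, Finset.mem_univ, true_and, SketchGood,
        hS]
    rw [hset]
    refine (coinMeasure_rows_le D q S).trans ?_
    rw [ENNReal.le_ofReal_iff_toReal_le (by finiteness) (by positivity)]
    rw [ENNReal.toReal_mul, ENNReal.toReal_pow]
    simp only [ENNReal.toReal_natCast, one_div, ENNReal.toReal_inv, ENNReal.toReal_ofNat, inv_pow]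
    rw [← div_eq_mul_inv, div_le_iff₀ (by positivity), mul_comm]
    exact hcard

/-! ### The clustering radius -/

/-- The points as number-valued functions, `0` outside their range. -/
def natPoints {n d : ℕ} (P : Fin n → Fin d → Bool) (v x : ℕ) : ℕ :=
  if h : v < n ∧ x < d then (P ⟨v, h.1⟩ ⟨x, h.2⟩).toNat else 0

theorem natPoints_le_one {n d : ℕ} (P : Fin n → Fin d → Bool) (v x : ℕ) : natPoints P v x ≤ 1 := by
  unfold natPoints; split_ifs
  exacts [Bool.toNat_le _, Nat.zero_le _]

theorem natPoints_fin {n d : ℕ} (P : Fin n → Fin d → Bool) (v : Fin n) (x : Fin d) :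
    natPoints P v x = (P v x).toNat := by
  simp [natPoints]

theorem hdist_eq_card {q : ℕ} {x y : ℕ → ℕ} (hx : ∀ m, x m ≤ 1) (hy : ∀ m, y m ≤ 1) :
    hdist q x y = ∑ m ∈ Finset.range q, if x m ≠ y m then 1 else 0 := by
  refine Finset.sum_congr rfl fun m _ => ?_
  have := hx m
  have := hy m
  unfold absDiff
  split_ifs <;> omega

theorem hdist_natPoints {n q : ℕ} (P : Fin n → Fin q → Bool) (v u : Fin n) :
    hdist q (natPoints P v) (natPoints P u) = hammingDist (P v) (P u) := by
  rw [hdist_eq_card (natPoints_le_one P _) (natPoints_le_one P _), hammingDist,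
    Finset.card_filter,
    ← Fin.sum_univ_eq_sum_range (fun m => if natPoints P v m ≠ natPoints P u m then 1 else 0)]
  refine Finset.sum_congr rfl fun m _ => ?_
  rw [natPoints_fin, natPoints_fin]
  cases P v m <;> cases P u m <;> simp

theorem exists_centers {n d : ℕ} (P : Fin n → Fin d → Bool) {k : ℕ} (hk : 0 < k) :
    ∃ (T : Fin k → Fin d → Bool) (t : Fin n → Fin k),
      ∀ i, hammingDist (P i) (T (t i)) ≤ centerRadius P k := by
  -- An infimum over no centers would be 0 by convention; with a center available it is attained.
  have : Nonempty (Fin k) := ⟨⟨0, hk⟩⟩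
  obtain ⟨T, hT⟩ := ciInf_mem fun T : Fin k → Fin d → Bool =>
    Finset.univ.sup fun i => ⨅ t, hammingDist (P i) (T t)
  have h : ∀ i, ∃ t, hammingDist (P i) (T t) ≤ centerRadius P k := fun i => by
    obtain ⟨t, ht⟩ := ciInf_mem fun t => hammingDist (P i) (T t)
    refine ⟨t, ?_⟩
    have h1 : (⨅ t, hammingDist (P i) (T t)) ≤ _ :=
      Finset.le_sup (f := fun i => ⨅ t, hammingDist (P i) (T t)) (Finset.mem_univ i)
    exact ht.trans_le (h1.trans hT.le)
  choose t ht using h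
  exact ⟨T, t, ht⟩

/-- Among more than `k` points two are at distance at most twice the radius. -/
theorem exists_close_points {n d : ℕ} (P : Fin n → Fin d → Bool) {k : ℕ} (hk : 0 < k)
    (g : Fin (k + 1) → Fin n) :
    ∃ s s', s < s' ∧ hammingDist (P (g s')) (P (g s)) ≤ 2 * centerRadius P k := by
  obtain ⟨T, t, ht⟩ := exists_centers P hk
  obtain ⟨s, s', hne, heq⟩ := Fintype.exists_ne_map_eq_of_card_lt (fun s => t (g s)) (by simp)
  have key : ∀ s s', t (g s) = t (g s') →
      hammingDist (P (g s')) (P (g s)) ≤ 2 * centerRadius P k := fun s s' h => by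
    have h1 := hammingDist_triangle (P (g s')) (T (t (g s'))) (P (g s))
    have h2 := ht (g s')
    have h3 := ht (g s)
    rw [hammingDist_comm, h] at h3
    omega
  rcases lt_or_gt_of_ne hne with h | h
  exacts [⟨s, s', h, key s s' heq⟩, ⟨s', s, h, key s' s heq.symm⟩]

/-- Let d be the distance of the point to its center and L the radius. Two of the `l + 1` separated
points are within 2L, so D/10·√d ≤ 2D·√(2L). Squaring √d ≤ 20·√(2L) gives the factor 800. -/
theorem Clustered.list_length_le {n q D o l : ℕ} {m w : ℕ → ℕ → ℕ} {P : Fin n → Fin q → Bool}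
    (h : Clustered m o n l q (natPoints P) (sketchDist q D w (natPoints P))) (hl : 0 < l)
    (hD : 0 < D) (hgood : ∀ v < n, ∀ u < n, SketchGood q D w (natPoints P) v u) {v : ℕ}
    (hv : v < n) : m (o + 5) v ≤ 800 * centerRadius P l := by
  set c := m (o + 4) (m (o + 3) v) with hc
  have hcn : c < n := h.ctr_lt _ (h.asg_lt v hv)
  have hlen : m (o + 5) v = hdist q (natPoints P v) (natPoints P c) := by
    have := h.diff v hv fun _ => 1
    rw [hdist_eq_card (natPoints_le_one P _) (natPoints_le_one P _), ← this]
    simp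
  obtain ⟨g, hg, hsep⟩ := h.sep v hv
  obtain ⟨s, s', hss, hclose⟩ := exists_close_points P hl
    fun s : Fin (l + 1) => ⟨g s, hg s (Nat.lt_succ_iff.1 s.2)⟩
  have hgs := hg s (Nat.lt_succ_iff.1 s.2)
  have hgs' := hg s' (Nat.lt_succ_iff.1 s'.2)
  have h1 := (hgood v hv c hcn).1
  have h2 : (sketchDist q D w (natPoints P) v c : ℝ) ≤
      sketchDist q D w (natPoints P) (g s') (g s) :=
    Nat.cast_le.2 (hsep s s' hss (Nat.lt_succ_iff.1 s'.2))
  have h3 := (hgood _ hgs' _ hgs).2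
  rw [show hdist q (natPoints P (g s')) (natPoints P (g s)) = _ from
    hdist_natPoints P ⟨g s', hgs'⟩ ⟨g s, hgs⟩] at h3
  rw [← hlen] at h1
  have hDr : (0 : ℝ) < D := by exact_mod_cast hD
  set L := centerRadius P l with hL
  have h4 : √(hammingDist (P ⟨g s', hgs'⟩) (P ⟨g s, hgs⟩) : ℝ) ≤ √(2 * L) :=
    Real.sqrt_le_sqrt (by exact_mod_cast hclose)
  have h5 : √(m (o + 5) v : ℝ) ≤ 20 * √(2 * L) := by
    have h6 : (D : ℝ) * √(m (o + 5) v : ℝ) ≤ D * (20 * √(2 * L)) := by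
      have := mul_le_mul_of_nonneg_left h4 hDr.le
      linarith
    exact le_of_mul_le_mul_left h6 hDr
  have h6 : ((m (o + 5) v : ℕ) : ℝ) ≤ (800 * L : ℕ) := by
    have h7 := pow_le_pow_left₀ (Real.sqrt_nonneg _) h5 2
    rw [Real.sq_sqrt (Nat.cast_nonneg _), mul_pow, Real.sq_sqrt (by positivity)] at h7
    push_cast
    linarith
  exact_mod_cast h6

/-! ### Time and word length -/

/-- All factors but `q` are at least 1, so every lower-order term is absorbed by one of the four
products; the terms `l * k`, `p + r` and the constants go into `p * r`. -/
theorem prepTime_le {p q r l k D : ℕ} (hl : 1 ≤ l) (hlp : l ≤ p) (hk : 1 ≤ k) (hkr : k ≤ r)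
    (hD : 1 ≤ D) : prepTime p q r l k D ≤
      10000 * (p * D * (q + l) + r * D * (q + k) + l * q * k + p * r) := by
  have hp : 1 ≤ p := hl.trans hlp
  have hr : 1 ≤ r := hk.trans hkr
  have cl : ∀ n l : ℕ, 1 ≤ n → 1 ≤ l → clusterTime n l q D ≤ 4000 * (n * D * (q + l)) := by
    intro n l hn hl
    have h1 : n * q ≤ n * D * q := Nat.mul_le_mul_right q (Nat.le_mul_of_pos_right n hD)
    have h2 : n * D ≤ n * D * l := Nat.le_mul_of_pos_right _ hl
    have h3 : n ≤ n * D := Nat.le_mul_of_pos_right n hD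
    have h4 : n * l ≤ n * D * l := Nat.mul_le_mul_right l h3
    have h5 : l ≤ n * l := Nat.le_mul_of_pos_left l hn
    unfold clusterTime
    nlinarith
  have c1 := cl p l hp hl
  have c2 := cl r k hr hk
  have h1 : p * q ≤ p * D * q := Nat.mul_le_mul_right q (Nat.le_mul_of_pos_right p hD)
  have h2 : r * q ≤ r * D * q := Nat.mul_le_mul_right q (Nat.le_mul_of_pos_right r hD)
  have h3 : D * q ≤ p * D * q := Nat.mul_le_mul_right q (Nat.le_mul_of_pos_left D hp)
  have h4 : l * k ≤ p * r := Nat.mul_le_mul hlp hkr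
  have h5 : p ≤ p * r := Nat.le_mul_of_pos_right p hr
  have h6 : r ≤ p * r := Nat.le_mul_of_pos_left r hp
  have h9 : 1 ≤ p * r := Nat.mul_pos hp hr
  have h7 : 0 ≤ p * D * l := Nat.zero_le _
  have h8 : 0 ≤ r * D * k := Nat.zero_le _
  have h10 : 0 ≤ p * D * q := Nat.zero_le _
  have h11 : 0 ≤ r * D * q := Nat.zero_le _
  have h12 : 0 ≤ l * q * k := Nat.zero_le _
  unfold prepTime
  linarith

/-- The ceiling costs at most one unit, which log n / log 2 ≥ 1 covers, and 2 / log 2 < 3. -/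
theorem clog_le_log {n : ℕ} (hn : 2 ≤ n) : (Nat.clog 2 n : ℝ) ≤ 3 * Real.log n := by
  have h1 : 2 ^ (Nat.clog 2 n).pred < n := Nat.pow_pred_clog_lt_self (by norm_num) (by omega)
  have h2 : (Nat.clog 2 n) ≤ (Nat.clog 2 n).pred + 1 := by
    rw [Nat.pred_eq_sub_one]; omega
  have h3 : ((Nat.clog 2 n).pred : ℝ) * Real.log 2 ≤ Real.log n := by
    rw [← Real.log_pow]
    exact Real.log_le_log (by positivity) (by exact_mod_cast h1.le)
  have h4 : Real.log 2 ≤ Real.log n := Real.log_le_log (by norm_num) (by exact_mod_cast hn)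
  have h5 : (Nat.clog 2 n : ℝ) ≤ (Nat.clog 2 n).pred + 1 := by exact_mod_cast h2
  have h6 := Real.log_two_gt_d9
  have h7 : (0 : ℝ) ≤ (Nat.clog 2 n).pred := Nat.cast_nonneg _
  nlinarith

/-- If p ≥ 2 and r ≤ p², then log(p + r) ≤ 3 log p. Otherwise p² ≤ r, and log(p + r) ≤ 2 log r if r
≥ 2. Then the part with q is absorbed by r·log r·q, while l ≤ p ≤ √r and log r ≤ 2√r give l·log r ≤
2r, so that the part with l is absorbed by pr. In the remaining case p = r = 1. -/
theorem log_add_mul_le {p q r l k : ℕ} (hl : 1 ≤ l) (hlp : l ≤ p) (hk : 1 ≤ k) (hkr : k ≤ r) :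
    (p : ℝ) * Real.log (p + r) * (q + l) ≤
      4 * (p * Real.log p * (q + l) + r * Real.log r * (q + k) + l * q * k + p * r) := by
  have hp : 1 ≤ p := hl.trans hlp
  have hr : 1 ≤ r := hk.trans hkr
  have hpR : (1 : ℝ) ≤ p := by exact_mod_cast hp
  have hrR : (1 : ℝ) ≤ r := by exact_mod_cast hr
  have hlR : (1 : ℝ) ≤ l := by exact_mod_cast hl
  have hkR : (1 : ℝ) ≤ k := by exact_mod_cast hk
  have hlpR : (l : ℝ) ≤ p := by exact_mod_cast hlp
  have hq : (0 : ℝ) ≤ q := Nat.cast_nonneg _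
  have lp : 0 ≤ Real.log p := Real.log_nonneg hpR
  have lr : 0 ≤ Real.log r := Real.log_nonneg hrR
  have t1 : 0 ≤ p * Real.log p * ((q : ℝ) + l) := by positivity
  have t2 : 0 ≤ r * Real.log r * ((q : ℝ) + k) := by positivity
  have t3 : 0 ≤ (l : ℝ) * q * k := by positivity
  have t4 : 0 ≤ (p : ℝ) * r := by positivity
  by_cases hA : 2 ≤ p ∧ r ≤ p ^ 2
  · have h2 : (2 : ℝ) ≤ p := by exact_mod_cast hA.1
    have h3 : (r : ℝ) ≤ p ^ 2 := by exact_mod_cast hA.2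
    have h4 : Real.log (p + r) ≤ 3 * Real.log p := by
      rw [show 3 * Real.log (p : ℝ) = Real.log ((p : ℝ) ^ 3) by rw [Real.log_pow]; norm_num]
      refine Real.log_le_log (by linarith) ?_
      nlinarith [mul_nonneg (show (0 : ℝ) ≤ p - 2 by linarith) (sq_nonneg (p : ℝ))]
    have h5 : p * Real.log (p + r) * ((q : ℝ) + l) ≤ p * (3 * Real.log p) * (q + l) := by gcongr
    linarith
  · have hB : p ^ 2 ≤ r := by
      by_cases h : 2 ≤ p
      · by_contra hcon; exact hA ⟨h, by omega⟩
      · obtain rfl : p = 1 := by omega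
        simpa using hr
    by_cases h2 : 2 ≤ r
    · have h2R : (2 : ℝ) ≤ r := by exact_mod_cast h2
      have hBR : (p : ℝ) ^ 2 ≤ r := by exact_mod_cast hB
      have hprR : (p : ℝ) ≤ r := by nlinarith
      have h4 : Real.log (p + r) ≤ 2 * Real.log r := by
        rw [show 2 * Real.log (r : ℝ) = Real.log ((r : ℝ) ^ 2) by rw [Real.log_pow]; norm_num]
        exact Real.log_le_log (by linarith) (by nlinarith)
      have hs : (p : ℝ) ≤ √r := Real.le_sqrt_of_sq_le hBR
      have hs2 : √(r : ℝ) ^ 2 = r := Real.sq_sqrt (by linarith)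
      have h5 : Real.log r ≤ 2 * √r := by
        have h6 := Real.log_le_sub_one_of_pos (show 0 < √(r : ℝ) by linarith)
        rw [Real.log_sqrt (by linarith)] at h6
        linarith
      have h6 : l * Real.log r ≤ 2 * r := by
        calc l * Real.log r ≤ √r * (2 * √r) := by gcongr; linarith
          _ = 2 * √r ^ 2 := by ring
          _ = 2 * r := by rw [hs2]
      have h7 : p * Real.log (p + r) * ((q : ℝ) + l) ≤ p * (2 * Real.log r) * (q + l) := by gcongr
      have h8 : p * (Real.log r * q) ≤ r * (Real.log r * q) := by gcongr
      have h9 : p * (l * Real.log r) ≤ p * (2 * r) := by gcongr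
      have h10 : 0 ≤ r * Real.log r * (k : ℝ) := by positivity
      nlinarith
    · obtain rfl : r = 1 := by omega
      obtain rfl : p = 1 := by nlinarith
      obtain rfl : l = 1 := by omega
      obtain rfl : k = 1 := by omega
      have := Real.log_two_lt_d9
      norm_num
      nlinarith

/-- Each clustering term is at most 3·4·K times the target expression, the other two terms together
at most K times it; 10000·(12 + 12 + 1) = 250000. -/
theorem prepTime_le_log {p q r l k K : ℕ} (hl : 1 ≤ l) (hlp : l ≤ p) (hk : 1 ≤ k) (hkr : k ≤ r)
    (hK : 1 ≤ K) : (prepTime p q r l k (K * Nat.clog 2 (p + r)) : ℝ) ≤ 250000 * K *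
      (p * Real.log p * (q + l) + r * Real.log r * (q + k) + l * q * k + p * r) := by
  have hn : 2 ≤ p + r := by omega
  have hL : 1 ≤ Nat.clog 2 (p + r) := Nat.clog_pos (by norm_num) hn
  have h1 := prepTime_le (q := q) hl hlp hk hkr (D := K * Nat.clog 2 (p + r)) (Nat.mul_pos hK hL)
  have h1R : (prepTime p q r l k (K * Nat.clog 2 (p + r)) : ℝ) ≤ _ := Nat.cast_le.2 h1
  have h2 := clog_le_log hn
  set L := Nat.clog 2 (p + r)
  have h3 := log_add_mul_le (q := q) hl hlp hk hkr
  have h4 := log_add_mul_le (q := q) hk hkr hl hlp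
  rw [add_comm (r : ℝ) p] at h4
  push_cast at h1R h2
  have hKR : (1 : ℝ) ≤ K := by exact_mod_cast hK
  set G := Real.log ((p : ℝ) + r)
  have e1 : (p : ℝ) * (K * L) * (q + l) ≤ 3 * K * (p * G * (q + l)) := by
    have : (p : ℝ) * (K * L) * (q + l) ≤ p * (K * (3 * G)) * (q + l) := by gcongr
    linarith
  have e2 : (r : ℝ) * (K * L) * (q + k) ≤ 3 * K * (r * G * (q + k)) := by
    have : (r : ℝ) * (K * L) * (q + k) ≤ r * (K * (3 * G)) * (q + k) := by gcongr
    linarith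
  set E := (p : ℝ) * Real.log p * (q + l) + r * Real.log r * (q + k) + l * q * k + p * r
  have h4' : (r : ℝ) * G * (q + k) ≤ 4 * E := by
    refine h4.trans (le_of_eq ?_)
    simp only [E]; ring
  have e3 : 3 * K * (p * G * ((q : ℝ) + l)) ≤ 3 * K * (4 * E) := by gcongr
  have e4 : 3 * K * (r * G * ((q : ℝ) + k)) ≤ 3 * K * (4 * E) := by gcongr
  have t1 : 0 ≤ p * Real.log p * ((q : ℝ) + l) :=
    mul_nonneg (mul_nonneg (Nat.cast_nonneg _) (Real.log_natCast_nonneg _)) (by positivity)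
  have t2 : 0 ≤ r * Real.log r * ((q : ℝ) + k) :=
    mul_nonneg (mul_nonneg (Nat.cast_nonneg _) (Real.log_natCast_nonneg _)) (by positivity)
  have e5 : (l : ℝ) * q * k + p * r ≤ E := by simp only [E]; linarith
  have hE : 0 ≤ E := by
    refine le_trans ?_ e5
    positivity
  have e6 : E ≤ K * E := le_mul_of_one_le_left hE hKR
  linarith

/-- The word length suffices for the preprocessing. -/
theorem fits_pow {N K : ℕ} (hN : 2 ≤ N) : Fits (N ^ (K + 10)) (N ^ (31 * (K + 10) + 1)) := by
  refine ⟨?_, ?_⟩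
  · calc 32 ≤ 2 ^ (K + 10) := by
          rw [pow_add]; have : 1 ≤ 2 ^ K := Nat.one_le_two_pow
          omega
      _ ≤ N ^ (K + 10) := Nat.pow_le_pow_left hN _
  · rw [← pow_mul, mul_comm (K + 10)]
    exact Nat.pow_lt_pow_right (by omega) (by omega)

/-! ### The failure probability -/

theorem exists_sketch_factor (α : ℝ) : ∃ K : ℕ, 1 ≤ K ∧ (97 / 100 : ℝ) ^ K ≤ 2 ^ (-(α + 3)) := by
  obtain ⟨K, hK⟩ := exists_pow_lt_of_lt_one (show (0 : ℝ) < 2 ^ (-(α + 3)) by positivity)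
    (show (97 / 100 : ℝ) < 1 by norm_num)
  refine ⟨K + 1, by omega, le_trans ?_ hK.le⟩
  rw [pow_succ]
  have : (0 : ℝ) < (97 / 100) ^ K := by positivity
  linarith

/-- Since n ≤ 2^⌈log₂ n⌉, each pair fails with probability at most 2n^(-α-3). Summing over n² pairs
leaves (2/n)·n^(-α), and n ≥ 2. -/
theorem union_bound_le {α : ℝ} (hα : 0 ≤ α) {K n : ℕ} (hn : 2 ≤ n)
    (hK : (97 / 100 : ℝ) ^ K ≤ 2 ^ (-(α + 3))) :
    (n : ℝ) ^ 2 * (2 * (97 / 100) ^ (K * Nat.clog 2 n)) ≤ 1 / (n : ℝ) ^ α := by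
  set L := Nat.clog 2 n
  have hn0 : (0 : ℝ) < n := by positivity
  have h1 : (n : ℝ) ≤ 2 ^ L := by exact_mod_cast Nat.le_pow_clog (b := 2) (by norm_num) n
  have h2 : (97 / 100 : ℝ) ^ (K * L) ≤ (n : ℝ) ^ (-(α + 3)) := by
    rw [pow_mul]
    calc ((97 / 100 : ℝ) ^ K) ^ L ≤ ((2 : ℝ) ^ (-(α + 3))) ^ L :=
          pow_le_pow_left₀ (by positivity) hK L
      _ = ((2 : ℝ) ^ L) ^ (-(α + 3)) := by
          rw [← Real.rpow_natCast, ← Real.rpow_natCast, ← Real.rpow_mul (by norm_num),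
            ← Real.rpow_mul (by norm_num), mul_comm]
      _ ≤ (n : ℝ) ^ (-(α + 3)) := Real.rpow_le_rpow_of_nonpos hn0 h1 (by linarith)
  have h3 : (n : ℝ) ^ (-(α + 3)) = 1 / (n : ℝ) ^ α / (n : ℝ) ^ 3 := by
    rw [Real.rpow_neg hn0.le, Real.rpow_add hn0, mul_inv, one_div, div_eq_mul_inv]
    norm_num
  rw [h3] at h2
  have h4 : (0 : ℝ) < 1 / (n : ℝ) ^ α := by positivity
  have hnR : (2 : ℝ) ≤ n := by exact_mod_cast hn
  calc (n : ℝ) ^ 2 * (2 * (97 / 100) ^ (K * L))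
      ≤ (n : ℝ) ^ 2 * (2 * (1 / (n : ℝ) ^ α / (n : ℝ) ^ 3)) := by gcongr
    _ = 1 / (n : ℝ) ^ α * (2 / n) := by field_simp
    _ ≤ 1 / (n : ℝ) ^ α * 1 := by
        gcongr
        rw [div_le_one hn0]; exact hnR
    _ = _ := mul_one _

open MeasureTheory in
theorem coinMeasure_exists_not_sketchGood_le (q D n : ℕ) (P : Fin n → Fin q → Bool) :
    coinMeasure {ω | ∃ v < n, ∃ u < n, ¬ SketchGood q D (coinRows q ω) (natPoints P) v u} ≤
      ENNReal.ofReal ((n : ℝ) ^ 2 * (2 * (97 / 100) ^ D)) := by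
  have hsub : {ω | ∃ v < n, ∃ u < n, ¬ SketchGood q D (coinRows q ω) (natPoints P) v u} ⊆
      ⋃ x ∈ Finset.range n ×ˢ Finset.range n,
        {ω | ¬ SketchGood q D (coinRows q ω) (natPoints P) x.1 x.2} := by
    rintro ω ⟨v, hv, u, hu, h⟩
    simp only [Set.mem_iUnion]
    exact ⟨(v, u), by simp [hv, hu], h⟩
  refine (measure_mono hsub).trans ((measure_biUnion_finset_le _ _).trans ?_)
  refine (Finset.sum_le_card_nsmul _ _ _ fun x _ => coinMeasure_not_sketchGood_le
    (fun _ _ => natPoints_le_one P _ _) fun _ _ => natPoints_le_one P _ _).trans ?_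
  rw [nsmul_eq_mul, ENNReal.ofReal_mul (show (0 : ℝ) ≤ (n : ℝ) ^ 2 by positivity)]
  refine le_of_eq (congr_arg₂ _ ?_ rfl)
  rw [Finset.card_product, Finset.card_range, ← sq, ENNReal.ofReal_pow (Nat.cast_nonneg _),
    ENNReal.ofReal_natCast, Nat.cast_pow]

/-! ### Initial states and assembly -/

/-- The view of a machine state with memory `m` in which temporaries count as `0`. -/
def State.view (s : State) (m : ℕ → ℕ → ℕ) : St where
  v x := if x < 40 then s.reg x else 0
  m := m
  coins := s.coins

theorem State.rep_view {s : State} {m : ℕ → ℕ → ℕ} (h : ∀ x, s.mem x = m (x % 32) (x / 32)) :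
    Rep (s.view m) s :=
  ⟨fun x hx => by simp [State.view, hx], h, rfl⟩

theorem State.bounded_view {B : ℕ} {s : State} {m : ℕ → ℕ → ℕ} (h : ∀ x < 40, s.reg x ≤ B)
    (hm : ∀ a i, m a i ≤ B) : (s.view m).Bounded B :=
  ⟨fun x => by simp only [State.view]; split_ifs with hx; exacts [h x hx, Nat.zero_le _], hm⟩

section Input

variable {p q r : ℕ} (A : Matrix (Fin p) (Fin q) Bool) (B : Matrix (Fin q) (Fin r) Bool)

theorem inputMem_le_one (x : ℕ) : inputMem A B x ≤ 1 := by
  unfold inputMem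
  split_ifs <;> first | exact Bool.toNat_le _ | exact Nat.zero_le _

theorem inputMem_left {i x : ℕ} (hi : i < p) (hx : x < q) :
    inputMem A B (i * q + x) = natPoints (fun i m => A i m) i x := by
  have h1 : (i * q + x) / q = i := by
    rw [mul_comm, Nat.mul_add_div (by omega), Nat.div_eq_of_lt hx, add_zero]
  have h2 : (i * q + x) % q = x := by
    rw [mul_comm, Nat.mul_add_mod, Nat.mod_eq_of_lt hx]
  have h3 : i * q + x < p * q := by
    have := Nat.mul_le_mul_right q (Nat.succ_le_of_lt hi)
    rw [Nat.succ_mul] at this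
    omega
  simp [inputMem, natPoints, h1, h2, h3, hi, hx]

theorem inputMem_right {j x : ℕ} (hj : j < r) (hx : x < q) :
    inputMem A B (p * q + (x * r + j)) = natPoints (fun j m => B m j) j x := by
  have h1 : (x * r + j) / r = x := by
    rw [mul_comm, Nat.mul_add_div (by omega), Nat.div_eq_of_lt hj, add_zero]
  have h2 : (x * r + j) % r = j := by
    rw [mul_comm, Nat.mul_add_mod, Nat.mod_eq_of_lt hj]
  simp [inputMem, natPoints, h1, h2, hj, hx]

theorem arithProduct_eq_sum (i : Fin p) (j : Fin r) :
    arithProduct A B i j = ∑ x ∈ Finset.range q,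
      natPoints (fun i m => A i m) i x * natPoints (fun j m => B m j) j x := by
  rw [← Fin.sum_univ_eq_sum_range fun x =>
    natPoints (fun i m => A i m) i x * natPoints (fun j m => B m j) j x]
  simp [arithProduct, Matrix.mul_apply, natPoints]

end Input

/-- For every outcome of the coins, the preprocessing halts in time, all queries are answered, and
their times are bounded if the sketch distances are good. -/
theorem exists_exec {p q r l k K : ℕ} (hl : 1 ≤ l) (hlp : l ≤ p) (hk : 1 ≤ k) (hkr : k ≤ r)
    (hK : 1 ≤ K) (A : Matrix (Fin p) (Fin q) Bool) (B : Matrix (Fin q) (Fin r) Bool)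
    (ω : ℕ → Bool) :
    ∃ (S : State) (T : ℕ) (Tq : Fin p → Fin r → ℕ),
      (Exec ((p + q + r) ^ (31 * (K + 10) + 1)) ω (prep K).comp (inputState A B l k) S T ∧
        T ≤ prepTime p q r l k (K * Nat.clog 2 (p + r))) ∧
      (∀ (i : Fin p) (j : Fin r), ∃ s',
        Exec ((p + q + r) ^ (31 * (K + 10) + 1)) ω query.comp (S.query i j) s' (Tq i j) ∧
        s'.reg 0 = arithProduct A B i j ∧ s'.mem = S.mem) ∧
      ((∀ v < p, ∀ u < p, SketchGood q (K * Nat.clog 2 (p + r)) (coinRows q ω)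
          (natPoints fun i m => A i m) v u) →
        (∀ v < r, ∀ u < r, SketchGood q (K * Nat.clog 2 (p + r)) (coinRows q ω)
          (natPoints fun j m => B m j) v u) →
        ∀ i j, Tq i j ≤ 176000 * (rowRadius A l + colRadius B k + 1)) := by
  have hn : 2 ≤ p + r := by omega
  set N := p + q + r with hN
  set Bd := N ^ (K + 10) with hBd
  set D := K * Nat.clog 2 (p + r) with hD
  have hN2 : 2 ≤ N := by omega
  have hB : Fits Bd (N ^ (31 * (K + 10) + 1)) := fits_pow hN2
  have hpow : ∀ m ≤ K + 10, N ^ m ≤ Bd := fun m hm => Nat.pow_le_pow_right (by omega) hm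
  have hNB : N ≤ Bd := by simpa using hpow 1 (by omega)
  have hNN : N * N ≤ Bd := by simpa [sq] using hpow 2 (by omega)
  -- The summand `K` in the exponent of `Bd` pays for the constant factor `K`, even for the smallest
  -- inputs.
  have hKN : K ≤ N ^ K := (Nat.lt_pow_self (by omega)).le
  have hKpow : ∀ m ≤ 10, K * N ^ m ≤ Bd := fun m hm => by
    refine le_trans ?_ (hpow (K + m) (by omega))
    rw [pow_add]
    exact Nat.mul_le_mul_right _ hKN
  have hclog : Nat.clog 2 (p + r) ≤ N :=
    (Nat.clog_le_of_le_pow Nat.lt_two_pow_self.le).trans (by omega)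
  have hclog0 : 1 ≤ Nat.clog 2 (p + r) := Nat.clog_pos (by norm_num) hn
  have hD0 : 0 < D := Nat.mul_pos hK hclog0
  have hDq : D * q + 1 ≤ Bd := by
    refine le_trans ?_ (hKpow 3 (by norm_num))
    have h1 : D * q ≤ K * (N * N) := by
      rw [hD, mul_assoc]
      exact Nat.mul_le_mul_left _ (Nat.mul_le_mul hclog (by omega))
    have h2 : 1 ≤ K * (N * N) := Nat.mul_pos hK (Nat.mul_pos (by omega) (by omega))
    calc D * q + 1 ≤ K * (N * N) * 2 := by omega
      _ ≤ K * (N * N) * N := Nat.mul_le_mul_left _ hN2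
      _ = K * N ^ 3 := by ring
  have hpq : p * q + q * r ≤ Bd := by
    refine le_trans ?_ hNN
    calc p * q + q * r = (p + r) * q := by ring
      _ ≤ N * N := Nat.mul_le_mul (by omega) (by omega)
  set X := natPoints fun i m => A i m
  set Y := natPoints fun j m => B m j
  set σ0 := (inputState A B l k).view fun a i => inputMem A B (32 * i + a) with hσ0
  have hrep0 : Rep σ0 (inputState A B l k) := State.rep_view fun x => by
    rw [Nat.div_add_mod]; rfl
  have hb0 : σ0.Bounded Bd := by
    refine State.bounded_view (fun x _ => ?_) fun a i => (inputMem_le_one A B _).trans (by omega)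
    simp only [inputState]
    split <;> omega
  obtain ⟨S, T, σ, e, hT, rep, bd, -, prepd⟩ := run_prep (ω := ω) (σ := σ0) (p := p) (q := q)
    (r := r) (l := l) (k := k) (K := K) (D := D) (inp := inputMem A B) (X := X) (Y := Y)
    (w := coinRows q ω) hB rfl rfl rfl rfl rfl rfl
    hl hlp hk hkr
    (fun x _ => by
      change inputMem A B (32 * (x / 32) + x % 32) = _
      rw [Nat.div_add_mod])
    (fun i hi x hx => inputMem_left A B hi hx) (fun j hj x hx => inputMem_right A B hj hx)
    (fun _ _ _ _ => natPoints_le_one _ _ _) (fun _ _ _ _ => natPoints_le_one _ _ _)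
    (fun _ _ => rfl) rfl hpq
    ((Nat.mul_le_mul hN2 (show p + r ≤ N by omega)).trans hNN)
    (by simpa using hKpow 0 (by norm_num))
    ((Nat.mul_le_mul_left K (show p + r ≤ N ^ 1 by rw [pow_one]; omega)).trans (hKpow 1 (by norm_num)))
    hDq (by omega) hb0 _ hrep0
  have hq : ∀ (i : Fin p) (j : Fin r), ∃ s' t, Exec (N ^ (31 * (K + 10) + 1)) ω query.comp
      (S.query i j) s' t ∧ s'.reg 0 = arithProduct A B i j ∧ s'.mem = S.mem ∧
      t ≤ σ.m 5 i * 220 + σ.m 13 j * 220 + 1340 := by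
    intro i j
    have hi := i.2
    have hj := j.2
    obtain ⟨s', t, σ', e', ht, rep', -, F, hv⟩ := run_query (ω := ω) (σ := (S.query i j).view σ.m)
      hB prepd i.2 j.2 rfl rfl (fun _ _ _ _ => natPoints_le_one _ _ _)
      (fun _ _ _ _ => natPoints_le_one _ _ _)
      (State.bounded_view (fun x _ => by simp only [State.query]; split <;> omega) bd.2)
      (S.query i j) (State.rep_view rep.2.1)
    refine ⟨s', t, e', ?_, ?_, ht⟩
    · rw [rep'.1 0 (by norm_num), hv, arithProduct_eq_sum]
    · funext x
      rw [rep'.2.1, F.m_eq keepsArr_query, rep.2.1]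
      rfl
  choose s' Tq h1 h2 h3 h4 using hq
  -- Here 176000 = 220·800, which also exceeds the constant part 1340 of the query time.
  refine ⟨S, T, Tq, ⟨e, hT⟩, fun i j => ⟨s' i j, h1 i j, h2 i j, h3 i j⟩, fun gX gY i j => ?_⟩
  have c1 : σ.m 5 i ≤ 800 * rowRadius A l :=
    prepd.rows.list_length_le hl hD0 gX i.2
  have c2 : σ.m 13 j ≤ 800 * colRadius B k :=
    prepd.cols.list_length_le hk hD0 gY j.2
  have := h4 i j
  omega

end WordRAM

open WordRAM MeasureTheory in
theorem theorem4 (α : ℝ) (hα : 1 ≤ α) :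
    ∃ (pre qry : WordRAM.Prog) (e : ℕ) (c : ℝ), qry.CoinFree ∧
      ∀ (p q r l k : ℕ), 1 ≤ l → l ≤ p → 1 ≤ k → k ≤ r →
      ∀ (A : Matrix (Fin p) (Fin q) Bool) (B : Matrix (Fin q) (Fin r) Bool),
      ∃ (S : (ℕ → Bool) → WordRAM.State) (T : (ℕ → Bool) → ℕ)
        (Tq : (ℕ → Bool) → Fin p → Fin r → ℕ),
        -- preprocessing: always halts within the time bound
        (∀ ω, WordRAM.Exec ((p + q + r) ^ e) ω pre (WordRAM.inputState A B l k) (S ω) (T ω) ∧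
          (T ω : ℝ) ≤ c * (p * Real.log p * (q + l) + r * Real.log r * (q + k)
            + l * q * k + p * r)) ∧
        -- queries: always answered exactly, without changing the preprocessed memory
        (∀ ω (i : Fin p) (j : Fin r), ∃ s' : WordRAM.State,
          WordRAM.Exec ((p + q + r) ^ e) ω qry ((S ω).query i j) s' (Tq ω i j) ∧
          s'.reg 0 = arithProduct A B i j ∧ s'.mem = (S ω).mem) ∧
        -- query time: with high probability, for all queries at once
        WordRAM.coinMeasure
            {ω | ∃ (i : Fin p) (j : Fin r), c * ((rowRadius A l : ℝ) + (colRadius B k : ℝ) + 1) < (Tq ω i j : ℝ)}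
          ≤ ENNReal.ofReal (1 / ((p : ℝ) + (r : ℝ)) ^ α) := by
  obtain ⟨K, hK1, hK⟩ := exists_sketch_factor α
  -- One constant serves both time bounds, since `K ≥ 1` makes it exceed 176000. The exponent makes
  -- the word size exceed the 31st power of the bound `N ^ (K + 10)` on stored values.
  refine ⟨(prep K).comp, query.comp, 31 * (K + 10) + 1, 250000 * K,
    Cmd.coinFree_comp _ noFlip_query, fun p q r l k hl hlp hk hkr A B => ?_⟩
  choose S T Tq h1 h2 h3 using exists_exec hl hlp hk hkr hK1 A B
  refine ⟨S, T, Tq, fun ω => ⟨(h1 ω).1, ?_⟩, h2, ?_⟩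
  · exact (Nat.cast_le.2 (h1 ω).2).trans (prepTime_le_log hl hlp hk hkr hK1)
  set D := K * Nat.clog 2 (p + r) with hD
  have hsub : {ω | ∃ (i : Fin p) (j : Fin r),
      250000 * (K : ℝ) * ((rowRadius A l : ℝ) + (colRadius B k : ℝ) + 1) < (Tq ω i j : ℝ)} ⊆
      {ω | ∃ v < p, ∃ u < p,
        ¬ SketchGood q D (coinRows q ω) (natPoints fun i m => A i m) v u} ∪
      {ω | ∃ v < r, ∃ u < r,
        ¬ SketchGood q D (coinRows q ω) (natPoints fun j m => B m j) v u} := by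
    rintro ω ⟨i, j, hlt⟩
    by_contra hcon
    rw [Set.mem_union, not_or] at hcon
    obtain ⟨g1, g2⟩ := hcon
    simp only [Set.mem_ofPred_eq, not_exists, not_and, not_not] at g1 g2
    have h := h3 ω g1 g2 i j
    have hR : (Tq ω i j : ℝ) ≤ 176000 * (rowRadius A l + colRadius B k + 1) := by exact_mod_cast h
    have hKR : (1 : ℝ) ≤ K := by exact_mod_cast hK1
    have h0 : (0 : ℝ) ≤ (rowRadius A l : ℝ) + colRadius B k + 1 := by positivity
    have := le_mul_of_one_le_left h0 hKR
    linarith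
  refine (measure_mono hsub).trans ((measure_union_le _ _).trans ?_)
  refine (add_le_add (coinMeasure_exists_not_sketchGood_le q D p _)
    (coinMeasure_exists_not_sketchGood_le q D r _)).trans ?_
  rw [← ENNReal.ofReal_add (by positivity) (by positivity)]
  refine ENNReal.ofReal_le_ofReal (le_trans ?_
    ((union_bound_le (by linarith) (show 2 ≤ p + r by omega) hK).trans_eq (by push_cast; rfl)))
  rw [← add_mul]
  push_cast
  gcongr
  -- Row pairs and column pairs together number p² + r² ≤ (p + r)².
  nlinarith [mul_nonneg (Nat.cast_nonneg (α := ℝ) p) (Nat.cast_nonneg (α := ℝ) r)]
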